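/- All digraphs are finite and loopless, without parallel arcs. Let $D=(V,A)$ be a digraph with $n$ vertices. A *comparability ordering* of $D$ is a linear order $\prec$ on $V$ such that for all $x\prec y\prec z$: $xy,yz\in A$ implies $xz\in A$, and $zy,yx\in A$ implies $zx\in A$; $D$ is a *comparability digraph* if it has one. $D$ is *semicomplete* if any two distinct vertices are joined by at least one arc. Let $Z_D=\{(x,y): xy\in A\text{ or }yx\in A\}$. For $(x,y),(x',y')\in Z_D$ write $(x,y)\,\Gamma\,(x',y')$ if one of the following holds: (i) $(x,y)=(x',y')$; (ii) $x=x'$, $y\ne y'$, and either $yx,x'y'\in A$, $yy'\notin A$, or $y'x',xy\in A$, $y'y\notin A$; (iii) $y=y'$, $x\neq x'$, and either $xy,y'x'\in A$, $xx'\notin A$, or $x'y',yx\in A$, $x'x\notin A$. The equivalence classes of the transitive closure of $\Gamma$ on $Z_D$ are the *implication classes* of $D$; put $I^{-1}=\{(y,x):(x,y)\in I\}$. **Algorithm 1.** Input: a semicomplete digraph $D$. 1. If $I=I^{-1}$ for some implication class $I$ of $D$, return "$D$ is not a comparability digraph". 2. Otherwise let $T=\emptyset$ and let $\mathcal I$ be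 the set of implication classes $I$ of $D$ with $|I|>1$. 3. While $\mathcal I\ne\emptyset$: if there are $(x,y),(y,z)\in T$ and $I\in\mathcal I$ with $(x,z)\in I$, choose such an $I$; otherwise choose an arbitrary $I\in\mathcal I$. Replace $T$ by $T\cup I$ and $\mathcal I$ by $\mathcal I\setminus\{I,I^{-1}\}$. 4. Return a vertex ordering $\prec$ such that $(x,y)\in T$ implies $x\prec y$. **Theorem.** Algorithm 1 can be implemented to run in $\mathcal O(n^3)$ time. This gives an $\mathcal O(n^3)$ recognition algorithm for semicomplete comparability digraphs. Precisely: there is a single program for a random access machine (unit cost per instruction, all numbers occurring in the computation polynomially bounded in $n$, i.e. of $\mathcal O(\log n)$ bits) that, given the adjacency lists of any digraph $D$ with $n$ vertices, halts after $\mathcal O(n^3)$ steps, and such that - if $D$ is semicomplete, then the computation carries out Algorithm 1 on $D$: it answers no if the test in step 1 succeeds; otherwise its memory holds, at successive times and in the form of an $n\times n$ matrix at an address depending only on $n$, the successive sets $T$ of an execution of Algorithm 1, and it answers yes and returns a vertex ordering that extends the final set $T$; moreover, an ordering returned is a comparability ordering of $D$; - for every $D$, it answers yes if $D$ is a semicomplete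 comparability digraph, and no otherwise. -/

import Mathlib

/-! ### Comparability digraphs, implication classes -/

namespace ComparabilityDigraph

variable {V : Type*}

/-- Digraphs here have no loops. -/
def IsLoopless (D : Digraph V) : Prop := ∀ x, ¬ D.Adj x x

/-- Any two distinct vertices are joined by at least one arc. -/
def IsSemicomplete (D : Digraph V) : Prop := ∀ x y, x ≠ y → D.Adj x y ∨ D.Adj y x

/-- `r` is a vertex ordering (a strict linear order on the vertices) such that for all
`x ≺ y ≺ z`, arcs `xy, yz` imply an arc `xz`, and arcs `zy, yx` imply an arc `zx`. -/
def IsComparabilityOrdering (D : Digraph V) (r : V → V → Prop) : Prop :=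
  IsStrictTotalOrder V r ∧
    ∀ x y z, r x y → r y z →
      (D.Adj x y → D.Adj y z → D.Adj x z) ∧ (D.Adj z y → D.Adj y x → D.Adj z x)

/-- A comparability digraph: a digraph with a comparability ordering. -/
def IsComparability (D : Digraph V) : Prop := ∃ r : V → V → Prop, IsComparabilityOrdering D r

/-- The set `Z_D` of ordered pairs of adjacent vertices. -/
def pairs (D : Digraph V) : Set (V × V) := {p | D.Adj p.1 p.2 ∨ D.Adj p.2 p.1}

/-- The relation `Γ` on `Z_D`: `(x, y)` directly forces `(x', y')`. -/
def DirectlyForces (D : Digraph V) (p q : V × V) : Prop :=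
  p ∈ pairs D ∧ q ∈ pairs D ∧
    ((p.1 = q.1 ∧ p.2 = q.2) ∨
     (p.1 = q.1 ∧ p.2 ≠ q.2 ∧
        ((D.Adj p.2 p.1 ∧ D.Adj q.1 q.2 ∧ ¬ D.Adj p.2 q.2) ∨
         (D.Adj q.2 q.1 ∧ D.Adj p.1 p.2 ∧ ¬ D.Adj q.2 p.2))) ∨
     (p.2 = q.2 ∧ p.1 ≠ q.1 ∧
        ((D.Adj p.1 p.2 ∧ D.Adj q.2 q.1 ∧ ¬ D.Adj p.1 q.1) ∨
         (D.Adj q.1 q.2 ∧ D.Adj p.2 p.1 ∧ ¬ D.Adj q.1 p.1))))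

/-- The implication class containing `p`: its class under the transitive closure of `Γ`. -/
def implicationClass (D : Digraph V) (p : V × V) : Set (V × V) :=
  {q | Relation.TransGen (DirectlyForces D) p q}

/-- The set of all implication classes of `D`. -/
def implicationClasses (D : Digraph V) : Set (Set (V × V)) :=
  {I | ∃ p ∈ pairs D, I = implicationClass D p}

/-- The inverse of a set of pairs. -/
def inverse (I : Set (V × V)) : Set (V × V) := {p | (p.2, p.1) ∈ I}

/-! ### The algorithm, as a nondeterministic procedure

If some implication class equals its inverse, the algorithm answers that the digraph is not a
comparability digraph. Otherwise it runs the loop below until the collection of remaining classes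
is empty, and then returns any vertex ordering that extends the set `T` of collected pairs. -/

/-- The two variables of the loop. -/
structure LoopState (V : Type*) where
  /-- the set `T` of collected pairs -/
  T : Set (V × V)
  /-- the collection of remaining implication classes -/
  remaining : Set (Set (V × V))

/-- The first test of the algorithm succeeds: some implication class equals its inverse. -/
def FirstTest (D : Digraph V) : Prop := ∃ I ∈ implicationClasses D, I = inverse I

/-- Initially `T = ∅` and all implication classes with more than one element remain. -/
def LoopState.init (D : Digraph V) : LoopState V where
  T := ∅
  remaining := {I ∈ implicationClasses D | 1 < I.encard}

/-- The class `I` contains a pair `(x, z)` with `(x, y), (y, z) ∈ T`. -/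
def HasPriority (T I : Set (V × V)) : Prop :=
  ∃ x y z, (x, y) ∈ T ∧ (y, z) ∈ T ∧ (x, z) ∈ I

/-- One pass through the loop body: choose a remaining class that has priority if there is one,
and an arbitrary remaining class otherwise; add it to `T`, and discard it and its inverse. -/
def LoopStep (s s' : LoopState V) : Prop :=
  ∃ I ∈ s.remaining,
    (HasPriority s.T I ∨ ¬ ∃ J ∈ s.remaining, HasPriority s.T J) ∧
    s' = { T := s.T ∪ I, remaining := s.remaining \ {I, inverse I} }

/-- `S 0, …, S k` is a complete execution of the loop. -/
def IsLoopExecution (D : Digraph V) (k : ℕ) (S : ℕ → LoopState V) : Prop :=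
  S 0 = LoopState.init D ∧ (∀ i < k, LoopStep (S i) (S (i + 1))) ∧ (S k).remaining = ∅

/-- The vertex ordering `p 0 ≺ p 1 ≺ ⋯ ≺ p (n - 1)`. -/
def listingOrder {n : ℕ} (p : Equiv.Perm (Fin n)) (x y : Fin n) : Prop := p.symm x < p.symm y

end ComparabilityDigraph

/-! ### Random access machines

Programs for a random access machine with registers and an addressable memory, both holding
natural numbers, with structured control flow. Every elementary instruction and every evaluation
of a test costs one step. -/

namespace RAM

/-- Tests compare two registers. -/
inductive Test where
  | lt (a b : ℕ)
  | eq (a b : ℕ)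

inductive Stmt where
  /-- do nothing -/
  | skip
  /-- `reg r := k` -/
  | const (r k : ℕ)
  /-- `reg r := reg a` -/
  | move (r a : ℕ)
  /-- `reg r := reg a + reg b` -/
  | add (r a b : ℕ)
  /-- `reg r := reg a - reg b`, truncated at zero -/
  | sub (r a b : ℕ)
  /-- `reg r := reg a * reg b` -/
  | mul (r a b : ℕ)
  /-- `reg r := mem (reg a)` -/
  | load (r a : ℕ)
  /-- `mem (reg a) := reg b` -/
  | store (a b : ℕ)
  | seq (s₁ s₂ : Stmt)
  | ite (t : Test) (s₁ s₂ : Stmt)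
  | loop (t : Test) (s : Stmt)

structure Store where
  reg : ℕ → ℕ
  mem : ℕ → ℕ

/-- The result of a test. -/
def Test.eval (σ : Store) : Test → Bool
  | .lt a b => decide (σ.reg a < σ.reg b)
  | .eq a b => decide (σ.reg a = σ.reg b)

def Store.setReg (σ : Store) (r v : ℕ) : Store := { σ with reg := Function.update σ.reg r v }

def Store.setMem (σ : Store) (i v : ℕ) : Store := { σ with mem := Function.update σ.mem i v }

/-- A configuration: the statements still to be executed, in order, and the store. -/
structure Config where
  todo : List Stmt
  store : Store

/-- The machine has halted when nothing is left to be executed. -/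
def Config.Halted (c : Config) : Prop := c.todo = []

/-- One step of the machine; a halted configuration does not change. -/
def step : Config → Config
  | ⟨[], σ⟩ => ⟨[], σ⟩
  | ⟨.skip :: K, σ⟩ => ⟨K, σ⟩
  | ⟨.const r k :: K, σ⟩ => ⟨K, σ.setReg r k⟩
  | ⟨.move r a :: K, σ⟩ => ⟨K, σ.setReg r (σ.reg a)⟩
  | ⟨.add r a b :: K, σ⟩ => ⟨K, σ.setReg r (σ.reg a + σ.reg b)⟩
  | ⟨.sub r a b :: K, σ⟩ => ⟨K, σ.setReg r (σ.reg a - σ.reg b)⟩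
  | ⟨.mul r a b :: K, σ⟩ => ⟨K, σ.setReg r (σ.reg a * σ.reg b)⟩
  | ⟨.load r a :: K, σ⟩ => ⟨K, σ.setReg r (σ.mem (σ.reg a))⟩
  | ⟨.store a b :: K, σ⟩ => ⟨K, σ.setMem (σ.reg a) (σ.reg b)⟩
  | ⟨.seq s₁ s₂ :: K, σ⟩ => ⟨s₁ :: s₂ :: K, σ⟩
  | ⟨.ite t s₁ s₂ :: K, σ⟩ => ⟨(if t.eval σ then s₁ else s₂) :: K, σ⟩
  | ⟨.loop t s :: K, σ⟩ => ⟨if t.eval σ then s :: .loop t s :: K else K, σ⟩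

/-- Initially the registers are zero and the memory holds the input word, followed by zeros. -/
def initial (P : Stmt) (w : List ℕ) : Config :=
  ⟨[P], { reg := fun _ => 0, mem := fun i => w.getD i 0 }⟩

/-- The configuration of the program `P` on the input word `w` after `t` steps. -/
def run (P : Stmt) (w : List ℕ) (t : ℕ) : Config := step^[t] (initial P w)

end RAM

/-! ### Input, output, and implementations of the algorithm -/

namespace ComparabilityDigraph

/-- `L` is a system of adjacency lists of `D`: `L x` lists, in any order and without
repetition, the out-neighbours of `x`. -/
def IsAdjacencyLists {n : ℕ} (D : Digraph (Fin n)) (L : Fin n → List (Fin n)) : Prop :=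
  ∀ x, (L x).Nodup ∧ ∀ y, y ∈ L x ↔ D.Adj x y

/-- The input word: the number `n` of vertices, followed, for each vertex `x = 0, …, n - 1`,
by the length of the adjacency list of `x` and the entries of this list. -/
def inputWord {n : ℕ} (L : Fin n → List (Fin n)) : List ℕ :=
  n :: (List.finRange n).flatMap fun x => (L x).length :: (L x).map Fin.val

/-- The answer no: 0 in register 0. -/
def AnswersNo (σ : RAM.Store) : Prop := σ.reg 0 = 0

/-- The answer yes: 1 in register 0. -/
def AnswersYes (σ : RAM.Store) : Prop := σ.reg 0 = 1

/-- The ordering `p 0 ≺ p 1 ≺ ⋯` is returned in consecutive memory cells, starting from the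
address in register 1. -/
def ReturnsOrdering {n : ℕ} (σ : RAM.Store) (p : Equiv.Perm (Fin n)) : Prop :=
  ∀ i : Fin n, σ.mem (σ.reg 1 + i) = p i

/-- The memory holds the set `T` of pairs as an `n × n` matrix, row by row from address `b`. -/
def HoldsPairs {n : ℕ} (σ : RAM.Store) (b : ℕ) (T : Set (Fin n × Fin n)) : Prop :=
  ∀ x y : Fin n, σ.mem (b + (x * n + y)) ≠ 0 ↔ (x, y) ∈ T

/-- The first `N` steps of the computation of `P` on the input word `w` carry out the algorithm
on `D`. Either the first test succeeds and the answer is no; or it fails, there is a complete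
execution `S 0, …, S k` of the loop such that at successive times `t 0 < ⋯ < t k ≤ N` the
memory holds the sets `T` of `S 0, …, S k` as matrices at address `b`, and the answer is yes
together with a vertex ordering that extends the final `T`. -/
def CarriesOut {n : ℕ} (P : RAM.Stmt) (w : List ℕ) (N b : ℕ) (D : Digraph (Fin n)) : Prop :=
  (FirstTest D ∧ AnswersNo (RAM.run P w N).store) ∨
  (¬ FirstTest D ∧ AnswersYes (RAM.run P w N).store ∧
    ∃ (k : ℕ) (S : ℕ → LoopState (Fin n)) (t : ℕ → ℕ),
      IsLoopExecution D k S ∧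
      (∀ i < k, t i < t (i + 1)) ∧ t k ≤ N ∧
      (∀ i ≤ k, HoldsPairs (RAM.run P w (t i)).store b (S i).T) ∧
      ∃ p : Equiv.Perm (Fin n), ReturnsOrdering (RAM.run P w N).store p ∧
        ∀ x y, (x, y) ∈ (S k).T → listingOrder p x y)

end ComparabilityDigraph

open ComparabilityDigraph

/-! A direct forcing says that `y` and `z` must lie on the same side of `x`: there are arcs `y → x →
z` or `z → x → y` without the arc joining the ends. So comparability orderings are the linear
extensions of acyclic sets `T` that contain, for every class `I` with several elements, exactly one
of `I` and its inverse; a class equal to its inverse excludes them. The point is that the algorithm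
never creates a cycle in `T`.

Two facts carry this. If `(x, y)` and `(y, z)` are collected and `(x, z)` is a pair of a remaining
class, then all arcs among `x, y, z` are present (`Sound.double_of_linked`). For such triples an
analogue of Gallai's triangle lemma holds (`Rainbow.of_equi`): when the pair `(x, z)` moves through
its class, the pairs joining its ends to `y` stay in their classes. Hence each pair of a class with
priority is already implied by two pairs of `T`, and adding the class keeps the transitive closure
(`acyclic_addClass_of_priority`). If no class has priority, a shortest closed walk in the enlarged
set has all arcs between its vertices; by the triangle lemma it uses the new class only once, and
its remaining part then contradicts the lack of priority (`acyclic_addClass_of_stable`).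

For the running time, `T` is kept both as a matrix and as a queue without repetition, so it has at
most `n²` entries. A class is closed under forcing by processing each queue entry once in linear
time. The search for a class with priority compares each entry with all vertices; since pairs never
become eligible again, its pointer never moves back, and the same holds for the pointer that looks
for an arbitrary remaining pair. One potential function pays for all three pointers. The test for
self-inverse classes is not made in advance: the loop runs in any case, and such a class exists if
and only if the final `T` contains a pair with its inverse (`LoopInvariant.conflict_iff`). -/

namespace ComparabilityDigraph

/-! ### Local structure: forcing among few vertices of a semicomplete digraph. -/

section Theory

variable {V : Type*} {D : Digraph V} {T : V → V → Prop}

/-- The pairs `(x, y)` and `(x, z)` are distinct and directly force each other. -/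
def Link (D : Digraph V) (x y z : V) : Prop :=
  y ≠ z ∧ ((D.Adj y x ∧ D.Adj x z ∧ ¬ D.Adj y z) ∨ (D.Adj z x ∧ D.Adj x y ∧ ¬ D.Adj z y))

/-- The arc `xy` is present, the arc `yx` is not. -/
def Single (D : Digraph V) (x y : V) : Prop := D.Adj x y ∧ ¬ D.Adj y x

/-- Both arcs `xy` and `yx` are present. -/
def Double (D : Digraph V) (x y : V) : Prop := D.Adj x y ∧ D.Adj y x

/-- The pair `(x, y)` directly forces some other pair. -/
def Linked (D : Digraph V) (x y : V) : Prop := ∃ u, Link D x y u ∨ Link D y x u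

theorem Link.symm {x y z : V} (h : Link D x y z) : Link D x z y := ⟨h.1.symm, h.2.symm⟩

theorem Linked.symm {x y : V} (h : Linked D x y) : Linked D y x := by
  obtain ⟨u, h⟩ := h
  exact ⟨u, h.symm⟩

theorem Double.symm {x y : V} (h : Double D x y) : Double D y x := ⟨h.2, h.1⟩

theorem single_or_double (hS : IsSemicomplete D) {x y : V} (h : x ≠ y) :
    Single D x y ∨ Single D y x ∨ Double D x y := by
  have := hS x y h
  unfold Single Double
  tauto

/-- The arcs `c → b → a` are present and `c → a` is missing, so `b` cannot lie between `a` and `c`.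
-/
theorem Link.of_double {b a c : V} (h₁ : Double D b a) (h₂ : Double D b c)
    (h : Single D a c) : Link D b a c :=
  ⟨by rintro rfl; exact h.2 h.1, Or.inr ⟨h₂.2, h₁.1, h.2⟩⟩

/-- The paths `a → b → c` and `b → c → a` both lack the arc joining their ends, so neither `b` nor
`c` can be in the middle: `a` is forced to lie between them. -/
theorem Link.of_path {a b c : V} (h : Double D b c) (h₁ : Single D c a) (h₂ : Single D a b) :
    Link D b a c ∧ Link D c a b :=
  ⟨⟨by rintro rfl; exact h₁.2 h₁.1, Or.inl ⟨h₂.1, h.1, h₁.2⟩⟩,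
   ⟨by rintro rfl; exact h₂.2 h₂.1, Or.inr ⟨h.1, h₁.1, h₂.2⟩⟩⟩

/-- No three vertices form a cycle of single arcs. -/
def NoSingleTriangle (D : Digraph V) : Prop :=
  ∀ a b c, Single D a b → Single D b c → Single D c a → False

/-- An asymmetric set of pairs that is a union of implication classes with several elements. -/
structure Sound (D : Digraph V) (T : V → V → Prop) : Prop where
  left : ∀ {x y z}, Link D x y z → T x y → T x z
  right : ∀ {x y z}, Link D x y z → T y x → T z x
  asymm : ∀ {x y}, T x y → ¬ T y x
  linked : ∀ {x y}, T x y → Linked D x y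

theorem Sound.swap (h : Sound D T) : Sound D (fun x y => T y x) :=
  ⟨h.right, h.left, h.asymm, fun hx => (h.linked hx).symm⟩

theorem Sound.ne (h : Sound D T) {x y : V} (hx : T x y) : x ≠ y := by
  rintro rfl
  exact h.asymm hx hx

/-- The digraph with all arcs reversed. -/
def reverse (D : Digraph V) : Digraph V := ⟨fun x y => D.Adj y x⟩

/-- Reversing all arcs exchanges the two alternatives of `Link`, so forcing does not change. Later
this disposes of half of the cases, with the same `T`. -/
theorem link_reverse {x y z : V} : Link (reverse D) x y z ↔ Link D x y z := by
  simp only [Link, reverse]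
  tauto

theorem single_reverse {x y : V} : Single (reverse D) x y ↔ Single D y x := Iff.rfl

theorem IsSemicomplete.reverse (h : IsSemicomplete D) : IsSemicomplete (reverse D) :=
  fun x y hxy => (h x y hxy).symm

theorem NoSingleTriangle.reverse (h : NoSingleTriangle D) : NoSingleTriangle (reverse D) :=
  fun a b c h₁ h₂ h₃ => h c b a h₂ h₁ h₃

theorem linked_reverse {x y : V} : Linked (reverse D) x y ↔ Linked D x y := by
  simp only [Linked, link_reverse]

theorem Sound.reverse (h : Sound D T) : Sound (reverse D) T :=
  ⟨fun hl => h.left (link_reverse.1 hl), fun hl => h.right (link_reverse.1 hl), h.asymm,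
    fun hx => linked_reverse.2 (h.linked hx)⟩

/-- The two ways in which a single arc can lie in an implication class with several elements. -/
theorem Linked.cases (hS : IsSemicomplete D) (hC : NoSingleTriangle D)
    {x y : V} (hl : Linked D x y) (hxy : Single D x y) :
    (∃ u, Double D x u ∧ Single D y u) ∨ (∃ u, Double D u y ∧ Single D u x) := by
  obtain ⟨u, ⟨hne, h | h⟩ | ⟨hne, h | h⟩⟩ := hl
  · exact absurd h.1 hxy.2
  · left
    have h₁ : D.Adj y u := (hS y u hne).resolve_right h.2.2
    refine ⟨u, ⟨?_, h.1⟩, h₁, h.2.2⟩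
    by_contra h₂
    exact hC x y u hxy ⟨h₁, h.2.2⟩ ⟨h.1, h₂⟩
  · right
    have h₁ : D.Adj u x := (hS x u hne).resolve_left h.2.2
    refine ⟨u, ⟨?_, h.2.1⟩, h₁, h.2.2⟩
    by_contra h₂
    exact hC x y u hxy ⟨h.2.1, h₂⟩ ⟨h₁, h.2.2⟩
  · exact absurd h.2.1 hxy.2

theorem Single.ne {x y : V} (h : Single D x y) : x ≠ y := by
  rintro rfl
  exact h.2 h.1

/-- This and `Sound.of_path` are the transfer rules of all case analyses below: once the arcs among
the vertices are known, suitable instances make the contradiction propositional, and `grind` finds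
it. -/
theorem Sound.of_double (hT : Sound D T) {b a c : V} (h₁ : Double D b a) (h₂ : Double D b c)
    (h : Single D a c ∨ Single D c a) : (T b a ↔ T b c) ∧ (T a b ↔ T c b) := by
  have hl : Link D b a c := h.elim (Link.of_double h₁ h₂) fun h => (Link.of_double h₂ h₁ h).symm
  exact ⟨⟨hT.left hl, hT.left hl.symm⟩, hT.right hl, hT.right hl.symm⟩

theorem Sound.of_path (hT : Sound D T) {a b c : V} (h : Double D b c) (h₁ : Single D c a)
    (h₂ : Single D a b) : (T b a ↔ T b c) ∧ (T a b ↔ T c b) ∧ (T c a ↔ T c b) ∧ (T a c ↔ T b c) := by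
  obtain ⟨p, q⟩ := Link.of_path h h₁ h₂
  exact ⟨⟨hT.left p, hT.left p.symm⟩, ⟨hT.right p, hT.right p.symm⟩,
    ⟨hT.left q, hT.left q.symm⟩, hT.right q, hT.right q.symm⟩

/-- The pair `(x, y)` is linked through some vertex `u` as in `Linked.cases`. Comparing `z` with
`u`, and then with `x`, every configuration but the two listed either closes a triangle of single
arcs or transports `T x y` to one of the excluded pairs `(z, y)`, `(x, z)`. -/
theorem Sound.single_single (hT : Sound D T) (hS : IsSemicomplete D) (hC : NoSingleTriangle D)
    {x y z : V} (hxy : Single D x y) (hzy : Single D z y) (hne : x ≠ z) (h : T x y)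
    (h₁ : ¬ T z y) (h₂ : ¬ T x z) :
    Single D z x ∨ (Double D x z ∧ ∃ u, Single D z u ∧ Single D u x ∧ T z u ∧ T u x) := by
  rcases (hT.linked h).cases hS hC hxy with ⟨u, hxu, hyu⟩ | ⟨u, huy, hux⟩
  · have p := hT.of_path hxu.symm hxy hyu
    have hzu : z ≠ u := by
      rintro rfl
      exact hzy.2 hyu.1
    rcases single_or_double hS hzu with hz | hz | hz
    · rcases single_or_double hS hne with hx | hx | hx
      · have q := hT.of_path hxu.symm hx hz
        grind
      · exact Or.inl hx
      · have q := hT.of_double hx hxu (Or.inl hz)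
        grind
    · exact (hC z y u hzy hyu hz).elim
    · have q := hT.of_path hz.symm hzy hyu
      grind
  · have p := hT.of_path huy.symm hux hxy
    have hzu : z ≠ u := by
      rintro rfl
      exact hzy.2 huy.2
    rcases single_or_double hS hzu with hz | hz | hz
    · rcases single_or_double hS hne with hx | hx | hx
      · exact (hC x z u hx hz hux).elim
      · exact Or.inl hx
      · have q := hT.of_path hx hz hux
        exact Or.inr ⟨hx, u, hz, hux, by grind, by grind⟩
    · have q := hT.of_path huy.symm hz hzy
      grind
    · have r := hT.of_double huy hz.symm (Or.inr hzy)
      rcases single_or_double hS hne with hx | hx | hx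
      · have q := hT.of_path hz hux hx
        grind
      · exact Or.inl hx
      · have q := hT.of_double hz hx.symm (Or.inl hux)
        have := hT.asymm h
        grind

/-- Two arcs of an asymmetric union of classes that point to a common region from outside cannot
occur with opposite orientations. -/
theorem Sound.no_turn (hT : Sound D T) (hS : IsSemicomplete D) (hC : NoSingleTriangle D)
    {x y y' z : V} (hxy : Single D x y) (hzy : Single D z y) (hxy' : Single D x y')
    (hzy' : Single D z y') (hne : x ≠ z) (h : T x y) (h' : T y' z)
    (h₁ : ¬ T z y) (h₂ : ¬ T y' x) (h₃ : ¬ T x z) : False := by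
  have a := hT.single_single hS hC hxy hzy hne h h₁ h₃
  -- The same statement for the inverse of `T`, with `x` and `z` exchanged.
  have b := hT.swap.single_single hS hC hzy' hxy' hne.symm h' h₂ h₃
  rcases a with a | ⟨a, u, hu⟩ <;> rcases b with b | ⟨b, v, hv⟩
  · exact a.2 b.1
  · exact a.2 b.2
  · exact b.2 a.2
  -- The single arcs `z → u → x → v → z` form a four-cycle. A single arc between `u` and `v` closes
  -- a triangle of single arcs; a double one forces both `T u v` and `T v u`.
  · have huv : u ≠ v := by
      rintro rfl
      exact hu.1.2 hv.2.1.1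
    rcases single_or_double hS huv with c | c | c
    · exact hC _ _ _ c hv.2.1 hu.1
    · exact hC _ _ _ c hu.2.1 hv.1
    · have q := hT.of_path c hv.2.1 hu.1
      have e₁ := hT.asymm hu.2.2.1
      have e₂ := hT.asymm hv.2.2.2
      grind

/-- If `(x, y), (y, z)` are collected, but neither `(x, z)` nor its inverse is, and `(x, z)` lies
in a class with several elements, then all arcs between the three vertices are present. -/
theorem Sound.single_path (hT : Sound D T) (hS : IsSemicomplete D) (hC : NoSingleTriangle D)
    {p q r : V} (hpq : T p q) (hqr : T q r) (hpr : ¬ T p r) (hrp : ¬ T r p)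
    (hl : Linked D p r) (h₁ : Single D p q) (h₂ : Single D q r ∨ Double D q r)
    (h₃ : Single D p r) : False := by
  rcases hl.cases hS hC h₃ with ⟨u, hpu, hru⟩ | ⟨u, hur, hup⟩
  · have a := hT.of_path hpu.symm h₃ hru
    have hqu : q ≠ u := by
      rintro rfl
      exact h₁.2 hpu.2
    rcases single_or_double hS hqu with b | b | b
    · have c := hT.of_path hpu.symm h₁ b
      grind
    · rcases h₂ with h₂ | h₂
      · exact hC _ _ _ b h₂ hru
      · have c := hT.of_path h₂ hru b
        grind
    · have c := hT.of_double hpu.symm b.symm (Or.inl h₁)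
      rcases h₂ with h₂ | h₂
      · have d := hT.of_path b.symm h₂ hru
        grind
      · have d := hT.of_double h₂ b (Or.inl hru)
        grind
  · have a := hT.of_path hur.symm hup h₃
    have hqu : q ≠ u := by
      rintro rfl
      exact h₁.2 hup.1
    rcases single_or_double hS hqu with b | b | b
    · exact hC _ _ _ b hup h₁
    · rcases h₂ with h₂ | h₂
      · have d := hT.of_path hur.symm b h₂
        grind
      · have d := hT.of_double hur.symm h₂.symm (Or.inl b)
        grind
    · have d := hT.of_path b hup h₁
      grind

/-- This provides the complete triples to which the triangle lemma applies. A single arc between any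
two of the three vertices would, by the transfer rules, decide the pair `(p, r)` or violate
asymmetry. -/
theorem Sound.double_of_linked (hT : Sound D T) (hS : IsSemicomplete D) (hC : NoSingleTriangle D)
    {p q r : V} (hpq : T p q) (hqr : T q r) (hpr : ¬ T p r) (hrp : ¬ T r p)
    (hl : Linked D p r) : Double D p q ∧ Double D q r ∧ Double D p r := by
  have hne : p ≠ r := by
    rintro rfl
    exact hT.asymm hpq hqr
  -- The digraph is left variable so that the reversed digraph covers a single arc from `q` to `p`.
  have aux : ∀ {D : Digraph V}, Sound D T → IsSemicomplete D → NoSingleTriangle D → Linked D p r →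
      Single D p q → False := by
    intro D hT hS hC hl h₁
    rcases single_or_double hS (hT.ne hqr) with h₂ | h₂ | h₂
    · rcases single_or_double hS hne with h₃ | h₃ | h₃
      · exact hT.single_path hS hC hpq hqr hpr hrp hl h₁ (Or.inl h₂) h₃
      · exact hC _ _ _ h₁ h₂ h₃
      · have := hT.of_path h₃.symm h₁ h₂
        grind
    · exact hT.no_turn hS hC h₁ h₂ h₁ h₂ hne hpq hqr (hT.asymm hqr) (hT.asymm hpq) hpr
    · rcases single_or_double hS hne with h₃ | h₃ | h₃
      · exact hT.single_path hS hC hpq hqr hpr hrp hl h₁ (Or.inr h₂) h₃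
      · have := hT.of_path h₂ h₃ h₁
        grind
      · have := hT.of_double h₃.symm h₂.symm (Or.inl h₁)
        grind
  have aux₂ : ∀ {D : Digraph V}, Sound D T → IsSemicomplete D → NoSingleTriangle D → Linked D p r →
      Double D p q → Single D q r → False := by
    intro D hT hS hC hl h₁ h₂
    rcases single_or_double hS hne with h₃ | h₃ | h₃
    -- Inverting `T` turns the path `p, q, r` into `r, q, p`; reversing the digraph makes the single
    -- arc `q → r` start at `r`, as `Sound.single_path` requires.
    · exact hT.swap.reverse.single_path hS.reverse hC.reverse hqr hpq hpr hrp
        (linked_reverse.2 hl.symm) h₂ (Or.inr h₁) h₃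
    · have := hT.of_path h₁ h₂ h₃
      grind
    · have := hT.of_double h₃ h₁ (Or.inr h₂)
      grind
  rcases single_or_double hS (hT.ne hpq) with h₁ | h₁ | h₁
  · exact (aux hT hS hC hl h₁).elim
  · exact (aux hT.reverse hS.reverse hC.reverse (linked_reverse.2 hl) h₁).elim
  rcases single_or_double hS (hT.ne hqr) with h₂ | h₂ | h₂
  · exact (aux₂ hT hS hC hl h₁ h₂).elim
  · exact (aux₂ hT.reverse hS.reverse hC.reverse (linked_reverse.2 hl) h₁.symm h₂).elim
  rcases single_or_double hS hne with h₃ | h₃ | h₃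
  · have := hT.of_double h₁.symm h₂ (Or.inl h₃)
    have := hT.asymm hpq
    grind
  · have := hT.of_double h₁.symm h₂ (Or.inr h₃)
    have := hT.asymm hpq
    grind
  · exact ⟨h₁, h₂, h₃⟩

end Theory
end ComparabilityDigraph

namespace ComparabilityDigraph

/-! ### Implication classes and the triangle lemma. -/

section Classes

variable {V : Type*} {D : Digraph V} {T : V → V → Prop}

theorem Link.mem_pairs {x y z : V} (h : Link D x y z) : (x, y) ∈ pairs D ∧ (x, z) ∈ pairs D := by
  simp only [pairs, Set.mem_ofPred_eq]
  have := h.2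
  tauto

/-- Both proper clauses of `Γ` are the same ternary relation `Link`, read at the common first or the
common second entry; adjacency of the pairs then comes for free. -/
theorem directlyForces_iff {p q : V × V} :
    DirectlyForces D p q ↔ (p = q ∧ p ∈ pairs D) ∨ (p.1 = q.1 ∧ Link D p.1 p.2 q.2) ∨
      (p.2 = q.2 ∧ Link D p.2 p.1 q.1) := by
  obtain ⟨x, y⟩ := p
  obtain ⟨x', y'⟩ := q
  simp only [DirectlyForces, Link, pairs, Set.mem_ofPred_eq, Prod.mk.injEq]
  constructor
  · rintro ⟨h₁, h₂, ⟨rfl, rfl⟩ | ⟨rfl, h₃, h₄⟩ | ⟨rfl, h₃, h₄⟩⟩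
    · exact Or.inl ⟨⟨rfl, rfl⟩, h₁⟩
    · exact Or.inr (Or.inl ⟨rfl, h₃, by tauto⟩)
    · exact Or.inr (Or.inr ⟨rfl, h₃, by tauto⟩)
  · rintro (⟨⟨rfl, rfl⟩, h⟩ | ⟨rfl, h₃, h₄⟩ | ⟨rfl, h₃, h₄⟩)
    · exact ⟨h, h, Or.inl ⟨rfl, rfl⟩⟩
    · exact ⟨by tauto, by tauto, Or.inr (Or.inl ⟨rfl, h₃, by tauto⟩)⟩
    · exact ⟨by tauto, by tauto, Or.inr (Or.inr ⟨rfl, h₃, by tauto⟩)⟩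

theorem Link.left {x y z : V} (h : Link D x y z) : DirectlyForces D (x, y) (x, z) :=
  directlyForces_iff.2 (Or.inr (Or.inl ⟨rfl, h⟩))

theorem Link.right {x y z : V} (h : Link D x y z) : DirectlyForces D (y, x) (z, x) :=
  directlyForces_iff.2 (Or.inr (Or.inr ⟨rfl, h⟩))

theorem DirectlyForces.symm {p q : V × V} (h : DirectlyForces D p q) : DirectlyForces D q p := by
  obtain ⟨x, y⟩ := p
  obtain ⟨x', y'⟩ := q
  rcases directlyForces_iff.1 h with ⟨h, hp⟩ | ⟨h, hl⟩ | ⟨h, hl⟩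
  · obtain ⟨rfl, rfl⟩ := Prod.mk.inj h
    exact directlyForces_iff.2 (Or.inl ⟨rfl, hp⟩)
  · obtain rfl : x = x' := h
    exact hl.symm.left
  · obtain rfl : y = y' := h
    exact hl.symm.right

theorem DirectlyForces.swap {p q : V × V} (h : DirectlyForces D p q) :
    DirectlyForces D p.swap q.swap := by
  obtain ⟨x, y⟩ := p
  obtain ⟨x', y'⟩ := q
  rcases directlyForces_iff.1 h with ⟨h, hp⟩ | ⟨h, hl⟩ | ⟨h, hl⟩
  · obtain ⟨rfl, rfl⟩ := Prod.mk.inj h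
    exact directlyForces_iff.2 (Or.inl ⟨rfl, Or.symm hp⟩)
  · obtain rfl : x = x' := h
    exact hl.right
  · obtain rfl : y = y' := h
    exact hl.left

/-- Two pairs lie in the same implication class. -/
abbrev Equi (D : Digraph V) (p q : V × V) : Prop := Relation.TransGen (DirectlyForces D) p q

theorem Equi.refl {p : V × V} (hp : p ∈ pairs D) : Equi D p p :=
  .single (directlyForces_iff.2 (Or.inl ⟨rfl, hp⟩))

theorem Equi.symm {p q : V × V} (h : Equi D p q) : Equi D q p := by
  induction h with
  | single h => exact .single h.symm
  | tail _ h ih => exact .trans (.single h.symm) ih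

theorem Equi.swap {p q : V × V} (h : Equi D p q) : Equi D p.swap q.swap := by
  induction h with
  | single h => exact .single h.swap
  | tail _ h ih => exact .tail ih h.swap

theorem Equi.flip {x y x' y' : V} (h : Equi D (x, y) (x', y')) : Equi D (y, x) (y', x') :=
  Equi.swap h

theorem Equi.mem_pairs {p q : V × V} (h : Equi D p q) : p ∈ pairs D ∧ q ∈ pairs D := by
  induction h with
  | single h => exact ⟨h.1, h.2.1⟩
  | tail _ h ih => exact ⟨ih.1, h.2.1⟩

theorem Link.equi_left {x y z : V} (h : Link D x y z) : Equi D (x, y) (x, z) := .single h.left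

theorem Link.equi_right {x y z : V} (h : Link D x y z) : Equi D (y, x) (z, x) := .single h.right

theorem Sound.of_equi (hT : Sound D T) {p q : V × V} (h : Equi D p q) (hp : T p.1 p.2) :
    T q.1 q.2 := by
  have step : ∀ {p q : V × V}, DirectlyForces D p q → T p.1 p.2 → T q.1 q.2 := by
    rintro ⟨x, y⟩ ⟨x', y'⟩ h hp
    rcases directlyForces_iff.1 h with ⟨h, _⟩ | ⟨h, hl⟩ | ⟨h, hl⟩
    · obtain ⟨rfl, rfl⟩ := Prod.mk.inj h
      exact hp
    · obtain rfl : x = x' := h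
      exact hT.left hl hp
    · obtain rfl : y = y' := h
      exact hT.right hl hp
  induction h with
  | single h => exact step h hp
  | tail _ h ih => exact step h ih

theorem Linked.of_equi {p q : V × V} (h : Equi D p q) (hp : Linked D p.1 p.2) :
    Linked D q.1 q.2 := by
  have step : ∀ {p q : V × V}, DirectlyForces D p q → Linked D p.1 p.2 → Linked D q.1 q.2 := by
    rintro ⟨x, y⟩ ⟨x', y'⟩ h hp
    rcases directlyForces_iff.1 h with ⟨h, _⟩ | ⟨h, hl⟩ | ⟨h, hl⟩
    · obtain ⟨rfl, rfl⟩ := Prod.mk.inj h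
      exact hp
    · obtain rfl : x = x' := h
      exact ⟨_, Or.inl hl.symm⟩
    · obtain rfl : y = y' := h
      exact ⟨_, Or.inr hl.symm⟩
  induction h with
  | single h => exact step h hp
  | tail _ h ih => exact step h ih

/-- No implication class contains a pair together with its inverse. -/
def NoSelfInverse (D : Digraph V) : Prop := ∀ x y, ¬ Equi D (x, y) (y, x)

/-- On a triangle of single arcs every vertex sees the other two on the same side, which chains `(a,
b)`, `(a, c)`, `(b, c)`, `(b, a)` into one class. -/
theorem NoSelfInverse.noSingleTriangle (h : NoSelfInverse D) : NoSingleTriangle D := by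
  intro a b c hab hbc hca
  have h₁ : Link D a b c := ⟨hbc.ne, Or.inr ⟨hca.1, hab.1, hbc.2⟩⟩
  have h₂ : Link D c a b := ⟨hab.ne, Or.inr ⟨hbc.1, hca.1, hab.2⟩⟩
  have h₃ : Link D b c a := ⟨hca.ne, Or.inr ⟨hab.1, hbc.1, hca.2⟩⟩
  exact h a b (h₁.equi_left.trans (h₂.equi_right.trans h₃.equi_left))

/-- Arcs between all of `a, b, c`, and the only coincidences among the classes of `(b, c)`,
`(a, b)`, `(a, c)` and their inverses that are allowed are those of `(a, b)` with `(b, c)` and of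
`(a, c)` with `(c, b)`. -/
structure Rainbow (D : Digraph V) (a b c : V) : Prop where
  bc : Double D b c
  ab : Double D a b
  ac : Double D a c
  h₁ : ¬ Equi D (b, c) (a, c)
  h₂ : ¬ Equi D (a, b) (a, c)
  h₃ : ¬ Equi D (b, c) (b, a)

theorem Rainbow.swap {a b c : V} (h : Rainbow D a b c) : Rainbow D a c b :=
  ⟨h.bc.symm, h.ac, h.ab, fun e => h.h₃ e.flip, fun e => h.h₂ e.symm, fun e => h.h₁ e.flip⟩

/-- One step of the triangle lemma, replacing `b` by `b'`. Since `bc` is double, the link at `c`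
makes the arc between `b` and `b'` single. If `b'c` and `ab'` are double as well, this arc also
links `(a, b)` with `(a, b')`. Any other configuration identifies two classes that the hypothesis
keeps apart. -/
theorem Rainbow.link (hS : IsSemicomplete D) {a b c b' : V} (h : Rainbow D a b c)
    (hl : Link D c b b') : Rainbow D a b' c ∧ Equi D (a, b) (a, b') := by
  have key : Double D b' c ∧ Double D a b' ∧ Link D a b b' := by
    have hs : Single D b b' ∨ Single D b' b := by
      have := hS b b' hl.1
      rcases hl.2 with h | h
      · exact Or.inr ⟨by tauto, h.2.2⟩
      · exact Or.inl ⟨by tauto, h.2.2⟩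
    have hab' : a ≠ b' := by
      rintro rfl
      rcases hs with hs | hs
      · exact hs.2 h.ab.1
      · exact hs.2 h.ab.2
    by_cases hd : Double D b' c
    · rcases single_or_double hS hab' with e | e | e
      · have := Link.of_double h.ac.symm hd.symm e
        exact (h.h₁ (hl.equi_right.trans this.symm.equi_right)).elim
      · have := Link.of_double hd.symm h.ac.symm e
        exact (h.h₁ (hl.equi_right.trans this.equi_right)).elim
      · refine ⟨hd, e, ?_⟩
        rcases hs with hs | hs
        · exact Link.of_double h.ab e hs
        · exact (Link.of_double e h.ab hs).symm
    · exfalso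
      -- If `b'c` is not double, then `b'` is the middle of a path of single arcs between `b` and
      -- `c`.
      have hp : (Single D c b' ∧ Single D b' b) ∨ (Single D b b' ∧ Single D b' c) := by
        have hx := h.bc
        have := hl.2
        unfold Double at hd hx
        unfold Single at hs ⊢
        tauto
      rcases single_or_double hS hab' with e | e | e
      · rcases hp with ⟨p, q⟩ | ⟨p, q⟩
        · have l₁ := Link.of_path h.bc p q
          have l₂ := Link.of_path h.ab.symm e q
          exact h.h₃ (l₁.1.symm.equi_left.trans l₂.1.equi_left)
        · have l₂ := (Link.of_path h.ac.symm e q).1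
          exact h.h₁ (hl.equi_right.trans l₂.equi_right)
      · rcases hp with ⟨p, q⟩ | ⟨p, q⟩
        · have l₂ := (Link.of_path h.ac p e).2
          exact h.h₁ (hl.equi_right.trans l₂.equi_right)
        · have l₁ := Link.of_path h.bc.symm p q
          have l₂ := Link.of_path h.ab p e
          exact h.h₃ (l₁.2.symm.equi_left.trans l₂.2.equi_left)
      · have l₁ : Link D a b b' := by
          rcases hs with hs | hs
          · exact Link.of_double h.ab e hs
          · exact (Link.of_double e h.ab hs).symm
        have l₂ : Link D a b' c := by
          rcases hp with ⟨p, q⟩ | ⟨p, q⟩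
          · exact (Link.of_double h.ac e p).symm
          · exact Link.of_double e h.ac q
        exact h.h₂ (l₁.equi_left.trans l₂.equi_left)
  refine ⟨⟨key.1, key.2.1, h.ac, fun e => h.h₁ (hl.equi_right.trans e),
    fun e => h.h₂ (key.2.2.equi_left.trans e),
    fun e => h.h₃ (hl.equi_right.trans (e.trans key.2.2.symm.equi_right))⟩, key.2.2.equi_left⟩

/-- The triangle lemma. -/
theorem Rainbow.of_equi (hS : IsSemicomplete D) {a b c : V} (h : Rainbow D a b c) {q : V × V}
    (hq : Equi D (b, c) q) :
    Rainbow D a q.1 q.2 ∧ Equi D (a, b) (a, q.1) ∧ Equi D (a, c) (a, q.2) := by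
  have step : ∀ {b c : V} {q : V × V}, Rainbow D a b c → DirectlyForces D (b, c) q →
      Rainbow D a q.1 q.2 ∧ Equi D (a, b) (a, q.1) ∧ Equi D (a, c) (a, q.2) := by
    rintro b c ⟨b', c'⟩ h hf
    have e₁ : Equi D (a, b) (a, b) := .refl (Or.inl h.ab.1)
    have e₂ : Equi D (a, c) (a, c) := .refl (Or.inl h.ac.1)
    rcases directlyForces_iff.1 hf with ⟨hf, _⟩ | ⟨hf, hl⟩ | ⟨hf, hl⟩
    · obtain ⟨rfl, rfl⟩ := Prod.mk.inj hf
      exact ⟨h, e₁, e₂⟩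
    · obtain rfl : b = b' := hf
      -- Replacing `c` is replacing `b` in the swapped triple: the three excluded coincidences are
      -- permuted by the swap.
      exact ⟨(h.swap.link hS hl).1.swap, e₁, (h.swap.link hS hl).2⟩
    · obtain rfl : c = c' := hf
      exact ⟨(h.link hS hl).1, (h.link hS hl).2, e₂⟩
  induction hq with
  | single hf => exact step h hf
  | tail _ hf ih =>
    obtain ⟨i₁, i₂, i₃⟩ := ih
    obtain ⟨j₁, j₂, j₃⟩ := step i₁ hf
    exact ⟨j₁, i₂.trans j₂, i₃.trans j₃⟩

end Classes

/-! ### Shortest closed walks in a sound set. -/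

section Cycles

variable {V : Type*} {D : Digraph V} {T : V → V → Prop}

/-- A closed walk of length `k`, continued periodically. -/
structure IsClosedWalk (T : V → V → Prop) (k : ℕ) (c : ℕ → V) : Prop where
  pos : 0 < k
  periodic : ∀ i, c (i + k) = c i
  step : ∀ i, T (c i) (c (i + 1))

theorem IsClosedWalk.of_segment {k : ℕ} {c : ℕ → V} (hk : 0 < k) (h : ∀ i, i + 1 < k → T (c i) (c (i + 1)))
    (h' : T (c (k - 1)) (c 0)) : IsClosedWalk T k (fun i => c (i % k)) := by
  refine ⟨hk, fun i => by simp, fun i => ?_⟩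
  have hlt := Nat.mod_lt i hk
  by_cases hi : i % k + 1 < k
  · have : (i + 1) % k = i % k + 1 := by
      rw [Nat.add_mod, Nat.mod_eq_of_lt (show 1 < k by omega), Nat.mod_eq_of_lt hi]
    simp only [this]
    exact h _ hi
  · have h1 : i % k = k - 1 := by omega
    have : (i + 1) % k = 0 := by
      rw [← Nat.mod_add_mod, h1, Nat.sub_add_cancel hk, Nat.mod_self]
    simp only [this, h1]
    exact h'

theorem exists_isClosedWalk {x : V} (h : Relation.TransGen T x x) :
    ∃ k c, IsClosedWalk T k c := by
  have : ∀ y, Relation.TransGen T x y → ∃ k, 0 < k ∧ ∃ c : ℕ → V, c 0 = x ∧ T (c (k - 1)) y ∧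
      ∀ i, i + 1 < k → T (c i) (c (i + 1)) := by
    intro y h
    induction h with
    | single h => exact ⟨1, one_pos, fun _ => x, rfl, h, fun i hi => by omega⟩
    | @tail b c' _ h ih =>
      obtain ⟨k, hk, c, h0, h1, h2⟩ := ih
      refine ⟨k + 1, by omega, fun i => if i < k then c i else b, ?_, ?_, ?_⟩
      · simpa [hk] using h0
      · simpa using h
      · intro i hi
        by_cases hik : i + 1 < k
        · simpa [hik, show i < k by omega] using h2 i hik
        · obtain rfl : i = k - 1 := by omega
          simpa [show k - 1 < k by omega, show k - 1 + 1 = k by omega] using h1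
  obtain ⟨k, hk, c, h0, h1, h2⟩ := this x h
  exact ⟨k, _, .of_segment hk h2 (by rw [h0]; exact h1)⟩

theorem IsClosedWalk.shift {k : ℕ} {c : ℕ → V} (h : IsClosedWalk T k c) (m : ℕ) :
    IsClosedWalk T k (fun i => c (i + m)) :=
  ⟨h.pos, fun i => by simpa [add_right_comm] using h.periodic (i + m),
    fun i => by simpa [add_right_comm] using h.step (i + m)⟩

/-- A closed walk of minimal length. -/
structure IsShortest (T : V → V → Prop) (k : ℕ) (c : ℕ → V) : Prop extends
    IsClosedWalk T k c where
  min : ∀ m c', IsClosedWalk T m c' → k ≤ m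

theorem exists_isShortest {x : V} (h : Relation.TransGen T x x) : ∃ k c, IsShortest T k c := by
  classical
  have h := exists_isClosedWalk h
  obtain ⟨c, hc⟩ := Nat.find_spec h
  exact ⟨_, c, hc, fun m c' h' => Nat.find_min' h ⟨c', h'⟩⟩

theorem IsShortest.shift {k : ℕ} {c : ℕ → V} (h : IsShortest T k c) (m : ℕ) :
    IsShortest T k (fun i => c (i + m)) := ⟨h.toIsClosedWalk.shift m, h.min⟩

/-- The segment from `c i` to `c j` together with this pair would be a closed walk of length `j - i
+ 1 < k`. -/
theorem IsShortest.not_back {k : ℕ} {c : ℕ → V} (h : IsShortest T k c) {i j : ℕ} (hij : i ≤ j)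
    (hk : j + 1 < i + k) : ¬ T (c j) (c i) := by
  intro ht
  have := h.min (j - i + 1) _ (IsClosedWalk.of_segment (T := T) (c := fun m => c (i + m))
    (by omega) (fun m _ => h.step (i + m)) (by
      simpa [show i + (j - i) = j by omega] using ht))
  omega

/-- By periodicity a chord from `c i` to `c j` is a backward pair from `c (i + k)` to `c j`. -/
theorem IsShortest.not_chord {k : ℕ} {c : ℕ → V} (h : IsShortest T k c) {i j : ℕ} (hij : i + 2 ≤ j)
    (hk : j ≤ i + k) : ¬ T (c i) (c j) := by
  rw [← h.periodic i]
  exact h.not_back hk (by omega)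

theorem IsShortest.three_le {k : ℕ} {c : ℕ → V} (h : IsShortest T k c) (hT : Sound D T) :
    3 ≤ k := by
  have h1 := h.pos
  by_contra hlt
  have : k = 1 ∨ k = 2 := by omega
  rcases this with rfl | rfl
  · have a := h.step 0
    rw [h.periodic 0] at a
    exact hT.asymm a a
  · have a := h.step 0
    have b := h.step 1
    rw [h.periodic 0] at b
    exact hT.asymm a b

theorem IsShortest.ne {k : ℕ} {c : ℕ → V} (h : IsShortest T k c) {i j : ℕ} (hij : i < j)
    (hk : j < i + k) : c i ≠ c j := by
  intro e
  have h1 := h.step j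
  rw [← e] at h1
  rcases Nat.lt_or_ge (j + 1) (i + k) with h' | h'
  · exact h.not_chord (i := i) (j := j + 1) (by omega) (by omega) h1
  · rw [show j + 1 = i + k by omega, h.periodic] at h1
    have := h.min 1 (fun _ => c i) ⟨one_pos, fun _ => rfl, fun _ => h1⟩
    omega

/-- Along the double stretch, single arcs from `c 0` propagate forwards and single arcs from `c (j +
1)` propagate backwards, since any other connection would transfer membership to a chord. Both ends
then have single arcs to `c 1` and to `c j`, which `Sound.no_turn` excludes. -/
theorem IsShortest.no_turn {k : ℕ} {c : ℕ → V} (h : IsShortest T k c) (hT : Sound D T)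
    (hS : IsSemicomplete D) (hC : NoSingleTriangle D) {j : ℕ} (hj : 1 ≤ j) (hjk : j + 1 < k)
    (h0 : Single D (c 0) (c 1)) (hD : ∀ i, 1 ≤ i → i < j → Double D (c i) (c (i + 1)))
    (hB : Single D (c (j + 1)) (c j)) : False := by
  have fwd : ∀ i, 1 ≤ i → i ≤ j → Single D (c 0) (c i) := by
    intro i hi
    induction i, hi using Nat.le_induction with
    | base => exact fun _ => h0
    | succ i hi ih =>
      intro hij
      have a := ih (by omega)
      have b := hD i hi (by omega)
      have hn : ¬ T (c 0) (c (i + 1)) := h.not_chord (by omega) (by omega)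
      have ht := h.step i
      rcases single_or_double hS (h.ne (show 0 < i + 1 by omega) (by omega)) with e | e | e
      · exact e
      · have := hT.of_path b e a
        grind
      · have := hT.of_double e.symm b.symm (Or.inl a)
        grind
  have bwd : ∀ m, m < j → Single D (c (j + 1)) (c (j - m)) := by
    intro m
    induction m with
    | zero => exact fun _ => hB
    | succ m ih =>
      intro hm
      have a := ih (by omega)
      have b := hD (j - (m + 1)) (by omega) (by omega)
      have ht := h.step (j - (m + 1))
      rw [show j - (m + 1) + 1 = j - m by omega] at b ht
      have hn : ¬ T (c (j - (m + 1))) (c (j + 1)) := h.not_chord (by omega) (by omega)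
      rcases single_or_double hS (h.ne (show j - (m + 1) < j + 1 by omega) (by omega)) with e | e | e
      · have := hT.of_path b.symm e a
        grind
      · exact e
      · have := hT.of_double b e (Or.inr a)
        grind
  have hz := bwd (j - 1) (by omega)
  rw [show j - (j - 1) = 1 by omega] at hz
  exact hT.no_turn hS hC h0 hz (fwd j hj le_rfl) hB (h.ne (by omega) (by omega)) (h.step 0)
    (h.step j) (h.not_back (by omega) (by omega)) (h.not_back (by omega) (by omega))
    (h.not_chord (by omega) (by omega))

/-- Between a forward and a backward single arc of the walk there is a place where the direction
changes with only double arcs in between, and `IsShortest.no_turn` applies there. -/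
theorem IsShortest.not_single_and_reverse {k : ℕ} {c : ℕ → V} (h : IsShortest T k c)
    (hT : Sound D T) (hS : IsSemicomplete D) (hC : NoSingleTriangle D)
    (h0 : Single D (c 0) (c 1)) {j : ℕ} (hj : j < k) : ¬ Single D (c (j + 1)) (c j) := by
  classical
  intro hB
  have h3 := h.three_le hT
  have hex : ∃ j, Single D (c (j + 1)) (c j) := ⟨j, hB⟩
  set m := Nat.find hex with hm
  have hmB : Single D (c (m + 1)) (c m) := Nat.find_spec hex
  have hmj : m ≤ j := Nat.find_min' hex hB
  have hmn : ∀ i < m, ¬ Single D (c (i + 1)) (c i) := fun i hi => Nat.find_min hex hi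
  have hm0 : m ≠ 0 := fun e => by
    rw [e] at hmB
    exact h0.2 hmB.1
  -- Here `m` is the first backward position; the least `d` gives the last forward position before
  -- it.
  have hex' : ∃ d, d ≤ m ∧ Single D (c (m - d)) (c (m - d + 1)) :=
    ⟨m, le_rfl, by simpa using h0⟩
  set d := Nat.find hex' with hd
  obtain ⟨hdm, hdF⟩ : d ≤ m ∧ Single D (c (m - d)) (c (m - d + 1)) := Nat.find_spec hex'
  have hdn : ∀ e < d, e ≤ m → ¬ Single D (c (m - e)) (c (m - e + 1)) :=
    fun e he hem hf => Nat.find_min hex' he ⟨hem, hf⟩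
  have hd0 : 1 ≤ d := by
    by_contra h'
    have : d = 0 := by omega
    rw [this] at hdF
    exact hmB.2 hdF.1
  have hD : ∀ i, 1 ≤ i → i < d → Double D (c (i + (m - d))) (c (i + 1 + (m - d))) := by
    intro i hi hid
    have a := hmn (i + (m - d)) (by omega)
    have b := hdn (d - i) (by omega) (by omega)
    rw [show m - (d - i) = i + (m - d) by omega] at b
    have := h.step (i + (m - d))
    rcases single_or_double hS (hT.ne this) with e | e | e
    · exact absurd e b
    · exact absurd e a
    · rwa [show i + 1 + (m - d) = i + (m - d) + 1 by omega]
  rcases Nat.lt_or_ge (d + 1) k with hdk | hdk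
  · refine (h.shift (m - d)).no_turn hT hS hC hd0 hdk ?_ hD ?_
    · simpa [add_comm] using hdF
    · simpa [show d + 1 + (m - d) = m + 1 by omega, show d + (m - d) = m by omega] using hmB
  -- The stretch takes up the whole walk, so the backward arc at `k - 1` is followed at once by the
  -- forward arc at `0`. In the reversed digraph this is a turn with `j = 1`.
  · rw [show m = k - 1 by omega] at hmB
    refine (h.shift (k - 1)).no_turn hT.reverse hS.reverse hC.reverse le_rfl (by omega) ?_
      (fun i hi hi' => by omega) ?_
    · simpa [add_comm, single_reverse] using hmB
    · have e1 : 1 + 1 + (k - 1) = 1 + k := by omega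
      have e2 : 1 + (k - 1) = 0 + k := by omega
      simp only [e1, e2, h.periodic]
      exact h0

/-- All other arcs of the walk are now double or forward, so single arcs from `c 0` propagate to all
later vertices up to `c (k - 1)`. The last of them is a backward single arc of the walk, which was
excluded. -/
theorem IsShortest.not_single {k : ℕ} {c : ℕ → V} (h : IsShortest T k c)
    (hT : Sound D T) (hS : IsSemicomplete D) (hC : NoSingleTriangle D) :
    ¬ Single D (c 0) (c 1) := by
  intro h0
  have h3 := h.three_le hT
  have hB := fun j (hj : j < k) => h.not_single_and_reverse hT hS hC h0 hj
  have fwd : ∀ i, 1 ≤ i → i < k → Single D (c 0) (c i) := by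
    intro i hi
    induction i, hi using Nat.le_induction with
    | base => exact fun _ => h0
    | succ i hi ih =>
      intro hij
      have a := ih (by omega)
      have hn : ¬ T (c 0) (c (i + 1)) := h.not_chord (by omega) (by omega)
      have hn' : ¬ T (c (i + 1)) (c i) := hT.asymm (h.step i)
      have ht := h.step i
      rcases single_or_double hS (h.ne (show 0 < i + 1 by omega) (by omega)) with e | e | e
      · exact e
      · rcases single_or_double hS (hT.ne ht) with b | b | b
        · exact (hC _ _ _ a b e).elim
        · exact (hB i (by omega) b).elim
        · have := hT.of_path b e a
          grind
      · rcases single_or_double hS (hT.ne ht) with b | b | b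
        · have := hT.of_path e.symm a b
          grind
        · exact (hB i (by omega) b).elim
        · have := hT.of_double e.symm b.symm (Or.inl a)
          grind
  have a := fwd (k - 1) (by omega) (by omega)
  have b := hB (k - 1) (by omega)
  have e := h.periodic 0
  rw [show k - 1 + 1 = 0 + k by omega, e] at b
  exact b a

/-- Consecutive vertices follow from `IsShortest.not_single` for the digraph and its reverse. For
the chords, a single arc between `c 0` and `c (i + 1)` would link `(c i, c (i + 1))` with the
backward pair `(c i, c 0)`. -/
theorem IsShortest.double {k : ℕ} {c : ℕ → V} (h : IsShortest T k c)
    (hT : Sound D T) (hS : IsSemicomplete D) (hC : NoSingleTriangle D) {j : ℕ} (hj : 1 ≤ j)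
    (hjk : j < k) : Double D (c 0) (c j) := by
  have edge : ∀ {c : ℕ → V}, IsShortest T k c → Double D (c 0) (c 1) := by
    intro c h
    rcases single_or_double hS (hT.ne (h.step 0)) with e | e | e
    · exact (h.not_single hT hS hC e).elim
    · exact (h.not_single hT.reverse hS.reverse hC.reverse e).elim
    · exact e
  induction j, hj using Nat.le_induction with
  | base => exact edge h
  | succ i hi ih =>
    have a := ih (by omega)
    have b : Double D (c i) (c (i + 1)) := by simpa [add_comm] using edge (h.shift i)
    have hn : ¬ T (c i) (c 0) := h.not_back (by omega) (by omega)
    have ht := h.step i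
    rcases single_or_double hS (h.ne (show 0 < i + 1 by omega) (by omega)) with e | e | e
    · have := hT.of_double a.symm b (Or.inl e)
      grind
    · have := hT.of_double a.symm b (Or.inr e)
      grind
    · exact e

end Cycles
end ComparabilityDigraph

namespace ComparabilityDigraph

/-! ### Adding a class to the collected set preserves acyclicity. -/

section Extension

variable {V : Type*} {D : Digraph V} {T : V → V → Prop}

/-- The set `T` of pairs together with the implication class of `p`. -/
def addClass (D : Digraph V) (T : V → V → Prop) (p : V × V) (x y : V) : Prop :=
  T x y ∨ Equi D p (x, y)

theorem Sound.addClass (hT : Sound D T) (hD : NoSelfInverse D) {p : V × V}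
    (hl : Linked D p.1 p.2) (h₂ : ¬ T p.2 p.1) : Sound D (addClass D T p) where
  left h := Or.imp (hT.left h) fun e => e.trans h.equi_left
  right h := Or.imp (hT.right h) fun e => e.trans h.equi_right
  asymm := by
    rintro x y (h | h) (h' | h')
    · exact hT.asymm h h'
    · exact h₂ (hT.of_equi h'.symm.swap h)
    · exact h₂ (hT.of_equi h.symm.swap h')
    · exact hD x y (h.symm.trans h')
  linked := by
    rintro x y (h | h)
    · exact hT.linked h
    · exact hl.of_equi h

/-- No remaining pair of a class with several elements is implied by transitivity. -/
def Stable (D : Digraph V) (T : V → V → Prop) : Prop :=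
  ∀ x y z, T x y → T y z → Linked D x z → T x z ∨ T z x

/-- By the triangle lemma with apex `y`, every pair `(a, b)` of the new class satisfies `T a y` and
`T y b`. So every closed walk in the enlarged set expands to one in `T`. -/
theorem acyclic_addClass_of_priority (hS : IsSemicomplete D) (hD : NoSelfInverse D)
    (hT : Sound D T) (hA : ∀ x, ¬ Relation.TransGen T x x) {p : V × V}
    (hl : Linked D p.1 p.2) (h₁ : ¬ T p.1 p.2) (h₂ : ¬ T p.2 p.1)
    {x y z : V} (hxy : T x y) (hyz : T y z) (hp : Equi D p (x, z)) :
    ∀ x, ¬ Relation.TransGen (addClass D T p) x x := by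
  have hxz : ¬ T x z := fun h => h₁ (hT.of_equi hp.symm h)
  have hzx : ¬ T z x := fun h => h₂ (hT.of_equi hp.symm.swap h)
  obtain ⟨d₁, d₂, d₃⟩ := hT.double_of_linked hS hD.noSingleTriangle hxy hyz hxz hzx (hl.of_equi hp)
  have hR : Rainbow D y x z := by
    refine ⟨d₃, d₁.symm, d₂, fun e => hxz (hT.of_equi e.symm hyz), fun e => ?_,
      fun e => hxz (hT.of_equi e.symm hxy)⟩
    exact hT.asymm hyz (hT.of_equi e.flip hxy)
  intro v hv
  refine hA v (Relation.TransGen.lift' (p := T) id ?_ v v hv)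
  rintro a b (h | h)
  · exact .single h
  · obtain ⟨_, e₁, e₂⟩ := hR.of_equi hS (hp.symm.trans h)
    exact .tail (.single (hT.of_equi e₁.flip hxy)) (hT.of_equi e₂ hyz)

/-- A shortest closed walk must use the new class, and is rotated so that this happens from `c 0` to
`c 1`. The triangle lemma with apex `c 2` shows that all its other pairs are in `T`; stability then
rules out both length three and larger lengths. -/
theorem acyclic_addClass_of_stable (hS : IsSemicomplete D) (hD : NoSelfInverse D)
    (hT : Sound D T) (hA : ∀ x, ¬ Relation.TransGen T x x) {p : V × V}
    (hl : Linked D p.1 p.2) (h₁ : ¬ T p.1 p.2) (h₂ : ¬ T p.2 p.1) (hs : Stable D T) :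
    ∀ x, ¬ Relation.TransGen (addClass D T p) x x := by
  intro v hv
  have hT' : Sound D (addClass D T p) := hT.addClass hD hl h₂
  have hC := hD.noSingleTriangle
  obtain ⟨k, c, h⟩ := exists_isShortest hv
  have h3 := h.three_le hT'
  have hex : ∃ i, Equi D p (c i, c (i + 1)) := by
    by_contra hno
    push Not at hno
    have hw : ∀ i, T (c i) (c (i + 1)) := fun i => (h.step i).resolve_right (hno i)
    have : ∀ i, Relation.TransGen T (c 0) (c (i + 1)) := by
      intro i
      induction i with
      | zero => exact .single (hw 0)
      | succ i ih => exact .tail ih (hw (i + 1))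
    have := this (k - 1)
    rw [show k - 1 + 1 = 0 + k by omega, h.periodic] at this
    exact hA _ this
  obtain ⟨i, hi⟩ := hex
  obtain ⟨c, h, hi⟩ : ∃ c, IsShortest (addClass D T p) k c ∧ Equi D p (c 0, c 1) :=
    ⟨_, h.shift i, by simpa [add_comm] using hi⟩
  have d01 := h.double hT' hS hC (j := 1) le_rfl (by omega)
  have d02 := h.double hT' hS hC (j := 2) (by omega) (by omega)
  have d12 : Double D (c 1) (c 2) :=
    (h.shift 1).double hT' hS hC (j := 1) le_rfl (by omega)
  have n02 : ¬ addClass D T p (c 0) (c 2) := h.not_chord le_rfl (by omega)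
  have n21 := hT'.asymm (h.step 1)
  have n10 := hT'.asymm (h.step 0)
  -- Each coincidence of classes excluded here would put the chord `(c 0, c 2)` or the inverse pair
  -- `(c 2, c 1)` into the enlarged set.
  have hR : Rainbow D (c 2) (c 0) (c 1) := by
    refine ⟨d01, d02.symm, d12.symm, fun e => n21 (hT'.of_equi e (Or.inr hi)), fun e => ?_,
      fun e => n02 (hT'.of_equi e (Or.inr hi))⟩
    exact n02 (hT'.of_equi e.flip.symm (h.step 1))
  have t1 : T (c 1) (c 2) := by
    refine (h.step 1).resolve_right fun e => ?_
    have e' := hT'.of_equi (hR.of_equi hS (hi.symm.trans e)).2.2.flip (h.step 1)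
    exact hT'.asymm e' e'
  -- A second pair `(c j, c (j + 1))` of the new class would transport `(c 1, c 2)` to the backward
  -- pair `(c (j + 1), c 2)`.
  have tj : ∀ j, 1 ≤ j → j < k → T (c j) (c (j + 1)) := by
    intro j hj hjk
    rcases Nat.lt_or_ge 1 j with hj' | hj'
    · refine (h.step j).resolve_right fun e => ?_
      have := (hR.of_equi hS (hi.symm.trans e)).2.2
      exact h.not_back (i := 2) (j := j + 1) (by omega) (by omega)
        (hT'.of_equi this.flip (h.step 1))
    · obtain rfl : j = 1 := by omega
      exact t1
  rcases Nat.lt_or_ge 3 k with hk | hk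
  -- By stability a linked chord would lie in `T` in one direction, which a shortest closed walk
  -- does not allow.
  · have trivial_chord : ∀ j, 1 ≤ j → j ≤ 2 → ¬ Linked D (c j) (c (j + 2)) := by
      intro j hj hj' hl
      rcases hs _ _ _ (tj j hj (by omega)) (tj (j + 1) (by omega) (by omega)) hl with e | e
      · exact h.not_chord (by omega) (by omega) (Or.inl e)
      · exact h.not_back (by omega) (by omega) (Or.inl e)
    have n13 := trivial_chord 1 le_rfl (by omega)
    have n24 := trivial_chord 2 (by omega) le_rfl
    have d13 : Double D (c 1) (c 3) :=
      (h.shift 1).double hT' hS hC (j := 2) (by omega) (by omega)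
    have d23 : Double D (c 2) (c 3) :=
      (h.shift 2).double hT' hS hC (j := 1) (by omega) (by omega)
    have d24 : Double D (c 2) (c 4) :=
      (h.shift 2).double hT' hS hC (j := 2) (by omega) (by omega)
    have t2 := tj 2 (by omega) (by omega)
    have t3 := tj 3 (by omega) (by omega)
    -- The ends of an unlinked double pair have the same in- and out-neighbours elsewhere. So in a
    -- link for `(c 2, c 3)` one may replace `c 3` by its twin `c 1`, or `c 2` by its twin `c 4`;
    -- this inverts a pair of `T`.
    have twin : ∀ {a b u : V}, Double D a b → ¬ Linked D a b → u ≠ a → u ≠ b →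
        (D.Adj a u ↔ D.Adj b u) ∧ (D.Adj u a ↔ D.Adj u b) := by
      intro a b u hab hn hua hub
      have l₁ : ¬ Link D a b u := fun hl => hn ⟨u, Or.inl hl⟩
      have l₂ : ¬ Link D b a u := fun hl => hn ⟨u, Or.inr hl⟩
      have s₁ := hS a u hua.symm
      have s₂ := hS b u hub.symm
      obtain ⟨q₁, q₂⟩ := hab
      simp only [Link, hub.symm, hua.symm, ne_eq, not_false_eq_true, true_and, q₁, q₂] at l₁ l₂
      grind
    obtain ⟨u, hu | hu⟩ := hT.linked t2
    · have hu1 : u ≠ c 1 := by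
        rintro rfl
        rcases hu.2 with e | e
        · exact e.2.2 d13.2
        · exact e.2.2 d13.1
      have tw := twin d13 n13 hu1 hu.1.symm
      have : Link D (c 2) (c 1) u := by
        refine ⟨hu1.symm, ?_⟩
        rcases hu.2 with e | e
        · exact Or.inl ⟨d12.1, e.2.1, fun e' => e.2.2 (tw.1.1 e')⟩
        · exact Or.inr ⟨e.1, d12.2, fun e' => e.2.2 (tw.2.1 e')⟩
      exact hT.asymm t1 (hT.left this.symm (hT.left hu t2))
    · have hu4 : u ≠ c 4 := by
        rintro rfl
        rcases hu.2 with e | e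
        · exact e.2.2 d24.1
        · exact e.2.2 d24.2
      have tw := twin d24 n24 hu.1.symm hu4
      have d34 : Double D (c 3) (c 4) :=
        (h.shift 3).double hT' hS hC (j := 1) (by omega) (by omega)
      have : Link D (c 3) (c 4) u := by
        refine ⟨hu4.symm, ?_⟩
        rcases hu.2 with e | e
        · exact Or.inl ⟨d34.2, e.2.1, fun e' => e.2.2 (tw.1.2 e')⟩
        · exact Or.inr ⟨e.1, d34.1, fun e' => e.2.2 (tw.2.2 e')⟩
      exact hT.asymm t3 (hT.right this.symm (hT.right hu t2))
  -- The two pairs `(c 1, c 2)` and `(c 2, c 0)` of `T` give priority to the inverse of the new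
  -- class.
  · obtain rfl : k = 3 := by omega
    have t2 := tj 2 (by omega) (by omega)
    rw [show 2 + 1 = 0 + 3 by omega, h.periodic] at t2
    rcases hs _ _ _ t1 t2 (hl.of_equi hi).symm with e | e
    · exact h₂ (hT.of_equi hi.symm.swap e)
    · exact h₁ (hT.of_equi hi.symm e)

theorem Link.ne (hL : IsLoopless D) {x y z : V} (h : Link D x y z) : x ≠ y ∧ x ≠ z := by
  constructor
  · rintro rfl
    have := hL x
    have := h.2
    tauto
  · rintro rfl
    have := hL x
    have := h.2
    tauto

/-- A comparability ordering orders all pairs of an implication class alike. -/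
theorem IsComparabilityOrdering.of_equi {r : V → V → Prop} (h : IsComparabilityOrdering D r)
    (hL : IsLoopless D) {p q : V × V} (e : Equi D p q) (hr : r p.1 p.2) : r q.1 q.2 := by
  have := h.1
  have hlink : ∀ {x y z}, Link D x y z → (r x y → r x z) ∧ (r y x → r z x) := by
    intro x y z hl
    have h₁ := h.2 y x z
    have h₂ := h.2 z x y
    have h₃ : r x z ∨ r z x := by
      rcases trichotomous_of r x z with h | h | h
      · exact Or.inl h
      · exact absurd h (hl.ne hL).2
      · exact Or.inr h
    have := hl.2
    tauto
  have step : ∀ {p q : V × V}, DirectlyForces D p q → r p.1 p.2 → r q.1 q.2 := by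
    rintro ⟨x, y⟩ ⟨x', y'⟩ h hp
    rcases directlyForces_iff.1 h with ⟨h, _⟩ | ⟨h, hl⟩ | ⟨h, hl⟩
    · obtain ⟨rfl, rfl⟩ := Prod.mk.inj h
      exact hp
    · obtain rfl : x = x' := h
      exact (hlink hl).1 hp
    · obtain rfl : y = y' := h
      exact (hlink hl).2 hp
  induction e with
  | single h => exact step h hr
  | tail _ h ih => exact step h ih

theorem IsComparability.noSelfInverse (h : IsComparability D) (hL : IsLoopless D) :
    NoSelfInverse D := by
  obtain ⟨r, hr⟩ := h
  intro x y e
  have := hr.1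
  have hxy : x ≠ y := by
    rintro rfl
    rcases e.mem_pairs.1 with h | h <;> exact hL _ h
  rcases trichotomous_of r x y with h | h | h
  · exact asymm_of r h (hr.of_equi hL e h)
  · exact hxy h
  · exact asymm_of r h (hr.of_equi hL e.symm h)

/-- A violation at `x ≺ y ≺ z` is a link at `y` between `x` and `z`. As `T` decides `(y, x)`, it
puts `x` and `z` on the same side of `y`. -/
theorem isComparabilityOrdering_of_extends (hT : Sound D T) {r : V → V → Prop}
    (hr : IsStrictTotalOrder V r) (hTr : ∀ x y, T x y → r x y)
    (hmax : ∀ x y, Linked D x y → T x y ∨ T y x) : IsComparabilityOrdering D r := by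
  have key : ∀ x y z, r x y → r y z → ¬ Link D y x z := by
    intro x y z hxy hyz hl
    rcases hmax y x ⟨z, Or.inl hl⟩ with h | h
    · exact asymm_of r hxy (hTr _ _ h)
    · exact asymm_of r hyz (hTr _ _ (hT.right hl h))
  refine ⟨hr, fun x y z hxy hyz => ⟨fun h₁ h₂ => ?_, fun h₁ h₂ => ?_⟩⟩
  · by_contra h
    refine key x y z hxy hyz ⟨?_, Or.inl ⟨h₁, h₂, h⟩⟩
    rintro rfl
    exact asymm_of r hxy hyz
  · by_contra h
    refine key x y z hxy hyz ⟨?_, Or.inr ⟨h₁, h₂, h⟩⟩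
    rintro rfl
    exact asymm_of r hxy hyz

end Extension
end ComparabilityDigraph

namespace ComparabilityDigraph

/-! ### From collected sets to executions of the loop. -/

section Execution

variable {V : Type*} {D : Digraph V} {T : V → V → Prop}

theorem eq_of_equi_of_not_linked {p q : V × V} (e : Equi D p q) (h : ¬ Linked D p.1 p.2) :
    p = q := by
  induction e with
  | single hf =>
    rcases directlyForces_iff.1 hf with ⟨hf, _⟩ | ⟨_, hl⟩ | ⟨_, hl⟩
    · exact hf
    · exact (h ⟨_, Or.inl hl⟩).elim
    · exact (h ⟨_, Or.inr hl⟩).elim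
  | tail _ hf ih =>
    subst ih
    rcases directlyForces_iff.1 hf with ⟨hf, _⟩ | ⟨_, hl⟩ | ⟨_, hl⟩
    · exact hf
    · exact (h ⟨_, Or.inl hl⟩).elim
    · exact (h ⟨_, Or.inr hl⟩).elim

theorem Linked.mem_pairs {x y : V} (h : Linked D x y) : (x, y) ∈ pairs D := by
  obtain ⟨u, h | h⟩ := h
  · exact h.mem_pairs.1
  · exact Or.symm h.mem_pairs.1

theorem one_lt_encard_implicationClass {p : V × V} (hp : p ∈ pairs D) :
    1 < (implicationClass D p).encard ↔ Linked D p.1 p.2 := by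
  rw [Set.one_lt_encard_iff]
  constructor
  · rintro ⟨a, b, ha, hb, hab⟩
    by_contra h
    exact hab ((eq_of_equi_of_not_linked ha h).symm.trans (eq_of_equi_of_not_linked hb h))
  · rintro ⟨u, h | h⟩
    · exact ⟨p, (p.1, u), Equi.refl hp, h.equi_left, fun e => h.1 (congrArg Prod.snd e)⟩
    · exact ⟨p, (u, p.2), Equi.refl hp, h.equi_right, fun e => h.1 (congrArg Prod.fst e)⟩

theorem implicationClass_eq {p q : V × V} (h : Equi D p q) :
    implicationClass D p = implicationClass D q :=
  Set.ext fun _ => ⟨fun e => h.symm.trans e, fun e => h.trans e⟩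

theorem inverse_implicationClass (p : V × V) :
    inverse (implicationClass D p) = implicationClass D p.swap :=
  Set.ext fun q => ⟨fun e => Equi.swap (q := (q.2, q.1)) e, fun e => Equi.swap (p := p.swap) e⟩

theorem firstTest_iff : FirstTest D ↔ ¬ NoSelfInverse D := by
  constructor
  · rintro ⟨I, ⟨p, hp, rfl⟩, h⟩ hn
    have : p ∈ inverse (implicationClass D p) := h ▸ Equi.refl hp
    exact hn p.1 p.2 this
  · intro h
    simp only [NoSelfInverse, not_forall, not_not] at h
    obtain ⟨x, y, h⟩ := h
    refine ⟨_, ⟨(x, y), h.mem_pairs.1, rfl⟩, ?_⟩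
    rw [inverse_implicationClass]
    exact implicationClass_eq h

/-- The state of the loop when the set `T` has been collected. -/
def stateOf (D : Digraph V) (T : V → V → Prop) : LoopState V where
  T := {p | T p.1 p.2}
  remaining := {I | ∃ x y, Linked D x y ∧ ¬ T x y ∧ ¬ T y x ∧ I = implicationClass D (x, y)}

theorem init_eq_stateOf : LoopState.init D = stateOf D (fun _ _ => False) := by
  have : {I ∈ implicationClasses D | 1 < I.encard} = (stateOf D (fun _ _ => False)).remaining := by
    ext I
    constructor
    · rintro ⟨⟨p, hp, rfl⟩, h⟩
      exact ⟨p.1, p.2, (one_lt_encard_implicationClass hp).1 h, id, id, rfl⟩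
    · rintro ⟨x, y, h, -, -, rfl⟩
      exact ⟨⟨_, h.mem_pairs, rfl⟩, (one_lt_encard_implicationClass h.mem_pairs).2 h⟩
  unfold LoopState.init
  rw [this]
  rfl

/-- The properties of the set of collected pairs that the loop maintains. -/
structure LoopInvariant (D : Digraph V) (T : V → V → Prop) : Prop where
  left : ∀ {x y z}, Link D x y z → T x y → T x z
  right : ∀ {x y z}, Link D x y z → T y x → T z x
  linked : ∀ {x y}, T x y → Linked D x y
  conflict : ∀ {x y}, T x y → T y x → Equi D (x, y) (y, x)
  acyclic : NoSelfInverse D → ∀ x, ¬ Relation.TransGen T x x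

/-- The next set of collected pairs. -/
def CollectStep (D : Digraph V) (T T' : V → V → Prop) : Prop :=
  ∃ p : V × V, Linked D p.1 p.2 ∧ ¬ T p.1 p.2 ∧ ¬ T p.2 p.1 ∧
    ((∃ x y z, T x y ∧ T y z ∧ Equi D p (x, z)) ∨ Stable D T) ∧
    ∀ x y, T' x y ↔ addClass D T p x y

theorem LoopInvariant.empty : LoopInvariant D (fun _ _ => False) := by
  refine ⟨by simp, by simp, by simp, by simp, fun _ x h => ?_⟩
  cases h with
  | single h => exact h
  | tail _ h => exact h

theorem LoopInvariant.of_equi (hT : LoopInvariant D T) {p q : V × V} (h : Equi D p q)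
    (hp : T p.1 p.2) : T q.1 q.2 := by
  have step : ∀ {p q : V × V}, DirectlyForces D p q → T p.1 p.2 → T q.1 q.2 := by
    rintro ⟨x, y⟩ ⟨x', y'⟩ h hp
    rcases directlyForces_iff.1 h with ⟨h, _⟩ | ⟨h, hl⟩ | ⟨h, hl⟩
    · obtain ⟨rfl, rfl⟩ := Prod.mk.inj h
      exact hp
    · obtain rfl : x = x' := h
      exact hT.left hl hp
    · obtain rfl : y = y' := h
      exact hT.right hl hp
  induction h with
  | single h => exact step h hp
  | tail _ h ih => exact step h ih

theorem LoopInvariant.sound (hT : LoopInvariant D T) (hD : NoSelfInverse D) : Sound D T :=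
  ⟨hT.left, hT.right, fun h h' => hD _ _ (hT.conflict h h'), hT.linked⟩

/-- No assumption is made on self-inverse classes, because the loop is run before they have been
excluded: conflicting pairs are tolerated if they come from such a class, and only acyclicity is
conditional. -/
theorem LoopInvariant.step (hS : IsSemicomplete D) (hT : LoopInvariant D T) {T' : V → V → Prop}
    (h : CollectStep D T T') : LoopInvariant D T' := by
  obtain ⟨p, hl, h₁, h₂, hp, hT'⟩ := h
  obtain rfl : T' = addClass D T p := by
    ext x y
    exact hT' x y
  refine ⟨fun h => Or.imp (hT.left h) fun e => e.trans h.equi_left,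
    fun h => Or.imp (hT.right h) fun e => e.trans h.equi_right, ?_, ?_, ?_⟩
  · rintro x y (h | h)
    · exact hT.linked h
    · exact hl.of_equi h
  · rintro x y (h | h) (h' | h')
    · exact hT.conflict h h'
    · exact (h₂ (hT.of_equi h'.symm.swap h)).elim
    · exact (h₂ (hT.of_equi h.symm.swap h')).elim
    · exact h.symm.trans h'
  · intro hD
    have hs := hT.sound hD
    rcases hp with ⟨x, y, z, hxy, hyz, e⟩ | hp
    · exact acyclic_addClass_of_priority hS hD hs (hT.acyclic hD) hl h₁ h₂ hxy hyz e
    · exact acyclic_addClass_of_stable hS hD hs (hT.acyclic hD) hl h₁ h₂ hp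

/-- Since `T` is a union of classes, a remaining class has no pair in `T` or its inverse. So
stability of `T` says precisely that no remaining class has priority. -/
theorem LoopInvariant.loopStep (hT : LoopInvariant D T) {T' : V → V → Prop}
    (h : CollectStep D T T') : LoopStep (stateOf D T) (stateOf D T') := by
  obtain ⟨p, hl, h₁, h₂, hp, hT'⟩ := h
  obtain rfl : T' = addClass D T p := by
    ext x y
    exact hT' x y
  refine ⟨implicationClass D p, ⟨p.1, p.2, hl, h₁, h₂, rfl⟩, ?_, ?_⟩
  · rcases hp with ⟨x, y, z, hxy, hyz, e⟩ | hp
    · exact Or.inl ⟨x, y, z, hxy, hyz, e⟩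
    · right
      rintro ⟨J, ⟨u, v, huv, n₁, n₂, rfl⟩, x, y, z, hxy, hyz, e⟩
      rcases hp x y z hxy hyz (huv.of_equi e) with h | h
      · exact n₁ (hT.of_equi (Equi.symm e) h)
      · exact n₂ (hT.of_equi (Equi.swap (Equi.symm e)) h)
  · have : (stateOf D (addClass D T p)).remaining =
        (stateOf D T).remaining \ {implicationClass D p, inverse (implicationClass D p)} := by
      ext J
      rw [inverse_implicationClass]
      constructor
      · rintro ⟨u, v, huv, n₁, n₂, rfl⟩
        refine ⟨⟨u, v, huv, fun h => n₁ (Or.inl h), fun h => n₂ (Or.inl h), rfl⟩, ?_⟩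
        have hm : (u, v) ∈ implicationClass D (u, v) := Equi.refl huv.mem_pairs
        rintro (e | e)
        · rw [e] at hm
          exact n₁ (Or.inr hm)
        · rw [e] at hm
          exact n₂ (Or.inr (Equi.swap hm))
      · rintro ⟨⟨u, v, huv, n₁, n₂, rfl⟩, n⟩
        refine ⟨u, v, huv, ?_, ?_, rfl⟩
        · rintro (h | h)
          · exact n₁ h
          · exact n (Or.inl (implicationClass_eq h).symm)
        · rintro (h | h)
          · exact n₂ h
          · exact n (Or.inr (implicationClass_eq (Equi.swap h)).symm)
    have h' : (stateOf D (addClass D T p)).T = (stateOf D T).T ∪ implicationClass D p := rfl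
    rw [← this, ← h']

/-- The first test of the algorithm can be read off the final set. A self-inverse class consists of
linked pairs, as a class with one element would come from a loop; the final set meets it and hence
contains all of it. -/
theorem LoopInvariant.conflict_iff (hT : LoopInvariant D T) (hL : IsLoopless D)
    (hmax : ∀ x y, Linked D x y → T x y ∨ T y x) :
    (∃ x y, T x y ∧ T y x) ↔ FirstTest D := by
  rw [firstTest_iff]
  constructor
  · rintro ⟨x, y, h₁, h₂⟩ hD
    exact hD _ _ (hT.conflict h₁ h₂)
  · intro h
    simp only [NoSelfInverse, not_forall, not_not] at h
    obtain ⟨x, y, h⟩ := h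
    have hl : Linked D x y := by
      by_contra hl
      obtain rfl := (Prod.mk.inj (eq_of_equi_of_not_linked h hl)).1
      rcases h.mem_pairs.1 with h | h <;> exact hL _ h
    rcases hmax x y hl with h' | h'
    · exact ⟨x, y, h', hT.of_equi h h'⟩
    · exact ⟨x, y, hT.of_equi h.symm h', h'⟩

/-- A sequence of collected sets, each obtained from the last, until nothing is left, is an
execution of the loop. -/
theorem isLoopExecution_of_collectStep (hS : IsSemicomplete D) {k : ℕ} {S : ℕ → V → V → Prop}
    (h0 : ∀ x y, ¬ S 0 x y) (hstep : ∀ i < k, CollectStep D (S i) (S (i + 1)))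
    (hmax : ∀ x y, Linked D x y → S k x y ∨ S k y x) :
    IsLoopExecution D k (fun i => stateOf D (S i)) ∧ LoopInvariant D (S k) := by
  have h0' : S 0 = fun _ _ => False := by
    ext x y
    simpa using h0 x y
  have inv : ∀ i ≤ k, LoopInvariant D (S i) := by
    intro i
    induction i with
    | zero => exact fun _ => h0' ▸ LoopInvariant.empty
    | succ i ih => exact fun hi => (ih (by omega)).step hS (hstep i (by omega))
  refine ⟨⟨?_, fun i hi => (inv i hi.le).loopStep (hstep i hi), ?_⟩, inv k le_rfl⟩
  · simp only [h0', init_eq_stateOf]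
  · rw [Set.eq_empty_iff_forall_notMem]
    rintro I ⟨x, y, hl, h₁, h₂, -⟩
    exact (hmax x y hl).elim h₁ h₂

end Execution
end ComparabilityDigraph

/-! ### A program logic for the machine, with time and size bounds. -/

namespace RAM

/-- All registers and memory cells hold numbers up to `B`. -/
def Store.Bounded (B : ℕ) (σ : Store) : Prop := (∀ i, σ.reg i ≤ B) ∧ ∀ i, σ.mem i ≤ B

@[simp] theorem Store.setReg_reg (σ : Store) (r v i : ℕ) :
    (σ.setReg r v).reg i = if i = r then v else σ.reg i := by
  simp [Store.setReg, Function.update_apply]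

@[simp] theorem Store.setReg_mem (σ : Store) (r v : ℕ) : (σ.setReg r v).mem = σ.mem := rfl

@[simp] theorem Store.setMem_reg (σ : Store) (a v : ℕ) : (σ.setMem a v).reg = σ.reg := rfl

theorem Store.setMem_mem (σ : Store) (a v : ℕ) :
    (σ.setMem a v).mem = Function.update σ.mem a v := rfl

theorem Store.Bounded.setReg {B : ℕ} {σ : Store} (h : σ.Bounded B) {r v : ℕ} (hv : v ≤ B) :
    (σ.setReg r v).Bounded B := by
  refine ⟨fun i => ?_, h.2⟩
  simp only [Store.setReg_reg]
  split_ifs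
  · exact hv
  · exact h.1 i

theorem Store.Bounded.setMem {B : ℕ} {σ : Store} (h : σ.Bounded B) {a v : ℕ} (hv : v ≤ B) :
    (σ.setMem a v).Bounded B := by
  refine ⟨h.1, fun i => ?_⟩
  simp only [Store.setMem_mem, Function.update_apply]
  split_ifs
  · exact hv
  · exact h.2 i

/-- From the store `σ`, the statement `s` takes `t` steps to the store `σ'`, and all numbers
that occur are at most `B`. -/
def Exec (B : ℕ) (s : Stmt) (σ σ' : Store) (t : ℕ) : Prop :=
  ∀ K, step^[t] ⟨s :: K, σ⟩ = ⟨K, σ'⟩ ∧ ∀ t' ≤ t, (step^[t'] ⟨s :: K, σ⟩).store.Bounded B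

theorem Exec.bounded {B : ℕ} {s : Stmt} {σ σ' : Store} {t : ℕ} (h : Exec B s σ σ' t) :
    σ'.Bounded B := by
  have := (h []).2 t le_rfl
  rwa [(h []).1] at this

/-- Composition of computations. -/
theorem bounded_trans {B t₁ t₂ : ℕ} {c c₁ : Config} (h₁ : step^[t₁] c = c₁)
    (b₁ : ∀ t ≤ t₁, (step^[t] c).store.Bounded B) (b₂ : ∀ t ≤ t₂, (step^[t] c₁).store.Bounded B) :
    ∀ t ≤ t₁ + t₂, (step^[t] c).store.Bounded B := by
  intro t ht
  rcases Nat.lt_or_ge t t₁ with h | h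
  · exact b₁ t h.le
  · obtain ⟨u, rfl⟩ := Nat.exists_eq_add_of_le h
    rw [add_comm, Function.iterate_add_apply, h₁]
    exact b₂ u (by omega)

theorem Exec.atomic {B : ℕ} {s : Stmt} {σ σ' : Store} (hσ : σ.Bounded B) (hσ' : σ'.Bounded B)
    (h : ∀ K, step ⟨s :: K, σ⟩ = ⟨K, σ'⟩) : Exec B s σ σ' 1 := by
  intro K
  refine ⟨h K, fun t ht => ?_⟩
  rcases (show t = 0 ∨ t = 1 by omega) with rfl | rfl
  · exact hσ
  · rw [Function.iterate_one, h K]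
    exact hσ'

theorem Exec.seq {B : ℕ} {s₁ s₂ : Stmt} {σ σ₁ σ₂ : Store} {t₁ t₂ : ℕ} (hσ : σ.Bounded B)
    (h₁ : Exec B s₁ σ σ₁ t₁) (h₂ : Exec B s₂ σ₁ σ₂ t₂) : Exec B (.seq s₁ s₂) σ σ₂ (1 + t₁ + t₂) := by
  intro K
  have a : step^[1 + t₁] ⟨.seq s₁ s₂ :: K, σ⟩ = ⟨s₂ :: K, σ₁⟩ := by
    rw [add_comm, Function.iterate_add_apply]
    exact (h₁ _).1
  refine ⟨?_, ?_⟩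
  · rw [add_comm, Function.iterate_add_apply, a, (h₂ K).1]
  · refine bounded_trans a (bounded_trans (c₁ := ⟨s₁ :: s₂ :: K, σ⟩) rfl ?_ (h₁ _).2) (h₂ K).2
    intro t ht
    rcases (show t = 0 ∨ t = 1 by omega) with rfl | rfl <;> exact hσ

theorem Exec.prepend {B : ℕ} {s s' : Stmt} {σ σ' : Store} {t : ℕ} (hσ : σ.Bounded B)
    (h : Exec B s σ σ' t) (hs : ∀ K, step ⟨s' :: K, σ⟩ = ⟨s :: K, σ⟩) :
    Exec B s' σ σ' (1 + t) := by
  intro K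
  refine ⟨?_, bounded_trans (hs K) ?_ (h K).2⟩
  · rw [add_comm, Function.iterate_add_apply, Function.iterate_one, hs, (h K).1]
  · intro t ht
    rcases (show t = 0 ∨ t = 1 by omega) with rfl | rfl
    · exact hσ
    · rw [Function.iterate_one, hs]
      exact hσ

/-- Total correctness with a time bound: started in the store `σ`, the statement `s` terminates
after some number `t` of steps in a store `σ'` with `Q t σ'`, and all numbers stay at most `B`. -/
def Ok (B : ℕ) (s : Stmt) (σ : Store) (Q : ℕ → Store → Prop) : Prop :=
  σ.Bounded B → ∃ t σ', Q t σ' ∧ Exec B s σ σ' t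

/-- The registers that a statement may change. -/
def Stmt.writes : Stmt → List ℕ
  | .skip => []
  | .const r _ => [r]
  | .move r _ => [r]
  | .add r _ _ => [r]
  | .sub r _ _ => [r]
  | .mul r _ _ => [r]
  | .load r _ => [r]
  | .store _ _ => []
  | .seq s₁ s₂ => s₁.writes ++ s₂.writes
  | .ite _ s₁ s₂ => s₁.writes ++ s₂.writes
  | .loop _ s => s.writes

/-- Whatever stands on the list of pending statements is a part of `s`, so none of it writes `r`. -/
theorem Exec.frame {B : ℕ} {s : Stmt} {σ σ' : Store} {t : ℕ} (h : Exec B s σ σ' t) {r : ℕ}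
    (hr : r ∉ s.writes) : σ'.reg r = σ.reg r := by
  have key : ∀ c : Config, (∀ s ∈ c.todo, r ∉ s.writes) → c.store.reg r = σ.reg r →
      (∀ s ∈ (step c).todo, r ∉ s.writes) ∧ (step c).store.reg r = σ.reg r := by
    rintro ⟨todo, τ⟩ h₁ h₂
    rcases todo with _ | ⟨s, K⟩
    · exact ⟨h₁, h₂⟩
    have hs := h₁ s (by simp)
    have hK : ∀ s ∈ K, r ∉ s.writes := fun s' h => h₁ s' (by simp [h])
    cases s with
    | skip => exact ⟨hK, h₂⟩
    | store a b => exact ⟨hK, h₂⟩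
    | seq s₁ s₂ =>
      simp only [Stmt.writes, List.mem_append, not_or] at hs
      refine ⟨?_, h₂⟩
      simp only [step, List.mem_cons, forall_eq_or_imp]
      exact ⟨hs.1, hs.2, hK⟩
    | ite t s₁ s₂ =>
      simp only [Stmt.writes, List.mem_append, not_or] at hs
      refine ⟨?_, h₂⟩
      simp only [step, List.mem_cons, forall_eq_or_imp]
      refine ⟨?_, hK⟩
      split_ifs
      · exact hs.1
      · exact hs.2
    | loop t s₁ =>
      refine ⟨?_, h₂⟩
      simp only [step]
      split_ifs
      · simp only [List.mem_cons, forall_eq_or_imp]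
        exact ⟨hs, hs, hK⟩
      · exact hK
    | _ =>
      simp only [Stmt.writes, List.mem_singleton] at hs
      refine ⟨hK, ?_⟩
      simp only [step, Store.setReg_reg, if_neg hs]
      exact h₂
  have : ∀ t, (∀ s' ∈ (step^[t] ⟨[s], σ⟩).todo, r ∉ s'.writes) ∧
      (step^[t] ⟨[s], σ⟩).store.reg r = σ.reg r := by
    intro t
    induction t with
    | zero => exact ⟨by simpa using hr, rfl⟩
    | succ t ih =>
      rw [Function.iterate_succ_apply']
      exact key _ ih.1 ih.2
  have := (this t).2
  rwa [(h []).1] at this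

/-- Besides weakening `Q`, this supplies the frame condition, so specifications need not mention
untouched registers; `decide` checks them against `Stmt.writes`. -/
theorem Ok.imp {B : ℕ} {s : Stmt} {σ : Store} {Q Q' : ℕ → Store → Prop} (h : Ok B s σ Q)
    (hQ : ∀ t σ', σ'.Bounded B → (∀ r, r ∉ s.writes → σ'.reg r = σ.reg r) → Q t σ' → Q' t σ') :
    Ok B s σ Q' := by
  intro hσ
  obtain ⟨t, σ', h₁, h₂⟩ := h hσ
  exact ⟨t, σ', hQ t σ' h₂.bounded (fun r hr => h₂.frame hr) h₁, h₂⟩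

theorem Ok.skip {B : ℕ} {σ : Store} {Q : ℕ → Store → Prop} (h : Q 1 σ) : Ok B .skip σ Q :=
  fun hσ => ⟨1, σ, h, .atomic hσ hσ fun _ => rfl⟩

theorem Ok.seq {B : ℕ} {s₁ s₂ : Stmt} {σ : Store} {Q : ℕ → Store → Prop}
    (h : Ok B s₁ σ fun t₁ σ₁ => Ok B s₂ σ₁ fun t₂ σ₂ => Q (1 + t₁ + t₂) σ₂) :
    Ok B (.seq s₁ s₂) σ Q := by
  intro hσ
  obtain ⟨t₁, σ₁, h₁, e₁⟩ := h hσ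
  obtain ⟨t₂, σ₂, h₂, e₂⟩ := h₁ e₁.bounded
  exact ⟨_, σ₂, h₂, e₁.seq hσ e₂⟩

theorem Ok.ite {B : ℕ} {b : Test} {s₁ s₂ : Stmt} {σ : Store} {Q : ℕ → Store → Prop}
    (h₁ : b.eval σ = true → Ok B s₁ σ fun t σ' => Q (1 + t) σ')
    (h₂ : b.eval σ = false → Ok B s₂ σ fun t σ' => Q (1 + t) σ') : Ok B (.ite b s₁ s₂) σ Q := by
  intro hσ
  cases hb : b.eval σ with
  | true =>
    obtain ⟨t, σ', h, e⟩ := h₁ hb hσ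
    exact ⟨_, σ', h, e.prepend hσ fun K => by simp [step, hb]⟩
  | false =>
    obtain ⟨t, σ', h, e⟩ := h₂ hb hσ
    exact ⟨_, σ', h, e.prepend hσ fun K => by simp [step, hb]⟩

/-- A precondition for loop-free statements, computed by recursion. -/
def wp (B : ℕ) : Stmt → (ℕ → Store → Prop) → Store → Prop
  | .skip, Q, σ => Q 1 σ
  | .const r k, Q, σ => k ≤ B ∧ Q 1 (σ.setReg r k)
  | .move r a, Q, σ => Q 1 (σ.setReg r (σ.reg a))
  | .add r a b, Q, σ => σ.reg a + σ.reg b ≤ B ∧ Q 1 (σ.setReg r (σ.reg a + σ.reg b))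
  | .sub r a b, Q, σ => Q 1 (σ.setReg r (σ.reg a - σ.reg b))
  | .mul r a b, Q, σ => σ.reg a * σ.reg b ≤ B ∧ Q 1 (σ.setReg r (σ.reg a * σ.reg b))
  | .load r a, Q, σ => Q 1 (σ.setReg r (σ.mem (σ.reg a)))
  | .store a b, Q, σ => Q 1 (σ.setMem (σ.reg a) (σ.reg b))
  | .seq s₁ s₂, Q, σ => wp B s₁ (fun t₁ σ₁ => wp B s₂ (fun t₂ σ₂ => Q (1 + t₁ + t₂) σ₂) σ₁) σ
  | .ite b s₁ s₂, Q, σ => (b.eval σ = true → wp B s₁ (fun t σ' => Q (1 + t) σ') σ) ∧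
      (b.eval σ = false → wp B s₂ (fun t σ' => Q (1 + t) σ') σ)
  | .loop b s, Q, σ => Ok B (.loop b s) σ Q

theorem Ok.of_wp {B : ℕ} {s : Stmt} {Q : ℕ → Store → Prop} {σ : Store} (h : wp B s Q σ) :
    Ok B s σ Q := by
  induction s generalizing Q σ with
  | skip => exact .skip h
  | const r k => exact fun hσ => ⟨1, _, h.2, .atomic hσ (hσ.setReg h.1) fun _ => rfl⟩
  | move r a => exact fun hσ => ⟨1, _, h, .atomic hσ (hσ.setReg (hσ.1 a)) fun _ => rfl⟩
  | add r a b => exact fun hσ => ⟨1, _, h.2, .atomic hσ (hσ.setReg h.1) fun _ => rfl⟩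
  | sub r a b =>
    exact fun hσ => ⟨1, _, h, .atomic hσ (hσ.setReg ((Nat.sub_le _ _).trans (hσ.1 a))) fun _ => rfl⟩
  | mul r a b => exact fun hσ => ⟨1, _, h.2, .atomic hσ (hσ.setReg h.1) fun _ => rfl⟩
  | load r a => exact fun hσ => ⟨1, _, h, .atomic hσ (hσ.setReg (hσ.2 _)) fun _ => rfl⟩
  | store a b => exact fun hσ => ⟨1, _, h, .atomic hσ (hσ.setMem (hσ.1 b)) fun _ => rfl⟩
  | seq s₁ s₂ ih₁ ih₂ => exact .seq ((ih₁ h).imp fun _ _ _ _ h => ih₂ h)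
  | ite b s₁ s₂ ih₁ ih₂ => exact .ite (fun hb => ih₁ (h.1 hb)) fun hb => ih₂ (h.2 hb)
  | loop b s => exact h

/-- The values that the control passes at the head of a loop. -/
theorem exists_trace {B : ℕ} {b : Test} {s : Stmt} (Inv : Store → Prop) (W : Store → ℕ)
    (R : Store → Store → Prop) (Wmax : ℕ) (hW : ∀ τ, Inv τ → W τ ≤ Wmax)
    (hstep : ∀ τ, Inv τ → b.eval τ = true →
      Ok B s τ fun t τ' => Inv τ' ∧ R τ τ' ∧ W τ + t + 1 ≤ W τ')
    {σ : Store} (hσ : σ.Bounded B) (h0 : Inv σ) :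
    ∃ (m : ℕ) (ss : ℕ → Store) (time : ℕ → ℕ), ss 0 = σ ∧ time 0 = 0 ∧
      (∀ i < m, R (ss i) (ss (i + 1)) ∧ time i < time (i + 1)) ∧
      Inv (ss m) ∧ b.eval (ss m) = false ∧ W σ + time m ≤ W (ss m) ∧
      ∀ K, (∀ i ≤ m, step^[time i] ⟨.loop b s :: K, σ⟩ = ⟨.loop b s :: K, ss i⟩) ∧
        ∀ t ≤ time m, (step^[t] ⟨.loop b s :: K, σ⟩).store.Bounded B := by
  -- Induction on the remaining budget: every pass raises `W` by at least its own duration,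
  -- including the test.
  obtain ⟨d, hd⟩ : ∃ d, d = Wmax - W σ := ⟨_, rfl⟩
  induction d using Nat.strong_induction_on generalizing σ with
  | _ d ih =>
    cases hb : b.eval σ with
    | false =>
      refine ⟨0, fun _ => σ, fun _ => 0, rfl, rfl, by simp, h0, hb, le_rfl, fun K => ⟨?_, ?_⟩⟩
      · simp
      · intro t ht
        obtain rfl : t = 0 := by simpa using ht
        exact hσ
    | true =>
      obtain ⟨t, σ', ⟨hI, hR, hle⟩, he⟩ := hstep σ h0 hb hσ
      have := hW σ' hI
      obtain ⟨m, ss, time, g0, g1, g2, g3, g4, g5, g6⟩ :=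
        ih (Wmax - W σ') (by omega) he.bounded hI rfl
      have hrun : ∀ K, step^[t + 1] ⟨.loop b s :: K, σ⟩ = ⟨.loop b s :: K, σ'⟩ := by
        intro K
        rw [Function.iterate_succ_apply]
        simp only [step, hb, if_true]
        exact (he _).1
      refine ⟨m + 1, fun i => if i = 0 then σ else ss (i - 1),
        fun i => if i = 0 then 0 else t + 1 + time (i - 1), by simp, by simp, ?_, by simpa using g3,
        by simpa using g4, by simp; omega, fun K => ⟨?_, ?_⟩⟩
      · intro i hi
        rcases i with _ | i
        · simp [g0, g1, hR]
        · have := g2 i (by omega)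
          simpa using this
      · intro i hi
        rcases i with _ | i
        · simp
        · have := (g6 K).1 i (by omega)
          simp only [Nat.add_eq_zero_iff, one_ne_zero, and_false, if_false, Nat.add_sub_cancel]
          rw [add_comm, Function.iterate_add_apply, hrun, this]
      · simp only [Nat.add_eq_zero_iff, one_ne_zero, and_false, if_false, Nat.add_sub_cancel]
        refine bounded_trans (hrun K) ?_ (g6 K).2
        intro u hu
        rcases u with _ | u
        · exact hσ
        · rw [Function.iterate_succ_apply]
          simp only [step, hb, if_true]
          exact (he _).2 u (by omega)

/-- The potential `W` serves both termination and amortised time: the total duration is at most its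
growth plus one step for the final test. -/
theorem Ok.loop {B : ℕ} {b : Test} {s : Stmt} {σ : Store} {Q : ℕ → Store → Prop}
    (Inv : Store → Prop) (W : Store → ℕ) (Wmax : ℕ) (hW : ∀ τ, Inv τ → W τ ≤ Wmax)
    (hstep : ∀ τ, Inv τ → b.eval τ = true → (∀ r, r ∉ s.writes → τ.reg r = σ.reg r) →
      Ok B s τ fun t τ' => Inv τ' ∧ W τ + t + 1 ≤ W τ')
    (h0 : Inv σ)
    (hQ : ∀ t τ, Inv τ → b.eval τ = false → (∀ r, r ∉ s.writes → τ.reg r = σ.reg r) →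
      W σ + t ≤ W τ + 1 → Q t τ) : Ok B (.loop b s) σ Q := by
  intro hσ
  obtain ⟨m, ss, time, g0, g1, g2, g3, g4, g5, g6⟩ := exists_trace (B := B) (b := b) (s := s)
    (fun τ => Inv τ ∧ ∀ r, r ∉ s.writes → τ.reg r = σ.reg r) W (fun _ _ => True) Wmax
    (fun τ h => hW τ h.1)
    (fun τ h hb => (hstep τ h.1 hb h.2).imp fun t τ' _ hf h' =>
      ⟨⟨h'.1, fun r hr => (hf r hr).trans (h.2 r hr)⟩, trivial, h'.2⟩) hσ ⟨h0, fun _ _ => rfl⟩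
  have hfin : ∀ K, step ⟨.loop b s :: K, ss m⟩ = ⟨K, ss m⟩ := fun K => by simp [step, g4]
  have hbd : (ss m).Bounded B := by
    have := (g6 []).2 (time m) le_rfl
    rwa [(g6 []).1 m le_rfl] at this
  refine ⟨time m + 1, ss m, hQ _ _ g3.1 g4 g3.2 (by omega), fun K => ⟨?_, ?_⟩⟩
  · rw [Function.iterate_succ_apply', (g6 K).1 m le_rfl, hfin]
  · refine bounded_trans ((g6 K).1 m le_rfl) (g6 K).2 ?_
    intro u hu
    rcases (show u = 0 ∨ u = 1 by omega) with rfl | rfl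
    · exact hbd
    · rw [Function.iterate_one, hfin]
      exact hbd

/-- `for i = 0, …, reg lim - 1`, with the constant 1 in register 3. -/
def forLoop (i lim : ℕ) (s : Stmt) : Stmt :=
  .seq (.const i 0) (.loop (.lt i lim) (.seq s (.add i i 3)))

/-- A pass costs three steps more than its body: test, sequencing and increment. Another three come
from the outer sequencing, the initialisation and the last test. -/
theorem Ok.forLoop {B : ℕ} {i lim : ℕ} {s : Stmt} {σ : Store} {Q : ℕ → Store → Prop}
    (N c : ℕ) (Inv : ℕ → Store → Prop)
    (hi : i ∉ s.writes ∧ lim ∉ s.writes ∧ 3 ∉ s.writes ∧ lim ≠ i ∧ 3 ≠ i)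
    (h3 : σ.reg 3 = 1) (hlim : σ.reg lim = N) (h0 : Inv 0 (σ.setReg i 0))
    (hstep : ∀ j < N, ∀ τ, τ.Bounded B → Inv j τ → τ.reg i = j →
      (∀ r, r ∉ i :: s.writes → τ.reg r = σ.reg r) →
      Ok B s τ fun t τ' => t ≤ c ∧ Inv (j + 1) (τ'.setReg i (j + 1)))
    (hQ : ∀ t τ, Inv N τ → τ.reg i = N → (∀ r, r ∉ i :: s.writes → τ.reg r = σ.reg r) →
      t ≤ (c + 3) * N + 3 → Q t τ) : Ok B (forLoop i lim s) σ Q := by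
  obtain ⟨hi, hl, hone, hli, h3i⟩ := hi
  intro hσ
  have hNB : N ≤ B := hlim ▸ hσ.1 lim
  have hσ' := hσ.setReg (r := i) (Nat.zero_le B)
  revert hσ
  refine Ok.seq (Ok.of_wp ⟨Nat.zero_le _, ?_⟩)
  refine Ok.loop (fun τ => ∃ j, j ≤ N ∧ τ.reg i = j ∧ Inv j τ ∧ τ.Bounded B ∧
    ∀ r, r ∉ i :: s.writes → τ.reg r = σ.reg r) (fun τ => (c + 3) * τ.reg i)
    ((c + 3) * N) ?_ ?_ ?_ ?_
  · rintro τ ⟨j, hj, hji, -⟩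
    exact Nat.mul_le_mul_left _ (hji ▸ hj)
  · rintro τ ⟨j, hj, hji, hI, hbd, hfr⟩ hb -
    have hlimτ : τ.reg lim = N := by
      rw [hfr lim (by simp [hl, hli]), hlim]
    have h3τ : τ.reg 3 = 1 := by
      rw [hfr 3 (by simp [hone, h3i]), h3]
    simp only [Test.eval, decide_eq_true_eq, hji, hlimτ] at hb
    refine Ok.seq ((hstep j hb τ hbd hI hji hfr).imp ?_)
    rintro t τ' hbd' hf ⟨ht, hI'⟩
    have e1 : τ'.reg i = j := (hf i hi).trans hji
    have e2 : τ'.reg 3 = 1 := (hf 3 hone).trans h3τ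
    refine Ok.of_wp ⟨by rw [e1, e2]; omega, ⟨j + 1, hb, by simp [e1, e2], ?_, ?_, ?_⟩, ?_⟩
    · rw [e1, e2]
      exact hI'
    · exact hbd'.setReg (by rw [e1, e2]; omega)
    · intro r hr
      simp only [List.mem_cons, not_or] at hr
      simp only [Store.setReg_reg, if_neg hr.1]
      rw [hf r hr.2, hfr r (by simp [hr])]
    · simp only [hji, Store.setReg_reg, if_true, e1, e2, Nat.mul_add]
      omega
  · refine ⟨0, Nat.zero_le _, by simp, h0, hσ', fun r hr => ?_⟩
    simp only [List.mem_cons, not_or] at hr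
    simp [hr.1]
  · rintro t τ ⟨j, hj, hji, hI, hbd, hfr⟩ hb - ht
    have hlimτ : τ.reg lim = N := by
      rw [hfr lim (by simp [hl, hli]), hlim]
    simp only [Test.eval, decide_eq_false_iff_not, hji, hlimτ, not_lt] at hb
    obtain rfl : j = N := by omega
    refine hQ _ τ hI hji hfr ?_
    simp only [Store.setReg_reg, if_true, hji] at ht
    omega

end RAM

namespace ComparabilityDigraph

open RAM

/-! ### Memory layout and constant registers. -/

section Layout

/-- Cell number `p` of the `k`-th block of memory; each block has `n * n + 1` cells. -/
def cell (n k p : ℕ) : ℕ := k * (n * n + 1) + p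

theorem index_lt {n : ℕ} (x y : Fin n) : (x : ℕ) * n + y < n * n := by
  have h₁ : (x : ℕ) + 1 ≤ n := x.2
  have h₂ := y.2
  have := Nat.mul_le_mul_right n h₁
  rw [Nat.add_mul] at this
  omega

theorem index_inj {n : ℕ} {x y x' y' : Fin n} :
    (x : ℕ) * n + y = x' * n + y' ↔ x = x' ∧ y = y' := by
  constructor
  · intro h
    have hn : 0 < n := x.pos
    have hy : (y : ℕ) = y' := by
      have := congrArg (· % n) h
      simpa [Nat.add_mod, Nat.mod_eq_of_lt y.2, Nat.mod_eq_of_lt y'.2] using this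
    rw [hy] at h
    exact ⟨Fin.ext (Nat.eq_of_mul_eq_mul_right hn (Nat.add_right_cancel h)), Fin.ext hy⟩
  · rintro ⟨rfl, rfl⟩
    rfl

theorem cell_inj {n k p k' p' : ℕ} (hp : p ≤ n * n) (hp' : p' ≤ n * n) :
    cell n k p = cell n k' p' ↔ k = k' ∧ p = p' := by
  constructor
  · intro h
    unfold cell at h
    have hk : k = k' := by
      have e : ∀ k p, p ≤ n * n → (k * (n * n + 1) + p) / (n * n + 1) = k := by
        intro k p hp
        rw [add_comm, Nat.add_mul_div_right _ _ (Nat.succ_pos _), Nat.div_eq_of_lt (by omega),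
          zero_add]
      rw [← e k p hp, h, e k' p' hp']
    subst hk
    exact ⟨rfl, by omega⟩
  · rintro ⟨rfl, rfl⟩
    rfl

/-- There are eight blocks: 0 for the input word, 1 for the arcs, 2 for the collected set, 3 for the
linked pairs, 4 and 5 for the two coordinates of the queue, 6 for the vertices already sorted, and 7
for the ordering. -/
theorem cell_le {n k p : ℕ} (hk : k ≤ 7) (hp : p ≤ n * n) : cell n k p ≤ 8 * (n * n + 1) := by
  unfold cell
  have := Nat.mul_le_mul_right (n * n + 1) hk
  omega

open Classical in
/-- The truth value of a proposition. -/
noncomputable def bit (p : Prop) : ℕ := if p then 1 else 0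

theorem bit_le (p : Prop) : bit p ≤ 1 := by
  unfold bit
  split_ifs <;> simp

@[simp] theorem bit_eq_zero {p : Prop} : bit p = 0 ↔ ¬ p := by
  unfold bit
  split_ifs <;> simp [*]

@[simp] theorem bit_eq_one {p : Prop} : bit p = 1 ↔ p := by
  unfold bit
  split_ifs <;> simp [*]

theorem bit_of {p : Prop} (h : p) : bit p = 1 := bit_eq_one.2 h

theorem bit_of_not {p : Prop} (h : ¬ p) : bit p = 0 := bit_eq_zero.2 h

theorem bit_mul_bit (p q : Prop) : bit p * bit q = bit (p ∧ q) := by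
  unfold bit
  split_ifs <;> simp_all

theorem one_sub_bit (p : Prop) : 1 - bit p = bit (¬ p) := by
  unfold bit
  split_ifs <;> simp_all

/-- Block `k` of the memory `m` holds the relation `R` as a matrix. -/
def IsMatrix (n : ℕ) (m : ℕ → ℕ) (k : ℕ) (R : Fin n → Fin n → Prop) : Prop :=
  ∀ x y : Fin n, m (cell n k (x * n + y)) = bit (R x y)

/-- A memory cell outside block `k` is unchanged when block `k` is written. -/
theorem update_cell {n k p k' p' : ℕ} (hp : p ≤ n * n) (hp' : p' ≤ n * n) (m : ℕ → ℕ) (v : ℕ) :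
    Function.update m (cell n k p) v (cell n k' p') =
      if k' = k ∧ p' = p then v else m (cell n k' p') := by
  rw [Function.update_apply]
  simp only [cell_inj hp' hp]

theorem update_cell_of_ne {n k p k' p' : ℕ} (hp : p ≤ n * n) (hp' : p' ≤ n * n) (hk : k' ≠ k)
    (m : ℕ → ℕ) (v : ℕ) :
    Function.update m (cell n k p) v (cell n k' p') = m (cell n k' p') := by
  rw [update_cell hp hp', if_neg fun h => hk h.1]

theorem IsMatrix.update_of_ne {n k k' p v : ℕ} {m : ℕ → ℕ} {R : Fin n → Fin n → Prop}
    (h : IsMatrix n m k R) (hk : k ≠ k') (hp : p ≤ n * n) :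
    IsMatrix n (Function.update m (cell n k' p) v) k R := by
  intro x y
  rw [update_cell_of_ne hp (index_lt x y).le hk, h x y]

theorem IsMatrix.update {n k : ℕ} {m : ℕ → ℕ} {R : Fin n → Fin n → Prop} (h : IsMatrix n m k R)
    (x y : Fin n) :
    IsMatrix n (Function.update m (cell n k (x * n + y)) 1) k
      (fun a b => R a b ∨ (a = x ∧ b = y)) := by
  intro a b
  rw [update_cell (index_lt x y).le (index_lt a b).le]
  simp only [index_inj]
  by_cases e : a = x ∧ b = y
  · rw [if_pos ⟨trivial, e⟩, bit_of (Or.inr e)]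
  · rw [if_neg fun h => e h.2, h a b]
    simp [e]

/-- The registers that stay constant: the number of vertices, the constants 0 and 1, and the
addresses of the blocks of memory. -/
structure Env (n : ℕ) (σ : Store) : Prop where
  r0 : σ.reg 0 = 0
  r1 : σ.reg 1 = 7 * (n * n + 1)
  r2 : σ.reg 2 = n
  r3 : σ.reg 3 = 1
  r4 : σ.reg 4 = 1 * (n * n + 1)
  r5 : σ.reg 5 = 0
  r6 : σ.reg 6 = 2 * (n * n + 1)
  r7 : σ.reg 7 = 3 * (n * n + 1)
  r8 : σ.reg 8 = 4 * (n * n + 1)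
  r9 : σ.reg 9 = 5 * (n * n + 1)
  r10 : σ.reg 10 = 6 * (n * n + 1)

theorem Env.of_eq {n : ℕ} {σ τ : Store} (h : Env n σ) (e : ∀ r ≤ 10, τ.reg r = σ.reg r) :
    Env n τ := by
  constructor
  · rw [e 0 (by omega), h.r0]
  · rw [e 1 (by omega), h.r1]
  · rw [e 2 (by omega), h.r2]
  · rw [e 3 (by omega), h.r3]
  · rw [e 4 (by omega), h.r4]
  · rw [e 5 (by omega), h.r5]
  · rw [e 6 (by omega), h.r6]
  · rw [e 7 (by omega), h.r7]
  · rw [e 8 (by omega), h.r8]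
  · rw [e 9 (by omega), h.r9]
  · rw [e 10 (by omega), h.r10]

theorem Env.setReg {n : ℕ} {σ : Store} (h : Env n σ) {r v : ℕ} (hr : 10 < r) :
    Env n (σ.setReg r v) :=
  h.of_eq fun i hi => by simp [show i ≠ r by omega]

theorem Env.setMem {n : ℕ} {σ : Store} (h : Env n σ) (a v : ℕ) : Env n (σ.setMem a v) :=
  h.of_eq fun _ _ => rfl

theorem Env.frame {n : ℕ} {σ τ : Store} (h : Env n σ) {l : List ℕ}
    (hf : ∀ r, r ∉ l → τ.reg r = σ.reg r) (hl : ∀ r ∈ l, 10 < r) : Env n τ :=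
  h.of_eq fun i hi => hf i fun hi' => by
    have := hl i hi'
    omega

end Layout

/-! ### Reading and writing matrices, and testing a link. -/

section Access

/-- `reg r := mem (reg b + (reg x * n + reg y))` -/
def getCell (r b x y : ℕ) : Stmt :=
  .seq (.mul 11 x 2) (.seq (.add 11 11 y) (.seq (.add 11 b 11) (.load r 11)))

/-- `mem (reg b + (reg x * n + reg y)) := reg v` -/
def setCell (b x y v : ℕ) : Stmt :=
  .seq (.mul 11 x 2) (.seq (.add 11 11 y) (.seq (.add 11 b 11) (.store 11 v)))

/-- `reg r := mem (reg b + reg i)` -/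
def getAt (r b i : ℕ) : Stmt := .seq (.add 11 b i) (.load r 11)

/-- `mem (reg b + reg i) := reg v` -/
def setAt (b i v : ℕ) : Stmt := .seq (.add 11 b i) (.store 11 v)

variable {n B : ℕ} {σ : Store} {Q : ℕ → Store → Prop}

/-- Four instructions and three sequencing steps make seven. Register 11 is the scratch register for
addresses, so operands read after its first use must avoid it. -/
theorem ok_getCell {r b x y k : ℕ} {X Y : Fin n} (hB : 8 * (n * n + 1) ≤ B) (h2 : σ.reg 2 = n)
    (hb : σ.reg b = k * (n * n + 1)) (hx : σ.reg x = X) (hy : σ.reg y = Y)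
    (hQ : Q 7 ((σ.setReg 11 (cell n k (X * n + Y))).setReg r (σ.mem (cell n k (X * n + Y)))))
    (hk : k ≤ 7 := by decide) (hd : b ≠ 11 ∧ y ≠ 11 := by decide) :
    Ok B (getCell r b x y) σ Q := by
  have hi := index_lt X Y
  have hc := cell_le hk hi.le
  unfold cell at hc
  apply Ok.of_wp
  simp only [getCell, wp, Store.setReg_reg, Store.setReg_mem, if_true,
    hd.1, hd.2, if_false, h2, hb, hx, hy]
  refine ⟨by omega, by omega, by omega, ?_⟩
  convert hQ using 1
  simp only [cell, Store.setReg]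
  simp

theorem ok_setCell {b x y v k : ℕ} {X Y : Fin n} (hB : 8 * (n * n + 1) ≤ B) (h2 : σ.reg 2 = n)
    (hb : σ.reg b = k * (n * n + 1)) (hx : σ.reg x = X) (hy : σ.reg y = Y)
    (hQ : Q 7 ((σ.setReg 11 (cell n k (X * n + Y))).setMem (cell n k (X * n + Y)) (σ.reg v)))
    (hk : k ≤ 7 := by decide) (hd : b ≠ 11 ∧ y ≠ 11 ∧ v ≠ 11 := by decide) :
    Ok B (setCell b x y v) σ Q := by
  have hi := index_lt X Y
  have hc := cell_le hk hi.le
  unfold cell at hc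
  apply Ok.of_wp
  simp only [setCell, wp, Store.setReg_reg, if_true,
    hd.1, hd.2.1, hd.2.2, if_false, h2, hb, hx, hy]
  refine ⟨by omega, by omega, by omega, ?_⟩
  convert hQ using 1
  simp only [cell, Store.setReg, Store.setMem]
  simp

theorem ok_getAt {r b i k p : ℕ} (hB : 8 * (n * n + 1) ≤ B)
    (hb : σ.reg b = k * (n * n + 1)) (hi : σ.reg i = p) (hp : p ≤ n * n)
    (hQ : Q 3 ((σ.setReg 11 (cell n k p)).setReg r (σ.mem (cell n k p))))
    (hk : k ≤ 7 := by decide) : Ok B (getAt r b i) σ Q := by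
  have hc := cell_le hk hp
  unfold cell at hc
  apply Ok.of_wp
  simp only [getAt, wp, Store.setReg_reg, Store.setReg_mem, if_true, hb, hi]
  exact ⟨by omega, hQ⟩

theorem ok_setAt {b i v k p : ℕ} (hB : 8 * (n * n + 1) ≤ B)
    (hb : σ.reg b = k * (n * n + 1)) (hi : σ.reg i = p) (hp : p ≤ n * n)
    (hQ : Q 3 ((σ.setReg 11 (cell n k p)).setMem (cell n k p) (σ.reg v)))
    (hk : k ≤ 7 := by decide) (hd : v ≠ 11 := by decide) : Ok B (setAt b i v) σ Q := by
  have hc := cell_le hk hp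
  unfold cell at hc
  apply Ok.of_wp
  simp only [setAt, wp, Store.setReg_reg, if_true, hb, hi, hd, if_false]
  exact ⟨by omega, hQ⟩

/-- `reg 13` becomes nonzero if and only if the pairs `(x, y)` and `(x, z)` directly force each
other, for `x, y, z` in the given registers. -/
def linkTest (x y z : ℕ) : Stmt :=
  .seq (getCell 14 4 y x) <| .seq (getCell 15 4 x z) <| .seq (getCell 16 4 y z) <|
  .seq (getCell 17 4 z x) <| .seq (getCell 18 4 x y) <| .seq (getCell 19 4 z y) <|
  .seq (.mul 14 14 15) <| .seq (.sub 16 3 16) <| .seq (.mul 14 14 16) <|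
  .seq (.mul 17 17 18) <| .seq (.sub 19 3 19) <| .seq (.mul 17 17 19) <|
  .seq (.add 13 14 17) <| .ite (.eq y z) (.const 13 0) .skip

/-- Logic is done in arithmetic on bits: product for "and", `1 - ·` for "not", sum for "or". The
case `Y = Z` is reset separately, since the sum could be nonzero there. -/
theorem ok_linkTest {D : Digraph (Fin n)} {x y z : ℕ} {X Y Z : Fin n}
    (hB : 8 * (n * n + 1) ≤ B) (hE : Env n σ) (hA : IsMatrix n σ.mem 1 D.Adj)
    (hx : σ.reg x = X) (hy : σ.reg y = Y) (hz : σ.reg z = Z)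
    (hd : 20 ≤ x ∧ 20 ≤ y ∧ 20 ≤ z := by decide) :
    Ok B (linkTest x y z) σ fun t τ => t ≤ 80 ∧ τ.mem = σ.mem ∧
      (τ.reg 13 = 0 ↔ ¬ Link D X Y Z) := by
  obtain ⟨dx, dy, dz⟩ := hd
  have nx : ∀ i < 20, x ≠ i := fun i hi => by omega
  have ny : ∀ i < 20, y ≠ i := fun i hi => by omega
  have nz : ∀ i < 20, z ≠ i := fun i hi => by omega
  have h2 := hE.r2
  have h4 := hE.r4
  have h3 := hE.r3
  have a1 := hA Y X
  have a2 := hA X Z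
  have a3 := hA Y Z
  have a4 := hA Z X
  have a5 := hA X Y
  have a6 := hA Z Y
  unfold linkTest
  refine .seq (ok_getCell hB h2 h4 hy hx ?_ (hd := ⟨by decide, nx _ (by decide)⟩))
  refine .seq (ok_getCell hB (X := X) (Y := Z) (k := 1) (by simp [h2]) (by simp [h4])
    (by simp [nx, hx]) (by simp [nz, hz]) ?_ (hd := ⟨by decide, nz _ (by decide)⟩))
  refine .seq (ok_getCell hB (X := Y) (Y := Z) (k := 1) (by simp [h2]) (by simp [h4])
    (by simp [ny, hy]) (by simp [nz, hz]) ?_ (hd := ⟨by decide, nz _ (by decide)⟩))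
  refine .seq (ok_getCell hB (X := Z) (Y := X) (k := 1) (by simp [h2]) (by simp [h4])
    (by simp [nz, hz]) (by simp [nx, hx]) ?_ (hd := ⟨by decide, nx _ (by decide)⟩))
  refine .seq (ok_getCell hB (X := X) (Y := Y) (k := 1) (by simp [h2]) (by simp [h4])
    (by simp [nx, hx]) (by simp [ny, hy]) ?_ (hd := ⟨by decide, ny _ (by decide)⟩))
  refine .seq (ok_getCell hB (X := Z) (Y := Y) (k := 1) (by simp [h2]) (by simp [h4])
    (by simp [nz, hz]) (by simp [ny, hy]) ?_ (hd := ⟨by decide, ny _ (by decide)⟩))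
  apply Ok.of_wp
  simp only [wp, Store.setReg_reg, Store.setReg_mem, a1, a2, a3, a4, a5, a6, h3]
  have hb : ∀ p, bit p ≤ B := fun p => (bit_le p).trans (by omega)
  simp [Test.eval, ny, nz, hy, hz, bit_mul_bit, one_sub_bit, hb]
  refine ⟨?_, fun h hl => hl.1 (Fin.ext h), fun h => ?_⟩
  · have h₁ := bit_le ((D.Adj Y X ∧ D.Adj X Z) ∧ ¬ D.Adj Y Z)
    have h₂ := bit_le ((D.Adj Z X ∧ D.Adj X Y) ∧ ¬ D.Adj Z Y)
    omega
  · have : Y ≠ Z := fun e => h (congrArg _ e)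
    simp only [Link]
    tauto

end Access

end ComparabilityDigraph

namespace ComparabilityDigraph

open RAM

/-! ### Testing semicompleteness and marking the linked pairs. -/

section Preprocessing

variable {n B : ℕ} {D : Digraph (Fin n)}

theorem IsMatrix.congr {m : ℕ → ℕ} {k : ℕ} {R R' : Fin n → Fin n → Prop} (h : IsMatrix n m k R)
    (e : ∀ x y, R x y ↔ R' x y) : IsMatrix n m k R' := fun x y => by
  rw [h x y, propext (e x y)]

/-- `reg 25` becomes 1 if the digraph is semicomplete, and 0 otherwise. -/
def semicompleteTest : Stmt :=
  .seq (.const 25 1) <| forLoop 20 2 <| forLoop 21 2 <|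
    .seq (getCell 14 4 20 21) <| .seq (getCell 15 4 21 20) <| .seq (.add 14 14 15) <|
    .ite (.eq 14 5) (.ite (.eq 20 21) .skip (.const 25 0)) .skip

theorem ok_semicompleteTest {σ : Store} (hB : 8 * (n * n + 1) ≤ B) (hE : Env n σ)
    (hA : IsMatrix n σ.mem 1 D.Adj) :
    Ok B semicompleteTest σ fun t τ => t ≤ (33 * n + 6) * n + 5 ∧ τ.mem = σ.mem ∧
      τ.reg 25 = bit (IsSemicomplete D) := by
  -- The argument describes the set of pairs tested so far, which grows lexicographically.
  let good : (Fin n → Fin n → Prop) → Prop :=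
    fun P => ∀ x y, P x y → x ≠ y → D.Adj x y ∨ D.Adj y x
  refine .seq (Ok.of_wp ⟨by omega, ?_⟩)
  refine Ok.forLoop n (33 * n + 3) (fun i τ => τ.mem = σ.mem ∧
    τ.reg 25 = bit (good fun x _ => x < i)) (by decide) (by simp [hE.r3]) (by simp [hE.r2])
    ⟨rfl, by simp [good, bit_of]⟩ ?_ ?_
  · rintro i hi τ hτ ⟨hm, hg⟩ h20 hf
    have hE' : Env n τ := (hE.setReg (by decide)).frame hf (by decide)
    refine Ok.forLoop n 30 (fun j τ' => τ'.mem = σ.mem ∧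
      τ'.reg 25 = bit (good fun x y => x < i ∨ (x = i ∧ y < j))) (by decide) hE'.r3 hE'.r2
      ⟨hm, by simp [hg]⟩ ?_ ?_
    · rintro j hj ρ hρ ⟨hm', hg'⟩ h21 hf'
      have hE'' : Env n ρ := hE'.frame hf' (by decide)
      have h20' : ρ.reg 20 = i := (hf' 20 (by decide)).trans h20
      have a1 := hA ⟨i, hi⟩ ⟨j, hj⟩
      have a2 := hA ⟨j, hj⟩ ⟨i, hi⟩
      refine .seq (ok_getCell hB (X := ⟨i, hi⟩) (Y := ⟨j, hj⟩) hE''.r2 hE''.r4 h20' h21 ?_)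
      refine .seq (ok_getCell hB (X := ⟨j, hj⟩) (Y := ⟨i, hi⟩) (k := 1) (by simp [hE''.r2])
        (by simp [hE''.r4]) (by simp [h21]) (by simp [h20']) ?_)
      apply Ok.of_wp
      simp only [wp, Store.setReg_reg, Store.setReg_mem, hm', a1, a2]
      have h₁ := bit_le (D.Adj ⟨i, hi⟩ ⟨j, hj⟩)
      have h₂ := bit_le (D.Adj ⟨j, hj⟩ ⟨i, hi⟩)
      have split : ∀ {v : ℕ}, (v = bit (good fun x y => x < i ∨ (x = i ∧ y < j + 1)) ↔
          v = bit ((good fun x y => x < i ∨ (x = i ∧ y < j)) ∧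
            ((⟨i, hi⟩ : Fin n) ≠ ⟨j, hj⟩ → D.Adj ⟨i, hi⟩ ⟨j, hj⟩ ∨ D.Adj ⟨j, hj⟩ ⟨i, hi⟩))) := by
        intro v
        have : (good fun x y => x < i ∨ (x = i ∧ y < j + 1)) ↔
            ((good fun x y => x < i ∨ (x = i ∧ y < j)) ∧
              ((⟨i, hi⟩ : Fin n) ≠ ⟨j, hj⟩ → D.Adj ⟨i, hi⟩ ⟨j, hj⟩ ∨ D.Adj ⟨j, hj⟩ ⟨i, hi⟩)) := by
          constructor
          · exact fun h => ⟨fun x y hxy => h x y (by omega), h _ _ (Or.inr ⟨rfl, by simp⟩)⟩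
          · rintro ⟨h, h'⟩ x y hxy
            by_cases e : (x : ℕ) = i ∧ (y : ℕ) = j
            · obtain rfl : x = ⟨i, hi⟩ := Fin.ext e.1
              obtain rfl : y = ⟨j, hj⟩ := Fin.ext e.2
              exact h'
            · exact h x y (by omega)
        rw [propext this]
      simp only [split]
      simp [Test.eval, h20', h21, hE''.r5, hg']
      refine ⟨by omega, ⟨fun n₁ n₂ => ⟨fun e => ?_, fun e => ?_⟩, fun h => ?_⟩⟩
      · simp [e]
      · simp only [bit]
        rw [if_neg]
        simp [e, n₁, n₂]
      · congr 1
        simp only [eq_iff_iff, iff_self_and]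
        tauto
    · rintro t ρ ⟨hm', hg'⟩ h21 hf' ht
      refine ⟨by omega, by simp [hm'], ?_⟩
      simp only [Store.setReg_reg]
      rw [if_neg (by decide), hg']
      congr 1
      simp only [good, eq_iff_iff]
      exact ⟨fun h x y hxy => h x y (by omega), fun h x y hxy => h x y (by omega)⟩
  · rintro t τ ⟨hm, hg⟩ - hf ht
    refine ⟨by ring_nf at ht ⊢; omega, hm, ?_⟩
    rw [hg]
    congr 1
    simp [good, IsSemicomplete]

/-- Mark the pairs that lie in implication classes with several elements. -/
def markLinked : Stmt :=
  forLoop 20 2 <| forLoop 21 2 <| forLoop 22 2 <|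
    .seq (linkTest 20 21 22) <| .ite (.eq 13 5) .skip <|
      .seq (setCell 7 20 21 3) (setCell 7 21 20 3)

/-- The pairs marked after the triples in `P` have been tested. -/
def marked (D : Digraph (Fin n)) (P : ℕ → ℕ → ℕ → Prop) (a b : Fin n) : Prop :=
  ∃ x y z : Fin n, P x y z ∧ Link D x y z ∧ ((a = x ∧ b = y) ∨ (a = y ∧ b = x))

theorem marked_congr {P P' : ℕ → ℕ → ℕ → Prop}
    (h : ∀ x y z, x < n → y < n → z < n → (P x y z ↔ P' x y z)) (a b : Fin n) :
    marked D P a b ↔ marked D P' a b := by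
  constructor
  · rintro ⟨x, y, z, hP, h'⟩
    exact ⟨x, y, z, (h x y z x.2 y.2 z.2).1 hP, h'⟩
  · rintro ⟨x, y, z, hP, h'⟩
    exact ⟨x, y, z, (h x y z x.2 y.2 z.2).2 hP, h'⟩

/-- Whether a class has several elements is visible at any of its pairs, so testing all triples for
a link suffices and no class has to be computed. -/
theorem ok_markLinked {σ : Store} (hB : 8 * (n * n + 1) ≤ B) (hE : Env n σ)
    (hA : IsMatrix n σ.mem 1 D.Adj) (h0 : ∀ k p, 2 ≤ k → p ≤ n * n → σ.mem (cell n k p) = 0) :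
    Ok B markLinked σ fun t τ => t ≤ ((103 * n + 6) * n + 6) * n + 3 ∧
      IsMatrix n τ.mem 3 (Linked D) ∧
      ∀ k p, k ≠ 3 → p ≤ n * n → τ.mem (cell n k p) = σ.mem (cell n k p) := by
  let Inv : (ℕ → ℕ → ℕ → Prop) → Store → Prop := fun P τ => IsMatrix n τ.mem 3 (marked D P) ∧
      ∀ k p, k ≠ 3 → p ≤ n * n → τ.mem (cell n k p) = σ.mem (cell n k p)
  have congr : ∀ {P P' : ℕ → ℕ → ℕ → Prop} {τ : Store}, Inv P τ →
      (∀ x y z, x < n → y < n → z < n → (P x y z ↔ P' x y z)) → Inv P' τ :=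
    fun h e => ⟨h.1.congr (marked_congr e), h.2⟩
  refine Ok.forLoop n ((103 * n + 6) * n + 3) (fun i => Inv fun x _ _ => x < i) (by decide)
    hE.r3 hE.r2 ⟨fun x y => ?_, fun _ _ _ _ => rfl⟩ ?_ ?_
  · rw [bit_of_not]
    · exact h0 _ _ (by omega) (index_lt x y).le
    · simp [marked]
  · rintro i hi τ - hI h20 hf
    have hE' : Env n τ := hE.frame hf (by decide)
    refine Ok.forLoop n (103 * n + 3) (fun j => Inv fun x y _ => x < i ∨ (x = i ∧ y < j))
      (by decide) hE'.r3 hE'.r2 (congr hI (by simp)) ?_ ?_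
    · rintro j hj ρ - hI h21 hf'
      have hE'' : Env n ρ := hE'.frame hf' (by decide)
      have h20' : ρ.reg 20 = i := (hf' 20 (by decide)).trans h20
      refine Ok.forLoop n 100
        (fun k => Inv fun x y z => x < i ∨ (x = i ∧ y < j) ∨ (x = i ∧ y = j ∧ z < k))
        (by decide) hE''.r3 hE''.r2 (congr hI (by simp)) ?_ ?_
      · rintro k hk π - hI h22 hf''
        have hE₃ : Env n π := hE''.frame hf'' (by decide)
        have g20 : π.reg 20 = i := (hf'' 20 (by decide)).trans h20'
        have g21 : π.reg 21 = j := (hf'' 21 (by decide)).trans h21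
        have hAπ : IsMatrix n π.mem 1 D.Adj := fun x y => by
          rw [hI.2 _ _ (by decide) (index_lt x y).le, hA x y]
        refine .seq ((ok_linkTest hB hE₃ hAπ (X := ⟨i, hi⟩) (Y := ⟨j, hj⟩) (Z := ⟨k, hk⟩)
          g20 g21 h22).imp ?_)
        rintro t₁ π₁ - hf₁ ⟨ht₁, hm₁, hl⟩
        have hE₄ : Env n π₁ := hE₃.frame hf₁ (by decide)
        have g20 : π₁.reg 20 = i := (hf₁ 20 (by decide)).trans g20
        have g21 : π₁.reg 21 = j := (hf₁ 21 (by decide)).trans g21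
        refine .ite (fun hb => ?_) (fun hb => ?_)
        · simp only [Test.eval, hE₄.r5, decide_eq_true_eq, hl] at hb
          refine .skip ⟨by omega, ?_, ?_⟩
          · simp only [Store.setReg_mem, hm₁]
            refine hI.1.congr fun a b => ?_
            constructor
            · rintro ⟨x, y, z, hP, h'⟩
              exact ⟨x, y, z, by omega, h'⟩
            · rintro ⟨x, y, z, hP, h'⟩
              refine ⟨x, y, z, ?_, h'⟩
              by_contra hne
              obtain rfl : x = ⟨i, hi⟩ := Fin.ext (by simp; omega)
              obtain rfl : y = ⟨j, hj⟩ := Fin.ext (by simp; omega)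
              obtain rfl : z = ⟨k, hk⟩ := Fin.ext (by simp at hP hne ⊢; omega)
              exact hb h'.1
          · simp only [Store.setReg_mem, hm₁]
            exact hI.2
        · simp only [Test.eval, hE₄.r5, decide_eq_false_iff_not, hl, not_not] at hb
          refine .seq (ok_setCell hB (X := ⟨i, hi⟩) (Y := ⟨j, hj⟩) hE₄.r2 hE₄.r7 g20 g21 ?_)
          refine ok_setCell hB (X := ⟨j, hj⟩) (Y := ⟨i, hi⟩) (k := 3) (by simp [hE₄.r2])
            (by simp [hE₄.r7]) (by simp [g21]) (by simp [g20]) ?_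
          have hmem : ∀ {v a b c d : ℕ}, (((((π₁.setReg 11 a).setMem b (π₁.reg 3)).setReg 11 c).setMem
              d (((π₁.setReg 11 a).setMem b (π₁.reg 3)).reg 3)).setReg 22 v).mem =
              Function.update (Function.update π.mem b 1) d 1 := by
            simp [Store.setMem_mem, hm₁, hE₄.r3]
          refine ⟨by omega, ?_, ?_⟩ <;> rw [hmem]
          · refine ((hI.1.update ⟨i, hi⟩ ⟨j, hj⟩).update ⟨j, hj⟩ ⟨i, hi⟩).congr fun a b => ?_
            constructor
            · rintro ((⟨x, y, z, hP, h'⟩ | h) | h)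
              · exact ⟨x, y, z, by omega, h'⟩
              · exact ⟨_, _, _, Or.inr (Or.inr ⟨rfl, rfl, Nat.lt_succ_self k⟩), hb, Or.inl h⟩
              · exact ⟨_, _, _, Or.inr (Or.inr ⟨rfl, rfl, Nat.lt_succ_self k⟩), hb, Or.inr h⟩
            · rintro ⟨x, y, z, hP, h'⟩
              by_cases hne : (x : ℕ) = i ∧ (y : ℕ) = j ∧ (z : ℕ) = k
              · obtain rfl : x = ⟨i, hi⟩ := Fin.ext hne.1
                obtain rfl : y = ⟨j, hj⟩ := Fin.ext hne.2.1
                rcases h'.2 with h | h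
                · exact Or.inl (Or.inr h)
                · exact Or.inr h
              · exact Or.inl (Or.inl ⟨x, y, z, by omega, h'⟩)
          · intro k' p hk' hp
            rw [update_cell_of_ne (index_lt _ _).le hp hk',
              update_cell_of_ne (index_lt _ _).le hp hk', hI.2 k' p hk' hp]
      · rintro t π hI - - ht
        exact ⟨by omega, congr (P' := fun x y _ => x < i ∨ (x = i ∧ y < j + 1)) hI
          (fun x y z hx hy hz => by omega)⟩
    · rintro t ρ hI - - ht
      refine ⟨by ring_nf at ht ⊢; omega, congr (P' := fun x _ _ => x < i + 1) hI
        (fun x y z hx hy hz => by omega)⟩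
  · rintro t τ hI - - ht
    refine ⟨by ring_nf at ht ⊢; omega, hI.1.congr fun a b => ?_, hI.2⟩
    constructor
    · rintro ⟨x, y, z, -, hl, ⟨rfl, rfl⟩ | ⟨rfl, rfl⟩⟩
      · exact ⟨z, Or.inl hl⟩
      · exact ⟨z, Or.inr hl⟩
    · rintro ⟨z, hl | hl⟩
      · exact ⟨a, b, z, a.2, hl, Or.inl ⟨rfl, rfl⟩⟩
      · exact ⟨b, a, z, b.2, hl, Or.inr ⟨rfl, rfl⟩⟩

end Preprocessing

end ComparabilityDigraph

namespace ComparabilityDigraph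

open RAM

/-! ### Reading the adjacency lists. -/

section Input

variable {n B : ℕ} {D : Digraph (Fin n)} {L : Fin n → List (Fin n)}

/-- The part of the input word that belongs to the vertex `x`. -/
def inputPart (L : Fin n → List (Fin n)) (x : Fin n) : List ℕ :=
  (L x).length :: (L x).map Fin.val

/-- The position of the `j`-th adjacency list in the input word. -/
def inputOffset (L : Fin n → List (Fin n)) (j : ℕ) : ℕ :=
  1 + (((List.finRange n).take j).flatMap (inputPart L)).length

theorem inputOffset_zero : inputOffset L 0 = 1 := by simp [inputOffset]

theorem take_finRange_succ {j : ℕ} (hj : j < n) :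
    (List.finRange n).take (j + 1) = (List.finRange n).take j ++ [⟨j, hj⟩] := by
  rw [List.take_succ_eq_append_getElem (by simpa using hj)]
  simp

theorem inputOffset_succ {j : ℕ} (hj : j < n) :
    inputOffset L (j + 1) = inputOffset L j + 1 + (L ⟨j, hj⟩).length := by
  simp only [inputOffset, take_finRange_succ hj, List.flatMap_append, List.flatMap_cons,
    List.flatMap_nil, List.append_nil, List.length_append, inputPart, List.length_cons,
    List.length_map]
  omega

theorem inputWord_getElem? {j i : ℕ} (hj : j < n) (hi : i ≤ (L ⟨j, hj⟩).length) :
    (inputWord L)[inputOffset L j + i]? = (inputPart L ⟨j, hj⟩)[i]? := by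
  have h : inputWord L = (n :: ((List.finRange n).take j).flatMap (inputPart L)) ++
      (inputPart L ⟨j, hj⟩ ++ ((List.finRange n).drop (j + 1)).flatMap (inputPart L)) := by
    unfold inputWord
    change n :: (List.finRange n).flatMap (inputPart L) = _
    conv_lhs => rw [← List.take_append_drop (j + 1) (List.finRange n), take_finRange_succ hj]
    simp
  rw [h, List.getElem?_append_right (by simp [inputOffset]; omega),
    List.getElem?_append_left (by simp [inputOffset, inputPart]; omega)]
  congr 1
  simp [inputOffset]
  omega

theorem inputWord_getD_length {j : ℕ} (hj : j < n) :
    (inputWord L).getD (inputOffset L j) 0 = (L ⟨j, hj⟩).length := by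
  have := inputWord_getElem? (L := L) hj (Nat.zero_le _)
  rw [add_zero] at this
  simp [List.getD_eq_getElem?_getD, this, inputPart]

theorem inputWord_getD_entry {j i : ℕ} (hj : j < n) (hi : i < (L ⟨j, hj⟩).length) :
    (inputWord L).getD (inputOffset L j + 1 + i) 0 = (L ⟨j, hj⟩)[i] := by
  have := inputWord_getElem? (L := L) (i := i + 1) hj hi
  rw [show inputOffset L j + (i + 1) = inputOffset L j + 1 + i by omega] at this
  simp [List.getD_eq_getElem?_getD, this, inputPart, hi]

theorem IsAdjacencyLists.length_lt (hL : IsAdjacencyLists D L) (hD : IsLoopless D) (x : Fin n) :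
    (L x).length + 1 ≤ n := by
  have hnd : (x :: L x).Nodup := by
    refine List.nodup_cons.2 ⟨fun h => hD x (((hL x).2 x).1 h), (hL x).1⟩
  simpa using hnd.length_le_card

theorem inputOffset_le (hL : IsAdjacencyLists D L) (hD : IsLoopless D) {j : ℕ} (hj : j ≤ n) :
    inputOffset L j ≤ 1 + j * n := by
  induction j with
  | zero => simp [inputOffset_zero]
  | succ j ih =>
    have h₁ := ih (by omega)
    have h₂ := hL.length_lt hD ⟨j, hj⟩
    rw [inputOffset_succ hj, Nat.add_mul]
    omega

/-- In a loopless digraph a list with its length takes at most `n` cells. Thus the input fits into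
block 0, and the matrices written later do not overwrite it. -/
theorem length_inputWord (hL : IsAdjacencyLists D L) (hD : IsLoopless D) :
    (inputWord L).length ≤ n * n + 1 := by
  have h := inputOffset_le hL hD (le_refl n)
  have e : inputOffset L n = (inputWord L).length := by
    rw [inputOffset, List.take_of_length_le (by simp), inputWord, List.length_cons, add_comm]
    rfl
  omega

theorem inputWord_getD_le (hL : IsAdjacencyLists D L) (hD : IsLoopless D) (i : ℕ) :
    (inputWord L).getD i 0 ≤ n := by
  have : ∀ a ∈ inputWord L, a ≤ n := by
    intro a ha
    simp only [inputWord, List.mem_cons, List.mem_flatMap, List.mem_map] at ha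
    rcases ha with rfl | ⟨x, -, rfl | ⟨y, -, rfl⟩⟩
    · exact le_rfl
    · have := hL.length_lt hD x
      omega
    · exact y.2.le
  rw [List.getD_eq_getElem?_getD]
  rcases h : (inputWord L)[i]? with _ | a
  · simp
  · exact this a (List.mem_of_getElem? h)

/-- Set up the constant registers. -/
def initRegs : Stmt :=
  .seq (.load 2 5) <| .seq (.const 3 1) <| .seq (.mul 4 2 2) <| .seq (.add 4 4 3) <|
  .seq (.add 6 4 4) <| .seq (.add 7 6 4) <| .seq (.add 8 7 4) <| .seq (.add 9 8 4) <|
  .seq (.add 10 9 4) (.add 1 10 4)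

theorem ok_initRegs {σ : Store} (hB : 8 * (n * n + 1) ≤ B) (hr : ∀ i, σ.reg i = 0)
    (hm : σ.mem 0 = n) :
    Ok B initRegs σ fun t τ => t ≤ 30 ∧ τ.mem = σ.mem ∧ Env n τ := by
  apply Ok.of_wp
  simp [initRegs, wp, hr, hm]
  refine ⟨by omega, by omega, by omega, by omega, by omega, by omega, by omega, by omega, by omega,
    ?_⟩
  constructor <;> simp [hr] <;> omega

/-- Convert the adjacency lists to an adjacency matrix. -/
def readInput : Stmt :=
  .seq (.const 20 1) <| forLoop 21 2 <| .seq (.load 22 20) <| .seq (.add 20 20 3) <|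
    forLoop 23 22 <| .seq (.load 24 20) <| .seq (.add 20 20 3) (setCell 4 21 24 3)

theorem ok_readInput {σ : Store} (hB : 8 * (n * n + 1) ≤ B) (hE : Env n σ)
    (hL : IsAdjacencyLists D L) (hD : IsLoopless D)
    (hm : ∀ i, σ.mem i = (inputWord L).getD i 0) :
    Ok B readInput σ fun t τ => t ≤ (23 * n + 20) * n + 10 ∧ IsMatrix n τ.mem 1 D.Adj ∧
      ∀ k p, 2 ≤ k → p ≤ n * n → τ.mem (cell n k p) = 0 := by
  have hlen := length_inputWord hL hD
  -- Block 1 holds the arcs read so far, while the input in block 0 and the zeros from block 2 on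
  -- are intact.
  let Inv : (Fin n → Fin n → Prop) → Store → Prop := fun R τ => IsMatrix n τ.mem 1 R ∧
      (∀ i ≤ n * n, τ.mem i = (inputWord L).getD i 0) ∧
      ∀ k p, 2 ≤ k → p ≤ n * n → τ.mem (cell n k p) = 0
  have far : ∀ k p, 1 ≤ k → (inputWord L).getD (cell n k p) 0 = 0 := by
    intro k p hk
    rw [List.getD_eq_default]
    unfold cell
    have := Nat.mul_le_mul_right (n * n + 1) hk
    omega
  refine .seq (Ok.of_wp ⟨by omega, ?_⟩)
  refine Ok.forLoop n (23 * n + 17) (fun j τ => τ.reg 20 = inputOffset L j ∧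
    Inv (fun x y => x < j ∧ D.Adj x y) τ) (by decide) (by simp [hE.r3]) (by simp [hE.r2])
    ⟨by simp [inputOffset_zero], ?_, ?_, ?_⟩ ?_ ?_
  · intro x y
    simp only [Store.setReg_mem, hm]
    rw [far _ _ le_rfl, bit_of_not (by simp)]
  · exact fun i _ => hm i
  · intro k p hk hp
    simp only [Store.setReg_mem, hm]
    exact far _ _ (by omega)
  · rintro j hj τ - ⟨h20, hI⟩ h21 hf
    have hE' : Env n τ := (hE.setReg (by decide)).frame hf (by decide)
    have hlj := hL.length_lt hD ⟨j, hj⟩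
    have hoff := inputOffset_le hL hD (j := j + 1) hj
    have hsq : (j + 1) * n ≤ n * n := Nat.mul_le_mul_right n hj
    rw [inputOffset_succ hj] at hoff
    refine .seq (Ok.of_wp ?_)
    refine Ok.seq (Ok.of_wp ⟨?_, ?_⟩)
    · simp only [Store.setReg_reg, h20, hE'.r3]
      simp
      omega
    refine Ok.forLoop (L ⟨j, hj⟩).length 20 (fun i ρ => ρ.reg 20 = inputOffset L j + 1 + i ∧
      Inv (fun x y => (x < j ∧ D.Adj x y) ∨ (x = j ∧ y ∈ (L ⟨j, hj⟩).take i)) ρ) (by decide)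
      (by simp [hE'.r3]) ?_ ⟨?_, ?_⟩ ?_ ?_
    · simp only [Store.setReg_reg, h20]
      simp
      rw [hI.2.1 _ (by omega)]
      exact inputWord_getD_length hj
    · simp [h20, hE'.r3]
    · simpa [Inv] using hI
    · rintro i hi ρ - ⟨h20', hI'⟩ h23 hf'
      have hE'' : Env n ρ := by
        refine Env.frame ?_ hf' (by decide)
        exact (hE'.setReg (by decide)).setReg (by decide)
      have h21' : ρ.reg 21 = j := (hf' 21 (by decide)).trans (by simpa using h21)
      have hval : ρ.mem (ρ.reg 20) = ((L ⟨j, hj⟩)[i] : ℕ) := by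
        rw [h20', hI'.2.1 _ (by omega)]
        exact inputWord_getD_entry hj hi
      refine .seq (Ok.of_wp ?_)
      refine Ok.seq (Ok.of_wp ⟨?_, ?_⟩)
      · simp only [Store.setReg_reg, h20', hE''.r3]
        simp
        omega
      refine ok_setCell hB (X := ⟨j, hj⟩) (Y := (L ⟨j, hj⟩)[i]) (k := 1) (by simp [hE''.r2])
        (by simp [hE''.r4]) (by simp [h21']) (by simp [hval]) ?_
      refine ⟨by omega, by simp [h20', hE''.r3]; omega, ?_⟩
      have hmem : ∀ {v a b c d : ℕ}, ((((((ρ.setReg 24 a).setReg 20 b).setReg 11 c).setMem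
          d (((ρ.setReg 24 a).setReg 20 b).reg 3)).setReg 23 v).mem) =
          Function.update ρ.mem d 1 := by
        simp [Store.setMem_mem, hE''.r3]
      simp only [Inv, hmem]
      refine ⟨?_, ?_, ?_⟩
      · refine (hI'.1.update ⟨j, hj⟩ (L ⟨j, hj⟩)[i]).congr fun x y => ?_
        rw [List.take_succ_eq_append_getElem hi]
        simp only [List.mem_append, List.mem_singleton, Fin.ext_iff]
        tauto
      · intro i' hi'
        rw [Function.update_of_ne, hI'.2.1 i' hi']
        unfold cell
        omega
      · intro k p hk hp
        rw [update_cell_of_ne (index_lt ⟨j, hj⟩ (L ⟨j, hj⟩)[i]).le hp (by omega), hI'.2.2 k p hk hp]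
    · rintro t ρ ⟨h20', hI'⟩ - - ht
      have hle : (20 + 3) * (L ⟨j, hj⟩).length ≤ 23 * n := by omega
      refine ⟨by omega, by simp [h20', inputOffset_succ hj], ?_, hI'.2⟩
      refine hI'.1.congr fun x y => ?_
      rw [List.take_length, Nat.lt_succ_iff_lt_or_eq]
      constructor
      · rintro (h | ⟨h, h'⟩)
        · exact ⟨Or.inl h.1, h.2⟩
        · obtain rfl : x = ⟨j, hj⟩ := Fin.ext h
          exact ⟨Or.inr rfl, ((hL _).2 y).1 h'⟩
      · rintro ⟨h | h, h'⟩
        · exact Or.inl ⟨h, h'⟩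
        · obtain rfl : x = ⟨j, hj⟩ := Fin.ext h
          exact Or.inr ⟨rfl, ((hL _).2 y).2 h'⟩
  · rintro t τ ⟨-, hI⟩ - - ht
    exact ⟨by ring_nf at ht ⊢; omega, hI.1.congr fun x y => by simp, hI.2.2⟩

end Input

end ComparabilityDigraph

namespace ComparabilityDigraph

open RAM

/-! ### The collected set as a queue, and its closure under forcing. -/

section Queue

variable {n B : ℕ} {D : Digraph (Fin n)}

/-- The memory `m` holds the list `q` of pairs, both as a queue in blocks 4 and 5 and as a
matrix in block 2. -/
structure IsQueue (n : ℕ) (m : ℕ → ℕ) (q : List (Fin n × Fin n)) : Prop where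
  nodup : q.Nodup
  matrix : IsMatrix n m 2 (fun x y => (x, y) ∈ q)
  entry : ∀ (i : ℕ) (x y : Fin n), q[i]? = some (x, y) → m (cell n 4 i) = (x : ℕ) ∧ m (cell n 5 i) = (y : ℕ)

theorem length_le_of_nodup {q : List (Fin n × Fin n)} (h : q.Nodup) : q.length ≤ n * n := by
  simpa using h.length_le_card

/-- The data of the main loop: `q` lists the collected pairs, and register 29 their number. -/
structure Ready (D : Digraph (Fin n)) (σ : Store) (q : List (Fin n × Fin n)) : Prop where
  env : Env n σ
  adj : IsMatrix n σ.mem 1 D.Adj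
  linked : IsMatrix n σ.mem 3 (Linked D)
  queue : IsQueue n σ.mem q
  tail : σ.reg 29 = q.length

theorem Ready.of_eq {σ τ : Store} {q : List (Fin n × Fin n)} (h : Ready D σ q)
    (hm : τ.mem = σ.mem) (hE : Env n τ) (h29 : τ.reg 29 = σ.reg 29) : Ready D τ q :=
  ⟨hE, hm ▸ h.adj, hm ▸ h.linked, hm ▸ h.queue, h29.trans h.tail⟩

theorem Ready.frame {σ τ : Store} {q : List (Fin n × Fin n)} (h : Ready D σ q)
    (hm : τ.mem = σ.mem) {l : List ℕ} (hf : ∀ r, r ∉ l → τ.reg r = σ.reg r)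
    (hl : (∀ r ∈ l, 10 < r) ∧ 29 ∉ l) : Ready D τ q :=
  h.of_eq hm (h.env.frame hf hl.1) (hf 29 hl.2)

theorem Ready.setReg {σ : Store} {q : List (Fin n × Fin n)} (h : Ready D σ q) {r v : ℕ}
    (hr : 10 < r ∧ r ≠ 29) : Ready D (σ.setReg r v) q :=
  h.of_eq rfl (h.env.setReg hr.1) (by simp [hr.2.symm])

/-- Append the pair in registers `x, y`. -/
def push (x y : ℕ) : Stmt :=
  .seq (setCell 6 x y 3) <| .seq (setAt 8 29 x) <| .seq (setAt 9 29 y) (.add 29 29 3)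

theorem ok_push {σ : Store} {q : List (Fin n × Fin n)} {x y : ℕ} {X Y : Fin n}
    (hB : 8 * (n * n + 1) ≤ B) (h : Ready D σ q) (hx : σ.reg x = X) (hy : σ.reg y = Y)
    (hq : (X, Y) ∉ q) (hd : x ≠ 11 ∧ y ≠ 11 := by decide) :
    Ok B (push x y) σ fun t τ => t ≤ 20 ∧ Ready D τ (q ++ [(X, Y)]) := by
  have hnd : (q ++ [(X, Y)]).Nodup := by
    rw [List.nodup_append]
    exact ⟨h.queue.nodup, by simp, by rintro a ha b hb rfl; simp at hb; exact hq (hb ▸ ha)⟩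
  -- The extended list still has no repetition, so there is room for the new entry in the block.
  have hlen := length_le_of_nodup hnd
  simp only [List.length_append, List.length_singleton] at hlen
  have hl : q.length ≤ n * n := by omega
  refine .seq (ok_setCell hB (X := X) (Y := Y) h.env.r2 h.env.r6 hx hy ?_
    (hd := ⟨by decide, hd.2, by decide⟩))
  refine .seq (ok_setAt hB (k := 4) (p := q.length) (by simp [h.env.r8]) (by simp [h.tail]) hl ?_
    (hd := hd.1))
  refine .seq (ok_setAt hB (k := 5) (p := q.length) (by simp [h.env.r9]) (by simp [h.tail]) hl ?_
    (hd := hd.2))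
  apply Ok.of_wp
  have hmem : ∀ {a b c d e f v w : ℕ}, ((((((((σ.setReg 11 a).setMem b (σ.reg 3)).setReg 11 c).setMem d
      (((σ.setReg 11 a).setMem b (σ.reg 3)).reg x)).setReg 11 e).setMem f
      (((((σ.setReg 11 a).setMem b (σ.reg 3)).setReg 11 c).setMem d
      (((σ.setReg 11 a).setMem b (σ.reg 3)).reg x)).reg y)).setReg v w).mem) =
      Function.update (Function.update (Function.update σ.mem b 1) d X) f Y := by
    simp [Store.setMem_mem, h.env.r3, hx, hy, hd.1, hd.2]
  simp only [wp]
  refine ⟨by simp [h.tail, h.env.r3]; omega, by omega, ?_, ?_, ?_, ⟨hnd, ?_, ?_⟩, ?_⟩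
  · exact (((((h.env.setReg (by decide)).setMem _ _).setReg (by decide)).setMem _ _).setReg
      (by decide)).setMem _ _ |>.setReg (by decide)
  · rw [hmem]
    exact ((h.adj.update_of_ne (by decide) (index_lt _ _).le).update_of_ne (by decide) hl).update_of_ne
      (by decide) hl
  · rw [hmem]
    exact ((h.linked.update_of_ne (by decide) (index_lt _ _).le).update_of_ne (by decide)
      hl).update_of_ne (by decide) hl
  · rw [hmem]
    refine (((h.queue.matrix.update X Y).update_of_ne (by decide) hl).update_of_ne (by decide)
      hl).congr fun a b => ?_
    simp
  · rw [hmem]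
    intro i a b hi
    rcases Nat.lt_or_ge i q.length with hlt | hge
    · rw [List.getElem?_append_left hlt] at hi
      have := h.queue.entry i a b hi
      have hi' : i ≤ n * n := by omega
      rw [update_cell_of_ne hl hi' (by decide), update_cell hl hi', if_neg (by omega),
        update_cell_of_ne (index_lt _ _).le hi' (by decide), update_cell hl hi', if_neg (by omega),
        update_cell_of_ne hl hi' (by decide), update_cell_of_ne (index_lt _ _).le hi' (by decide)]
      exact this
    · rw [List.getElem?_append_right hge, List.getElem?_singleton] at hi
      split_ifs at hi with h0
      obtain rfl : i = q.length := by omega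
      obtain ⟨rfl, rfl⟩ := Prod.mk.inj (Option.some.inj hi)
      rw [update_cell_of_ne hl hl (by decide), update_cell hl hl, if_pos ⟨rfl, rfl⟩,
        update_cell hl hl, if_pos ⟨rfl, rfl⟩]
      exact ⟨rfl, rfl⟩
  · simp [h.tail, h.env.r3]

/-- Append the pair in registers `u, v` unless it is listed, provided that the pairs given by
registers `x, y, z` force each other. -/
def linkPush (x y z u v : ℕ) : Stmt :=
  .seq (linkTest x y z) <| .ite (.eq 13 5) .skip <|
    .seq (getCell 14 6 u v) <| .ite (.eq 14 5) (push u v) .skip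

theorem ok_linkPush {σ : Store} {q : List (Fin n × Fin n)} {x y z u v : ℕ} {X Y Z U V : Fin n}
    (hB : 8 * (n * n + 1) ≤ B) (h : Ready D σ q) (hx : σ.reg x = X) (hy : σ.reg y = Y)
    (hz : σ.reg z = Z) (hu : σ.reg u = U) (hv : σ.reg v = V)
    (hd : (20 ≤ x ∧ 20 ≤ y ∧ 20 ≤ z) ∧ 20 ≤ u ∧ 20 ≤ v := by decide) :
    Ok B (linkPush x y z u v) σ fun t τ => t ≤ 120 ∧ ∃ q', Ready D τ q' ∧ q <+: q' ∧
      (∀ p ∈ q', p ∈ q ∨ (p = (U, V) ∧ Link D X Y Z)) ∧ (Link D X Y Z → (U, V) ∈ q') := by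
  have hw : ∀ {i}, 20 ≤ i → i ∉ (linkTest x y z).writes := by
    intro i hi
    simp only [linkTest, getCell, Stmt.writes]
    simp
    omega
  refine .seq ((ok_linkTest hB h.env h.adj hx hy hz (hd := hd.1)).imp ?_)
  rintro t₁ τ - hf ⟨ht, hm, hl⟩
  have hτ : Ready D τ q := h.frame hm hf ⟨fun r hr => by
    simp only [linkTest, getCell, Stmt.writes] at hr
    simp at hr
    omega, hw (by decide)⟩
  have hu' : τ.reg u = U := (hf u (hw hd.2.1)).trans hu
  have hv' : τ.reg v = V := (hf v (hw hd.2.2)).trans hv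
  refine .ite (fun hb => ?_) (fun hb => ?_)
  · simp only [Test.eval, hτ.env.r5, decide_eq_true_eq, hl] at hb
    exact .skip ⟨by omega, q, hτ, List.prefix_rfl, fun p hp => Or.inl hp, fun h => absurd h hb⟩
  · simp only [Test.eval, hτ.env.r5, decide_eq_false_iff_not, hl, not_not] at hb
    refine .seq (ok_getCell hB (X := U) (Y := V) hτ.env.r2 hτ.env.r6 hu' hv' ?_
      (hd := ⟨by decide, by omega⟩))
    have hτ' : Ready D ((τ.setReg 11 (cell n 2 (U * n + V))).setReg 14
        (τ.mem (cell n 2 (U * n + V)))) q := (hτ.setReg (by decide)).setReg (by decide)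
    refine .ite (fun hb' => ?_) (fun hb' => ?_)
    · simp [Test.eval, hτ.env.r5, hτ.queue.matrix U V] at hb'
      refine (ok_push hB hτ' (X := U) (Y := V)
        (by simp [hu', show u ≠ 14 by omega, show u ≠ 11 by omega])
        (by simp [hv', show v ≠ 14 by omega, show v ≠ 11 by omega]) hb'
        (hd := ⟨by omega, by omega⟩)).imp ?_
      rintro t₂ ρ - - ⟨ht₂, hρ⟩
      exact ⟨by omega, _, hρ, List.prefix_append _ _, fun p hp => by
        simp only [List.mem_append, List.mem_singleton] at hp
        exact hp.imp_right fun e => ⟨e, hb⟩, fun _ => by simp⟩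
    · simp [Test.eval, hτ.env.r5, hτ.queue.matrix U V] at hb'
      exact .skip ⟨by omega, q, hτ', List.prefix_rfl, fun p hp => Or.inl hp, fun _ => hb'⟩

/-- All pairs directly forced by the first `h` entries of `q` are in `q`. -/
def Processed (D : Digraph (Fin n)) (q : List (Fin n × Fin n)) (h : ℕ) : Prop :=
  ∀ (i : ℕ) (x y : Fin n), i < h → q[i]? = some (x, y) →
    ∀ z, (Link D x y z → (x, z) ∈ q) ∧ (Link D y x z → (z, y) ∈ q)

theorem getElem?_of_prefix {α : Type*} {q q' : List α} (h : q <+: q') {i : ℕ} (hi : i < q.length) :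
    q'[i]? = q[i]? := by
  obtain ⟨l, rfl⟩ := h
  exact List.getElem?_append_left hi

theorem Processed.of_prefix {q q' : List (Fin n × Fin n)} {h : ℕ} (hp : Processed D q h)
    (hh : h ≤ q.length) (hq : q <+: q') : Processed D q' h := by
  intro i x y hi he z
  rw [getElem?_of_prefix hq (by omega)] at he
  exact ⟨fun hl => hq.subset ((hp i x y hi he z).1 hl), fun hl => hq.subset ((hp i x y hi he z).2 hl)⟩

theorem Processed.of_equi {q : List (Fin n × Fin n)} (hp : Processed D q q.length)
    {p p' : Fin n × Fin n} (e : Equi D p p') (h : p ∈ q) : p' ∈ q := by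
  have step : ∀ {p p' : Fin n × Fin n}, DirectlyForces D p p' → p ∈ q → p' ∈ q := by
    rintro ⟨x, y⟩ ⟨x', y'⟩ hf h
    obtain ⟨i, hi, he⟩ := List.getElem_of_mem h
    have := hp i x y hi (by rw [List.getElem?_eq_getElem hi, he])
    rcases directlyForces_iff.1 hf with ⟨hf, _⟩ | ⟨hf, hl⟩ | ⟨hf, hl⟩
    · exact hf ▸ h
    · obtain rfl : x = x' := hf
      exact (this y').1 hl
    · obtain rfl : y = y' := hf
      exact (this x').2 hl
  induction e with
  | single hf => exact step hf h
  | tail _ hf ih => exact step hf ih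

/-- Append all pairs directly forced by the entry of the queue at position `reg 26`. -/
def processEntry : Stmt :=
  .seq (getAt 20 8 26) <| .seq (getAt 21 9 26) <|
  .seq (forLoop 22 2 (.seq (linkPush 20 21 22 20 22) (linkPush 21 20 22 22 21))) (.add 26 26 3)

/-- The cost of one pass through an inner loop. -/
def unitCost (n : ℕ) : ℕ := 1000 * (n + 1)

/-- A pair directly forces only pairs that share an entry with it in the same place, so one loop
over the vertices, with two link tests each, finds them all. -/
theorem ok_processEntry {σ : Store} {q : List (Fin n × Fin n)} {h : ℕ} {X Y : Fin n}
    (hB : 8 * (n * n + 1) ≤ B) (hσ : Ready D σ q) (h26 : σ.reg 26 = h)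
    (hq : q[h]? = some (X, Y)) (hp : Processed D q h) :
    Ok B processEntry σ fun t τ => t + 1 ≤ unitCost n ∧ ∃ q', Ready D τ q' ∧ q <+: q' ∧
      τ.reg 26 = h + 1 ∧ Processed D q' (h + 1) ∧
      ∀ p ∈ q', p ∈ q ∨ DirectlyForces D (X, Y) p := by
  have hh : h < q.length := by
    by_contra hge
    rw [List.getElem?_eq_none (by omega)] at hq
    cases hq
  have hlen := length_le_of_nodup hσ.queue.nodup
  obtain ⟨e₁, e₂⟩ := hσ.queue.entry h X Y hq
  refine .seq (ok_getAt hB hσ.env.r8 h26 (by omega) ?_)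
  refine .seq (ok_getAt hB (k := 5) (p := h) (by simp [hσ.env.r9]) (by simp [h26]) (by omega) ?_)
  simp only [Store.setReg_mem, e₁, e₂]
  have hσ' : Ready D ((((σ.setReg 11 (cell n 4 h)).setReg 20 X).setReg 11 (cell n 5 h)).setReg 21 Y)
    q := (((hσ.setReg (by decide)).setReg (by decide)).setReg (by decide)).setReg (by decide)
  refine .seq (Ok.forLoop n 250 (fun j τ => ∃ q', Ready D τ q' ∧ q <+: q' ∧
    (∀ p ∈ q', p ∈ q ∨ DirectlyForces D (X, Y) p) ∧
    ∀ z : Fin n, z < j → (Link D X Y z → (X, z) ∈ q') ∧ (Link D Y X z → (z, Y) ∈ q'))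
    (by decide) hσ'.env.r3 hσ'.env.r2
    ⟨q, hσ'.setReg (by decide), List.prefix_rfl, fun p hp => Or.inl hp, by simp⟩ ?_ ?_)
  · rintro j hj τ - ⟨q₁, hτ, hpre, hsub, hdone⟩ h22 hf
    have h20 : τ.reg 20 = X := (hf 20 (by decide)).trans (by simp)
    have h21 : τ.reg 21 = Y := (hf 21 (by decide)).trans (by simp)
    refine .seq ((ok_linkPush hB hτ (Z := ⟨j, hj⟩) (V := ⟨j, hj⟩) h20 h21 h22 h20 h22).imp ?_)
    rintro t₁ τ₁ - hf₁ ⟨ht₁, q₂, hτ₁, hpre₁, hsub₁, hin₁⟩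
    have h20 : τ₁.reg 20 = X := (hf₁ 20 (by decide)).trans h20
    have h21 : τ₁.reg 21 = Y := (hf₁ 21 (by decide)).trans h21
    have h22 : τ₁.reg 22 = j := (hf₁ 22 (by decide)).trans h22
    refine (ok_linkPush hB hτ₁ (Z := ⟨j, hj⟩) (U := ⟨j, hj⟩) h21 h20 h22 h22 h21).imp ?_
    rintro t₂ τ₂ - hf₂ ⟨ht₂, q₃, hτ₂, hpre₂, hsub₂, hin₂⟩
    refine ⟨by omega, q₃, hτ₂.setReg (by decide), hpre.trans (hpre₁.trans hpre₂), ?_, ?_⟩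
    · intro p hp
      rcases hsub₂ p hp with hp | ⟨rfl, hl⟩
      · rcases hsub₁ p hp with hp | ⟨rfl, hl⟩
        · exact hsub p hp
        · exact Or.inr hl.left
      · exact Or.inr hl.right
    · intro z hz
      rcases Nat.lt_succ_iff_lt_or_eq.1 hz with hz | hz
      · exact ⟨fun hl => hpre₂.subset (hpre₁.subset ((hdone z hz).1 hl)),
          fun hl => hpre₂.subset (hpre₁.subset ((hdone z hz).2 hl))⟩
      · obtain rfl : z = ⟨j, hj⟩ := Fin.ext hz
        exact ⟨fun hl => hpre₂.subset (hin₁ hl), hin₂⟩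
  · rintro t τ ⟨q', hτ, hpre, hsub, hdone⟩ - hf ht
    have h26' : τ.reg 26 = h := (hf 26 (by decide)).trans (by simp [h26])
    apply Ok.of_wp
    refine ⟨by rw [h26', hτ.env.r3]; omega, by unfold unitCost; omega, q', hτ.setReg (by decide),
      hpre, by simp [h26', hτ.env.r3], ?_, hsub⟩
    intro i x y hi he z
    rcases Nat.lt_succ_iff_lt_or_eq.1 hi with hi | rfl
    · exact hp.of_prefix hh.le hpre i x y hi he z
    · rw [getElem?_of_prefix hpre hh, hq] at he
      obtain ⟨rfl, rfl⟩ := Prod.mk.inj (Option.some.inj he)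
      exact hdone z z.2

/-- Close the queue under direct forcing. -/
def closeQueue : Stmt := .loop (.lt 26 29) processEntry

/-- The potential is the position of the head. It is bounded by the length of the queue and
continues where the previous class ended, so the closures of all classes together cost `n²` passes
at most. -/
theorem ok_closeQueue {σ : Store} {q₀ : List (Fin n × Fin n)} {s : Fin n × Fin n}
    (hB : 8 * (n * n + 1) ≤ B) (hσ : Ready D σ (q₀ ++ [s])) (h26 : σ.reg 26 = q₀.length)
    (hp : Processed D q₀ q₀.length) (hs : s ∈ pairs D) :
    Ok B closeQueue σ fun t τ => ∃ q, Ready D τ q ∧ q₀ ++ [s] <+: q ∧ τ.reg 26 = q.length ∧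
      Processed D q q.length ∧ (∀ p, p ∈ q ↔ p ∈ q₀ ∨ Equi D s p) ∧
      unitCost n * q₀.length + t ≤ unitCost n * q.length + 1 := by
  refine Ok.loop (fun τ => ∃ q, Ready D τ q ∧ q₀ ++ [s] <+: q ∧ τ.reg 26 ≤ q.length ∧
    Processed D q (τ.reg 26) ∧ ∀ p ∈ q, p ∈ q₀ ∨ Equi D s p) (fun τ => unitCost n * τ.reg 26)
    (unitCost n * (n * n)) ?_ ?_ ?_ ?_
  · rintro τ ⟨q, hτ, -, hle, -⟩
    exact Nat.mul_le_mul_left _ (hle.trans (length_le_of_nodup hτ.queue.nodup))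
  · rintro τ ⟨q, hτ, hpre, hle, hpr, hsub⟩ hb hf
    simp only [Test.eval, decide_eq_true_eq, hτ.tail] at hb
    refine (ok_processEntry hB hτ rfl (X := q[τ.reg 26].1) (Y := q[τ.reg 26].2)
      (List.getElem?_eq_getElem hb) hpr).imp ?_
    rintro t τ' - - ⟨ht, q', hτ', hpre', h26', hpr', hsub'⟩
    refine ⟨⟨q', hτ', hpre.trans hpre', ?_, h26' ▸ hpr', fun p hpq => ?_⟩, ?_⟩
    · rw [h26']
      exact le_trans hb hpre'.length_le
    · rcases hsub' p hpq with hpq | hf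
      · exact hsub p hpq
      · rcases hsub _ (List.getElem_mem hb) with h | h
        -- The earlier part `q₀` is closed under forcing, so its entries contribute nothing new.
        · exact Or.inl (hp.of_equi (.single hf) h)
        · exact Or.inr (h.tail hf)
    · rw [h26', Nat.mul_add]
      omega
  · refine ⟨_, hσ, List.prefix_rfl, by simp [h26], ?_, ?_⟩
    · rw [h26]
      exact hp.of_prefix le_rfl (List.prefix_append _ _)
    · intro p hp
      simp only [List.mem_append, List.mem_singleton] at hp
      rcases hp with hp | rfl
      · exact Or.inl hp
      · exact Or.inr (.refl hs)
  · rintro t τ ⟨q, hτ, hpre, hle, hpr, hsub⟩ hb - ht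
    simp only [Test.eval, decide_eq_false_iff_not, hτ.tail, not_lt] at hb
    have e : τ.reg 26 = q.length := by omega
    rw [e] at hpr ht
    rw [h26] at ht
    refine ⟨q, hτ, hpre, e, hpr, fun p => ⟨hsub p, ?_⟩, ht⟩
    rintro (h | h)
    · exact hpre.subset (by simp [h])
    · exact hpr.of_equi h (hpre.subset (by simp))

end Queue

end ComparabilityDigraph

namespace ComparabilityDigraph

open RAM

/-! ### Searching for a pair of the next class. -/

section Search

variable {n B : ℕ} {D : Digraph (Fin n)}

/-- The pair `(x, y)` lies in a remaining class, when the pairs in `q` have been collected. -/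
def Eligible (D : Digraph (Fin n)) (q : List (Fin n × Fin n)) (x y : Fin n) : Prop :=
  Linked D x y ∧ (x, y) ∉ q ∧ (y, x) ∉ q

/-- Eligibility can only be lost while the queue grows; this is why the search pointers never have
to move back. -/
theorem Eligible.anti {q q' : List (Fin n × Fin n)} {x y : Fin n} (h : Eligible D q' x y)
    (hq : q ⊆ q') : Eligible D q x y :=
  ⟨h.1, fun h' => h.2.1 (hq h'), fun h' => h.2.2 (hq h')⟩

/-- If the pair in registers `u, v` is eligible, then note it in registers 31, 32 and set the
flag in register 30. -/
def noteIfEligible (u v : ℕ) : Stmt :=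
  .seq (getCell 14 7 u v) <| .seq (getCell 15 6 u v) <| .seq (getCell 16 6 v u) <|
  .seq (.add 15 15 16) <| .seq (.sub 14 14 15) <| .ite (.eq 14 5) .skip <|
  .seq (.const 30 1) <| .seq (.move 31 u) (.move 32 v)

/-- Either the flag in register 30 is 0, or it is 1 and registers 31, 32 hold a pair with `P`. -/
def Noted (P : Fin n → Fin n → Prop) (σ : Store) : Prop :=
  σ.reg 30 = 0 ∨ σ.reg 30 = 1 ∧ ∃ x y : Fin n, σ.reg 31 = x ∧ σ.reg 32 = y ∧ P x y

theorem Noted.of_eq {P : Fin n → Fin n → Prop} {σ τ : Store} (h : Noted P σ)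
    (h30 : τ.reg 30 = σ.reg 30) (h31 : τ.reg 31 = σ.reg 31) (h32 : τ.reg 32 = σ.reg 32) :
    Noted P τ := by
  unfold Noted
  rw [h30, h31, h32]
  exact h

theorem ok_noteIfEligible {σ : Store} {q : List (Fin n × Fin n)} {u v : ℕ} {U V : Fin n}
    {P : Fin n → Fin n → Prop}
    (hB : 8 * (n * n + 1) ≤ B) (h : Ready D σ q) (hu : σ.reg u = U) (hv : σ.reg v = V)
    (hN : Noted P σ) (hP : Eligible D q U V → P U V)
    (hd : (20 ≤ u ∧ u < 30) ∧ 20 ≤ v ∧ v < 30 := by decide) :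
    Ok B (noteIfEligible u v) σ fun t τ => t ≤ 40 ∧ τ.mem = σ.mem ∧ Noted P τ ∧
      (τ.reg 30 = 0 → σ.reg 30 = 0 ∧ ¬ Eligible D q U V) := by
  have nu : ∀ i < 20, u ≠ i := fun i hi => by omega
  have nv : ∀ i < 20, v ≠ i := fun i hi => by omega
  have nu' : ∀ i, 30 ≤ i → u ≠ i := fun i hi => by omega
  have nv' : ∀ i, 30 ≤ i → v ≠ i := fun i hi => by omega
  refine .seq (ok_getCell hB h.env.r2 h.env.r7 hu hv ?_ (hd := ⟨by decide, nv _ (by decide)⟩))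
  refine .seq (ok_getCell hB (X := U) (Y := V) (k := 2) (by simp [h.env.r2]) (by simp [h.env.r6])
    (by simp [nu, hu]) (by simp [nv, hv]) ?_ (hd := ⟨by decide, nv _ (by decide)⟩))
  refine .seq (ok_getCell hB (X := V) (Y := U) (k := 2) (by simp [h.env.r2]) (by simp [h.env.r6])
    (by simp [nv, hv]) (by simp [nu, hu]) ?_ (hd := ⟨by decide, nu _ (by decide)⟩))
  apply Ok.of_wp
  have e₁ := h.linked U V
  have e₂ := h.queue.matrix U V
  have e₃ := h.queue.matrix V U
  -- Truncated subtraction leaves 1 precisely for linked pairs that are collected in neither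
  -- direction.
  have hval : bit (Linked D U V) - (bit ((U, V) ∈ q) + bit ((V, U) ∈ q)) = 0 ↔
      ¬ Eligible D q U V := by
    unfold Eligible bit
    split_ifs <;> simp_all
  have hle := bit_le ((U, V) ∈ q)
  have hle' := bit_le ((V, U) ∈ q)
  simp only [wp, Store.setReg_reg, Store.setReg_mem, e₁, e₂, e₃]
  simp [Test.eval, h.env.r5, hval, Noted, hu, hv, nu, nv, nu', nv']
  refine ⟨by omega, fun hne => ⟨by simpa [Noted] using hN, fun h0 => ⟨h0, hne⟩⟩,
    fun he => ⟨by omega, ⟨U, rfl, V, rfl, hP he⟩⟩⟩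

/-- The predicate `bad` names what the body looks for: a flag that is still 0 at the end certifies
that no vertex has it. -/
theorem ok_loopNote {σ : Store} {q : List (Fin n × Fin n)} {P : Fin n → Fin n → Prop} {s : Stmt}
    {c : ℕ} {bad : Fin n → Prop} (h : Ready D σ q) (hN : Noted P σ)
    (hw : (22 ∉ s.writes ∧ 2 ∉ s.writes ∧ 3 ∉ s.writes) ∧ (∀ r ∈ s.writes, 10 < r) ∧ 29 ∉ s.writes)
    (hs : ∀ z : Fin n, ∀ τ, Ready D τ q → Noted P τ → τ.reg 22 = z →
      (∀ r, r ∉ 22 :: s.writes → τ.reg r = σ.reg r) →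
      Ok B s τ fun t τ' => t ≤ c ∧ τ'.mem = τ.mem ∧ Noted P τ' ∧
        (τ'.reg 30 = 0 → τ.reg 30 = 0 ∧ ¬ bad z)) :
    Ok B (forLoop 22 2 s) σ fun t τ => t ≤ (c + 3) * n + 3 ∧ τ.mem = σ.mem ∧ Noted P τ ∧
      (τ.reg 30 = 0 → ∀ z, ¬ bad z) := by
  refine Ok.forLoop n c (fun j τ => τ.mem = σ.mem ∧ Noted P τ ∧
    (τ.reg 30 = 0 → ∀ z : Fin n, z < j → ¬ bad z))
    ⟨hw.1.1, hw.1.2.1, hw.1.2.2, by decide, by decide⟩ h.env.r3 h.env.r2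
    ⟨rfl, hN.of_eq (by simp) (by simp) (by simp), by simp⟩ ?_ ?_
  · rintro j hj τ - ⟨hm, hN, hb⟩ h22 hf
    have hτ : Ready D τ q := h.frame hm hf ⟨by
      intro r hr
      rcases List.mem_cons.1 hr with rfl | hr
      · decide
      · exact hw.2.1 r hr, by simp [hw.2.2]⟩
    refine (hs ⟨j, hj⟩ τ hτ hN h22 hf).imp ?_
    rintro t τ' - - ⟨ht, hm', hN', hb'⟩
    refine ⟨ht, by simp [hm', hm], hN'.of_eq (by simp) (by simp) (by simp), fun h30 z hz => ?_⟩
    have := hb' (by simpa using h30)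
    rcases Nat.lt_succ_iff_lt_or_eq.1 hz with hz | hz
    · exact hb this.1 z hz
    · obtain rfl : z = ⟨j, hj⟩ := Fin.ext hz
      exact this.2
  · rintro t τ ⟨hm, hN, hb⟩ - - ht
    exact ⟨ht, hm, hN, fun h30 z => hb h30 z z.2⟩

/-- The pair `(x, z)` is implied by transitivity. -/
def Implied (q : List (Fin n × Fin n)) (x z : Fin n) : Prop :=
  ∃ y, (x, y) ∈ q ∧ (y, z) ∈ q

/-- No two of the first `h` entries of `q` imply an eligible pair. -/
def Scanned (D : Digraph (Fin n)) (q : List (Fin n × Fin n)) (h : ℕ) : Prop :=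
  ∀ (i j : ℕ) (x y z : Fin n), i < h → j < h → q[i]? = some (x, y) → q[j]? = some (y, z) →
    ¬ Eligible D q x z

theorem Scanned.of_prefix {q q' : List (Fin n × Fin n)} {h : ℕ} (hs : Scanned D q h)
    (hh : h ≤ q.length) (hq : q <+: q') : Scanned D q' h := by
  intro i j x y z hi hj ei ej he
  rw [getElem?_of_prefix hq (by omega)] at ei ej
  exact hs i j x y z hi hj ei ej (he.anti hq.subset)

/-- Look for an eligible pair that is implied by the entry at position `reg 27` and another
entry. -/
def scanEntry : Stmt :=
  .seq (getAt 20 8 27) <| .seq (getAt 21 9 27) <|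
  .seq (forLoop 22 2 <|
    .seq (.seq (getCell 14 6 21 22) (.ite (.eq 14 5) .skip (noteIfEligible 20 22)))
      (.seq (getCell 14 6 22 20) (.ite (.eq 14 5) .skip (noteIfEligible 22 21)))) <|
  .ite (.eq 30 5) (.add 27 27 3) (.const 33 0)

theorem ok_noteIfMember {σ : Store} {q : List (Fin n × Fin n)} {a b u v : ℕ} {X Y U V : Fin n}
    {P : Fin n → Fin n → Prop}
    (hB : 8 * (n * n + 1) ≤ B) (h : Ready D σ q) (ha : σ.reg a = X) (hb : σ.reg b = Y)
    (hu : σ.reg u = U) (hv : σ.reg v = V)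
    (hN : Noted P σ) (hP : (X, Y) ∈ q → Eligible D q U V → P U V)
    (hd : ((20 ≤ u ∧ u < 30) ∧ 20 ≤ v ∧ v < 30) ∧ b ≠ 11 := by decide) :
    Ok B (.seq (getCell 14 6 a b) (.ite (.eq 14 5) .skip (noteIfEligible u v))) σ
      fun t τ => t ≤ 50 ∧ τ.mem = σ.mem ∧ Noted P τ ∧
      (τ.reg 30 = 0 → σ.reg 30 = 0 ∧ ¬ ((X, Y) ∈ q ∧ Eligible D q U V)) := by
  refine .seq (ok_getCell hB h.env.r2 h.env.r6 ha hb ?_ (hd := ⟨by decide, hd.2⟩))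
  have hσ' : Ready D ((σ.setReg 11 (cell n 2 (X * n + Y))).setReg 14
      (σ.mem (cell n 2 (X * n + Y)))) q := (h.setReg (by decide)).setReg (by decide)
  have hN' : Noted P ((σ.setReg 11 (cell n 2 (X * n + Y))).setReg 14
      (σ.mem (cell n 2 (X * n + Y)))) := hN.of_eq (by simp) (by simp) (by simp)
  refine .ite (fun hb' => ?_) (fun hb' => ?_)
  · simp [Test.eval, h.env.r5, h.queue.matrix X Y] at hb'
    exact .skip ⟨by omega, rfl, hN', fun h30 => ⟨by simpa using h30, fun h => hb' h.1⟩⟩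
  · simp [Test.eval, h.env.r5, h.queue.matrix X Y] at hb'
    refine (ok_noteIfEligible hB hσ' (U := U) (V := V)
      (by simp [hu, show u ≠ 14 by omega, show u ≠ 11 by omega])
      (by simp [hv, show v ≠ 14 by omega, show v ≠ 11 by omega]) hN' (hP hb') (hd := hd.1)).imp ?_
    rintro t τ - - ⟨ht, hm, hNτ, he⟩
    exact ⟨by omega, hm, hNτ, fun h30 => ⟨by simpa using (he h30).1, fun h => (he h30).2 h.2⟩⟩

/-- The entry is tried both as the first and as the second factor, so two entries have been combined
once the later one is scanned. After a success the pointer stays, because the entry may imply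
further eligible pairs; limit register 33 becomes 0 to leave the search loop. -/
theorem ok_scanEntry {σ : Store} {q : List (Fin n × Fin n)} {h : ℕ} {X Y : Fin n}
    (hB : 8 * (n * n + 1) ≤ B) (hσ : Ready D σ q) (h27 : σ.reg 27 = h)
    (hq : q[h]? = some (X, Y)) (hs : Scanned D q h) (h30 : σ.reg 30 = 0) :
    Ok B scanEntry σ fun t τ => t + 1 ≤ unitCost n ∧ τ.mem = σ.mem ∧
      ((τ.reg 27 = h + 1 ∧ τ.reg 33 = σ.reg 33 ∧ τ.reg 30 = 0 ∧ Scanned D q (h + 1)) ∨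
       (τ.reg 27 = h ∧ τ.reg 33 = 0 ∧ τ.reg 30 = 1 ∧
         Noted (fun x z => Eligible D q x z ∧ Implied q x z) τ)) := by
  have hmem : (X, Y) ∈ q := List.mem_of_getElem? hq
  have hh : h < q.length := by
    by_contra hge
    rw [List.getElem?_eq_none (by omega)] at hq
    cases hq
  have hlen := length_le_of_nodup hσ.queue.nodup
  obtain ⟨e₁, e₂⟩ := hσ.queue.entry h X Y hq
  refine .seq (ok_getAt hB hσ.env.r8 h27 (by omega) ?_)
  refine .seq (ok_getAt hB (k := 5) (p := h) (by simp [hσ.env.r9]) (by simp [h27]) (by omega) ?_)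
  simp only [Store.setReg_mem, e₁, e₂]
  have hσ' : Ready D ((((σ.setReg 11 (cell n 4 h)).setReg 20 X).setReg 11 (cell n 5 h)).setReg 21 Y)
    q := (((hσ.setReg (by decide)).setReg (by decide)).setReg (by decide)).setReg (by decide)
  refine .seq ((ok_loopNote (c := 110) (P := fun x z => Eligible D q x z ∧ Implied q x z)
    (bad := fun z => ((Y, z) ∈ q ∧ Eligible D q X z) ∨ ((z, X) ∈ q ∧ Eligible D q z Y))
    hσ' (Or.inl (by simp [h30])) (by decide) ?_).imp ?_)
  · rintro z τ hτ hN h22 hf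
    have h20 : τ.reg 20 = X := (hf 20 (by decide)).trans (by simp)
    have h21 : τ.reg 21 = Y := (hf 21 (by decide)).trans (by simp)
    refine .seq ((ok_noteIfMember hB hτ h21 h22 h20 h22 hN
      fun hm he => ⟨he, Y, hmem, hm⟩).imp ?_)
    rintro t₁ τ₁ - hf₁ ⟨ht₁, hm₁, hN₁, hb₁⟩
    have hτ₁ : Ready D τ₁ q := hτ.frame hm₁ hf₁ (by decide)
    have h20 : τ₁.reg 20 = X := (hf₁ 20 (by decide)).trans h20
    have h21 : τ₁.reg 21 = Y := (hf₁ 21 (by decide)).trans h21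
    have h22 : τ₁.reg 22 = z := (hf₁ 22 (by decide)).trans h22
    refine (ok_noteIfMember hB hτ₁ h22 h20 h22 h21 hN₁ fun hm he => ⟨he, X, hm, hmem⟩).imp ?_
    rintro t₂ τ₂ - - ⟨ht₂, hm₂, hN₂, hb₂⟩
    refine ⟨by omega, hm₂.trans hm₁, hN₂, fun h0 => ?_⟩
    have b₂ := hb₂ h0
    have b₁ := hb₁ b₂.1
    exact ⟨b₁.1, fun h => h.elim b₁.2 b₂.2⟩
  · rintro t τ - hf ⟨ht, hm, hN, hb⟩
    have hτ : Ready D τ q := hσ'.frame hm hf (by decide)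
    have h27' : τ.reg 27 = h := (hf 27 (by decide)).trans (by simp [h27])
    have h33' : τ.reg 33 = σ.reg 33 := (hf 33 (by decide)).trans (by simp)
    refine .ite (fun hb' => ?_) (fun hb' => ?_)
    · simp only [Test.eval, hτ.env.r5, decide_eq_true_eq] at hb'
      refine Ok.of_wp ⟨by rw [h27', hτ.env.r3]; omega, by unfold unitCost; omega, by simp [hm], ?_⟩
      refine Or.inl ⟨by simp [h27', hτ.env.r3], by simp [h33'], by simp [hb'], ?_⟩
      have hb := hb hb'
      intro i j x y z hi hj ei ej he
      rcases Nat.lt_succ_iff_lt_or_eq.1 hi with hi | rfl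
      · rcases Nat.lt_succ_iff_lt_or_eq.1 hj with hj | rfl
        · exact hs i j x y z hi hj ei ej he
        · rw [hq] at ej
          obtain ⟨rfl, rfl⟩ := Prod.mk.inj (Option.some.inj ej)
          exact hb x (Or.inr ⟨List.mem_of_getElem? ei, he⟩)
      · rw [hq] at ei
        obtain ⟨rfl, rfl⟩ := Prod.mk.inj (Option.some.inj ei)
        exact hb z (Or.inl ⟨List.mem_of_getElem? ej, he⟩)
    · simp only [Test.eval, hτ.env.r5, decide_eq_false_iff_not] at hb'
      refine Ok.of_wp ⟨Nat.zero_le _, by unfold unitCost; omega, by simp [hm], Or.inr ?_⟩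
      exact ⟨by simp [h27'], by simp, by simpa using (hN.resolve_left hb').1,
        hN.of_eq (by simp) (by simp) (by simp)⟩

/-- Look for an eligible pair in row `reg 28`. -/
def scanRow : Stmt :=
  .seq (forLoop 22 2 (noteIfEligible 28 22)) <| .ite (.eq 30 5) (.add 28 28 3) (.const 33 0)

theorem ok_scanRow {σ : Store} {q : List (Fin n × Fin n)} {h : ℕ}
    (hB : 8 * (n * n + 1) ≤ B) (hσ : Ready D σ q) (h28 : σ.reg 28 = h) (hh : h < n)
    (hs : ∀ x z : Fin n, x < h → ¬ Eligible D q x z) (h30 : σ.reg 30 = 0) :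
    Ok B scanRow σ fun t τ => t + 1 ≤ unitCost n ∧ τ.mem = σ.mem ∧
      ((τ.reg 28 = h + 1 ∧ τ.reg 33 = σ.reg 33 ∧ τ.reg 30 = 0 ∧
         ∀ x z : Fin n, x < h + 1 → ¬ Eligible D q x z) ∨
       (τ.reg 28 = h ∧ τ.reg 33 = 0 ∧ τ.reg 30 = 1 ∧ Noted (Eligible D q) τ)) := by
  have hhB : h < n * n + 1 := by
    have := Nat.le_mul_self n
    omega
  refine .seq ((ok_loopNote (c := 40) (P := Eligible D q) (bad := fun z => Eligible D q ⟨h, hh⟩ z)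
    hσ (Or.inl h30) (by decide) ?_).imp ?_)
  · rintro z τ hτ hN h22 hf
    exact ok_noteIfEligible hB hτ (U := ⟨h, hh⟩) ((hf 28 (by decide)).trans h28) h22 hN id
  · rintro t τ - hf ⟨ht, hm, hN, hb⟩
    have hτ : Ready D τ q := hσ.frame hm hf (by decide)
    have h28' : τ.reg 28 = h := (hf 28 (by decide)).trans (by simp [h28])
    have h33' : τ.reg 33 = σ.reg 33 := (hf 33 (by decide)).trans (by simp)
    refine .ite (fun hb' => ?_) (fun hb' => ?_)
    · simp only [Test.eval, hτ.env.r5, decide_eq_true_eq] at hb'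
      refine Ok.of_wp ⟨by rw [h28', hτ.env.r3]; omega, by unfold unitCost; omega, by simp [hm], ?_⟩
      refine Or.inl ⟨by simp [h28', hτ.env.r3], by simp [h33'], by simp [hb'], ?_⟩
      intro x z hx
      rcases Nat.lt_succ_iff_lt_or_eq.1 hx with hx | hx
      · exact hs x z hx
      · obtain rfl : x = ⟨h, hh⟩ := Fin.ext hx
        exact hb hb' z
    · simp only [Test.eval, hτ.env.r5, decide_eq_false_iff_not] at hb'
      refine Ok.of_wp ⟨Nat.zero_le _, by unfold unitCost; omega, by simp [hm], Or.inr ?_⟩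
      exact ⟨by simp [h28'], by simp, by simpa using (hN.resolve_left hb').1,
        hN.of_eq (by simp) (by simp) (by simp)⟩

end Search

end ComparabilityDigraph

namespace ComparabilityDigraph

open RAM

/-! ### The main loop and its amortised cost. -/

section MainLoop

variable {n B : ℕ} {D : Digraph (Fin n)}

/-- Look for an eligible pair that is implied by transitivity. -/
def findImplied : Stmt := .seq (.move 33 29) (.loop (.lt 27 33) scanEntry)

/-- The flag in register 30 is part of the potential: it pays for the successful pass, which does
not advance the pointer. -/
theorem ok_findImplied {σ : Store} {q : List (Fin n × Fin n)} (hB : 8 * (n * n + 1) ≤ B)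
    (hσ : Ready D σ q) (h27 : σ.reg 27 ≤ q.length) (hs : Scanned D q (σ.reg 27))
    (h30 : σ.reg 30 = 0) :
    Ok B findImplied σ fun t τ => τ.mem = σ.mem ∧ τ.reg 27 ≤ q.length ∧ Scanned D q (τ.reg 27) ∧
      ((τ.reg 30 = 0 ∧ τ.reg 27 = q.length) ∨
        (τ.reg 30 = 1 ∧ Noted (fun x z => Eligible D q x z ∧ Implied q x z) τ)) ∧
      unitCost n * σ.reg 27 + t ≤ unitCost n * (τ.reg 27 + τ.reg 30) + 3 := by
  refine .seq (Ok.of_wp ?_)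
  refine Ok.loop (fun τ => τ.mem = σ.mem ∧ τ.reg 27 ≤ q.length ∧ Scanned D q (τ.reg 27) ∧
    ((τ.reg 30 = 0 ∧ τ.reg 33 = q.length) ∨ (τ.reg 30 = 1 ∧ τ.reg 33 = 0 ∧
      Noted (fun x z => Eligible D q x z ∧ Implied q x z) τ)))
    (fun τ => unitCost n * (τ.reg 27 + τ.reg 30)) (unitCost n * (n * n + 1)) ?_ ?_ ?_ ?_
  · rintro τ ⟨-, hle, -, h⟩
    have := length_le_of_nodup hσ.queue.nodup
    exact Nat.mul_le_mul_left _ (by omega)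
  · rintro τ ⟨hm, hle, hsc, h⟩ hb hf
    simp only [Test.eval, decide_eq_true_eq] at hb
    have h0 : τ.reg 30 = 0 ∧ τ.reg 33 = q.length := by
      rcases h with h | h
      · exact h
      · omega
    have hτ : Ready D τ q := (hσ.setReg (r := 33) (by decide)).frame hm hf (by decide)
    have hlt : τ.reg 27 < q.length := by omega
    refine (ok_scanEntry hB hτ rfl (X := q[τ.reg 27].1) (Y := q[τ.reg 27].2)
      (List.getElem?_eq_getElem hlt) hsc h0.1).imp ?_
    rintro t τ' - - ⟨ht, hm', ⟨e₁, e₂, e₃, e₄⟩ | ⟨e₁, e₂, e₃, e₄⟩⟩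
    · refine ⟨⟨hm'.trans hm, by omega, e₁ ▸ e₄, Or.inl ⟨e₃, e₂.trans h0.2⟩⟩, ?_⟩
      rw [e₁, e₃, h0.1, add_zero, add_zero, Nat.mul_add]
      omega
    · refine ⟨⟨hm'.trans hm, by omega, e₁ ▸ hsc, Or.inr ⟨e₃, e₂, e₄⟩⟩, ?_⟩
      rw [e₁, e₃, h0.1, add_zero, Nat.mul_add]
      omega
  · exact ⟨rfl, by simpa using h27, by simpa using hs, Or.inl ⟨by simpa using h30,
      by simp [hσ.tail]⟩⟩
  · rintro t τ ⟨hm, hle, hsc, h⟩ hb - ht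
    simp only [Test.eval, decide_eq_false_iff_not] at hb
    refine ⟨hm, hle, hsc, ?_, ?_⟩
    · rcases h with h | h
      · exact Or.inl ⟨h.1, by omega⟩
      · exact Or.inr ⟨h.1, h.2.2⟩
    · simp [h30] at ht
      omega

/-- Look for any eligible pair. -/
def findAny : Stmt := .seq (.move 33 2) (.loop (.lt 28 33) scanRow)

theorem ok_findAny {σ : Store} {q : List (Fin n × Fin n)} (hB : 8 * (n * n + 1) ≤ B)
    (hσ : Ready D σ q) (h28 : σ.reg 28 ≤ n)
    (hs : ∀ x z : Fin n, x < σ.reg 28 → ¬ Eligible D q x z) (h30 : σ.reg 30 = 0) :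
    Ok B findAny σ fun t τ => τ.mem = σ.mem ∧ τ.reg 28 ≤ n ∧
      (∀ x z : Fin n, x < τ.reg 28 → ¬ Eligible D q x z) ∧
      ((τ.reg 30 = 0 ∧ τ.reg 28 = n) ∨ (τ.reg 30 = 1 ∧ Noted (Eligible D q) τ)) ∧
      unitCost n * σ.reg 28 + t ≤ unitCost n * (τ.reg 28 + τ.reg 30) + 3 := by
  refine .seq (Ok.of_wp ?_)
  refine Ok.loop (fun τ => τ.mem = σ.mem ∧ τ.reg 28 ≤ n ∧
    (∀ x z : Fin n, x < τ.reg 28 → ¬ Eligible D q x z) ∧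
    ((τ.reg 30 = 0 ∧ τ.reg 33 = n) ∨ (τ.reg 30 = 1 ∧ τ.reg 33 = 0 ∧ Noted (Eligible D q) τ)))
    (fun τ => unitCost n * (τ.reg 28 + τ.reg 30)) (unitCost n * (n + 1)) ?_ ?_ ?_ ?_
  · rintro τ ⟨-, hle, -, h⟩
    exact Nat.mul_le_mul_left _ (by omega)
  · rintro τ ⟨hm, hle, hsc, h⟩ hb hf
    simp only [Test.eval, decide_eq_true_eq] at hb
    have h0 : τ.reg 30 = 0 ∧ τ.reg 33 = n := by
      rcases h with h | h
      · exact h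
      · omega
    have hτ : Ready D τ q := (hσ.setReg (r := 33) (by decide)).frame hm hf (by decide)
    refine (ok_scanRow hB hτ rfl (by omega) hsc h0.1).imp ?_
    rintro t τ' - - ⟨ht, hm', ⟨e₁, e₂, e₃, e₄⟩ | ⟨e₁, e₂, e₃, e₄⟩⟩
    · refine ⟨⟨hm'.trans hm, by omega, e₁ ▸ e₄, Or.inl ⟨e₃, e₂.trans h0.2⟩⟩, ?_⟩
      rw [e₁, e₃, h0.1, add_zero, add_zero, Nat.mul_add]
      omega
    · refine ⟨⟨hm'.trans hm, by omega, e₁ ▸ hsc, Or.inr ⟨e₃, e₂, e₄⟩⟩, ?_⟩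
      rw [e₁, e₃, h0.1, add_zero, Nat.mul_add]
      omega
  · exact ⟨rfl, by simpa using h28, by simpa using hs, Or.inl ⟨by simpa using h30,
      by simp [hσ.env.r2]⟩⟩
  · rintro t τ ⟨hm, hle, hsc, h⟩ hb - ht
    simp only [Test.eval, decide_eq_false_iff_not] at hb
    refine ⟨hm, hle, hsc, ?_, ?_⟩
    · rcases h with h | h
      · exact Or.inl ⟨h.1, by omega⟩
      · exact Or.inr ⟨h.1, h.2.2⟩
    · simp [h30] at ht
      omega

/-- The positions reached by the two searches, and what they have excluded. -/
structure SearchState (D : Digraph (Fin n)) (q : List (Fin n × Fin n)) (σ : Store) : Prop where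
  le₁ : σ.reg 27 ≤ q.length
  le₂ : σ.reg 28 ≤ n
  scanned : Scanned D q (σ.reg 27)
  rows : ∀ x z : Fin n, x < σ.reg 28 → ¬ Eligible D q x z

/-- A completed scan is what entitles the algorithm to an arbitrary choice. -/
theorem Scanned.stable {q : List (Fin n × Fin n)} (h : Scanned D q q.length) :
    Stable D (fun x y => (x, y) ∈ q) := by
  intro x y z hxy hyz hl
  obtain ⟨i, hi, ei⟩ := List.getElem_of_mem hxy
  obtain ⟨j, hj, ej⟩ := List.getElem_of_mem hyz
  by_contra hne
  exact h i j x y z hi hj (by rw [List.getElem?_eq_getElem hi, ei])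
    (by rw [List.getElem?_eq_getElem hj, ej]) ⟨hl, fun h => hne (Or.inl h), fun h => hne (Or.inr h)⟩

/-- The pair `(x, y)` may be used as the next seed. -/
def IsSeed (D : Digraph (Fin n)) (q : List (Fin n × Fin n)) (x y : Fin n) : Prop :=
  Eligible D q x y ∧ (Implied q x y ∨ Stable D (fun x y => (x, y) ∈ q))

/-- Choose the seed of the next implication class. -/
def search : Stmt :=
  .seq (.const 30 0) <| .seq findImplied <| .ite (.eq 30 5) findAny .skip

/-- The second search runs only if the first fails, so at most one of them succeeds; this accounts
for the single extra unit beyond the advance of the pointers. -/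
theorem ok_search {σ : Store} {q : List (Fin n × Fin n)} (hB : 8 * (n * n + 1) ≤ B)
    (hσ : Ready D σ q) (h : SearchState D q σ) :
    Ok B search σ fun t τ => τ.mem = σ.mem ∧ SearchState D q τ ∧
      ((τ.reg 30 = 0 ∧ ∀ x y, ¬ Eligible D q x y) ∨ (τ.reg 30 = 1 ∧ Noted (IsSeed D q) τ)) ∧
      unitCost n * (σ.reg 27 + σ.reg 28) + t ≤ unitCost n * (τ.reg 27 + τ.reg 28 + 1) + 20 := by
  refine .seq (Ok.of_wp ⟨Nat.zero_le _, ?_⟩)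
  have hσ' : Ready D (σ.setReg 30 0) q := hσ.setReg (by decide)
  refine .seq ((ok_findImplied hB hσ' (by simpa using h.le₁) (by simpa using h.scanned)
    (by simp)).imp ?_)
  rintro t τ - hf ⟨hm, hle, hsc, hor, ht⟩
  have hτ : Ready D τ q := hσ'.frame hm hf (by decide)
  have h28 : τ.reg 28 = σ.reg 28 := (hf 28 (by decide)).trans (by simp)
  simp only [Store.setReg_reg, if_neg (show ¬ (27 : ℕ) = 30 by decide)] at ht
  refine .ite (fun hb => ?_) (fun hb => ?_)
  · simp only [Test.eval, hτ.env.r5, decide_eq_true_eq] at hb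
    have e27 : τ.reg 27 = q.length := by omega
    refine (ok_findAny hB hτ (h28 ▸ h.le₂) (h28 ▸ h.rows) hb).imp ?_
    rintro t' τ' - hf' ⟨hm', hle', hr', hor', ht'⟩
    have h27' : τ'.reg 27 = τ.reg 27 := hf' 27 (by decide)
    refine ⟨hm'.trans hm, ⟨h27' ▸ hle, hle', h27' ▸ hsc, hr'⟩, ?_, ?_⟩
    · rcases hor' with ⟨h0, hn⟩ | ⟨h1, hN⟩
      · exact Or.inl ⟨h0, fun x y => hr' x y (hn ▸ x.2)⟩
      · refine Or.inr ⟨h1, Or.inr ⟨h1, ?_⟩⟩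
        obtain ⟨x, y, hx, hy, he⟩ := (hN.resolve_left (by omega)).2
        exact ⟨x, y, hx, hy, he, Or.inr (e27 ▸ hsc).stable⟩
    · have h30' : τ'.reg 30 ≤ 1 := by omega
      have := Nat.mul_le_mul_left (unitCost n) h30'
      rw [hb] at ht
      rw [h28] at ht'
      simp only [Nat.mul_add, h27'] at *
      omega
  · simp only [Test.eval, hτ.env.r5, decide_eq_false_iff_not] at hb
    have h1 : τ.reg 30 = 1 ∧ Noted (fun x z => Eligible D q x z ∧ Implied q x z) τ := by
      rcases hor with h | h
      · exact absurd h.1 hb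
      · exact h
    refine .skip ⟨hm, ⟨hle, h28 ▸ h.le₂, hsc, h28 ▸ h.rows⟩, Or.inr ⟨h1.1, Or.inr ⟨h1.1, ?_⟩⟩, ?_⟩
    · obtain ⟨x, y, hx, hy, he⟩ := (h1.2.resolve_left hb).2
      exact ⟨x, y, hx, hy, he.1, Or.inl he.2⟩
    · rw [h1.1] at ht
      rw [h28]
      simp only [Nat.mul_add] at *
      omega

/-- One pass through the main loop: collect the class of the seed, and choose the next seed. -/
def collectClass : Stmt := .seq (push 31 32) (.seq closeQueue search)

/-- The set of pairs held in block 2. -/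
def heldPairs (n : ℕ) (σ : Store) (x y : Fin n) : Prop := σ.mem (cell n 2 (x * n + y)) ≠ 0

theorem Ready.heldPairs_iff {σ : Store} {q : List (Fin n × Fin n)} (h : Ready D σ q) (x y : Fin n) :
    heldPairs n σ x y ↔ (x, y) ∈ q := by
  simp [heldPairs, h.queue.matrix x y]

theorem Ready.heldPairs_eq {σ : Store} {q : List (Fin n × Fin n)} (h : Ready D σ q) :
    heldPairs n σ = fun x y => (x, y) ∈ q := by
  ext x y
  exact h.heldPairs_iff x y

/-- The invariant of the main loop. -/
structure MainInvariant (D : Digraph (Fin n)) (q : List (Fin n × Fin n)) (σ : Store) : Prop where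
  ready : Ready D σ q
  head : σ.reg 26 = q.length
  processed : Processed D q q.length
  search : SearchState D q σ
  seed : (σ.reg 30 = 0 ∧ ∀ x y, ¬ Eligible D q x y) ∨ (σ.reg 30 = 1 ∧ Noted (IsSeed D q) σ)

/-- The amount of work done so far. -/
def work (n : ℕ) (σ : Store) : ℕ :=
  unitCost n * (σ.reg 26 + σ.reg 27 + σ.reg 28 + 2 * σ.reg 29)

/-- In `work`, registers 26, 27 and 28 pay for closing the queue and for the two searches. Each pass
lengthens the queue, whose length is in register 29, and the two units this earns cover the extra
unit of the search and all constant overheads. -/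
theorem ok_collectClass {σ : Store} {q : List (Fin n × Fin n)} (hB : 8 * (n * n + 1) ≤ B)
    (hσ : MainInvariant D q σ) (h30 : σ.reg 30 = 1) :
    Ok B collectClass σ fun t τ => (∃ q', MainInvariant D q' τ) ∧
      CollectStep D (heldPairs n σ) (heldPairs n τ) ∧ work n σ + t + 1 ≤ work n τ := by
  obtain ⟨x, y, hx, hy, hel, hseed⟩ : ∃ x y : Fin n, σ.reg 31 = x ∧ σ.reg 32 = y ∧
      IsSeed D q x y := by
    rcases hσ.seed with h | h
    · omega
    · exact (h.2.resolve_left (by omega)).2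
  refine .seq ((ok_push hB hσ.ready hx hy hel.2.1).imp ?_)
  rintro t₁ τ₁ - hf₁ ⟨ht₁, hr₁⟩
  refine .seq ((ok_closeQueue hB hr₁ ((hf₁ 26 (by decide)).trans hσ.head) hσ.processed
    hel.1.mem_pairs).imp ?_)
  rintro t₂ τ₂ - hf₂ ⟨q', hr₂, hpre, h26, hp₂, hmem, ht₂⟩
  have hpre' : q <+: q' := (List.prefix_append _ _).trans hpre
  have hlen : q.length + 1 ≤ q'.length := by
    simpa using hpre.length_le
  have h27 : τ₂.reg 27 = σ.reg 27 := (hf₂ 27 (by decide)).trans (hf₁ 27 (by decide))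
  have h28 : τ₂.reg 28 = σ.reg 28 := (hf₂ 28 (by decide)).trans (hf₁ 28 (by decide))
  have hS : SearchState D q' τ₂ := by
    refine ⟨?_, h28 ▸ hσ.search.le₂, ?_, ?_⟩
    · have := hσ.search.le₁
      omega
    · rw [h27]
      exact hσ.search.scanned.of_prefix hσ.search.le₁ hpre'
    · rw [h28]
      exact fun a b hab he => hσ.search.rows a b hab (he.anti hpre'.subset)
  refine (ok_search hB hr₂ hS).imp ?_
  rintro t₃ τ₃ - hf₃ ⟨hm, hS₃, hor, ht₃⟩
  have hr₃ : Ready D τ₃ q' := hr₂.frame hm hf₃ (by decide)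
  have h26' : τ₃.reg 26 = q'.length := (hf₃ 26 (by decide)).trans h26
  refine ⟨⟨q', hr₃, h26', hp₂, hS₃, hor⟩, ?_, ?_⟩
  · rw [hσ.ready.heldPairs_eq, hr₃.heldPairs_eq]
    refine ⟨(x, y), hel.1, hel.2.1, hel.2.2, ?_, fun a b => hmem (a, b)⟩
    refine hseed.imp_left ?_
    rintro ⟨z, h₁, h₂⟩
    exact ⟨x, z, y, h₁, h₂, .refl hel.1.mem_pairs⟩
  · simp only [work, h26', hr₃.tail, hσ.head, hσ.ready.tail]
    rw [h27, h28] at ht₃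
    have hK : 1000 ≤ unitCost n := by
      unfold unitCost
      omega
    have := Nat.mul_le_mul_left (unitCost n) hlen
    simp only [Nat.mul_add, Nat.mul_left_comm _ 2] at *
    omega

theorem work_le {σ : Store} {q : List (Fin n × Fin n)} (h : MainInvariant D q σ) :
    work n σ ≤ unitCost n * (4 * (n * n) + n) := by
  have h₁ := length_le_of_nodup h.ready.queue.nodup
  have h₂ := h.search.le₁
  have h₃ := h.search.le₂
  refine Nat.mul_le_mul_left _ ?_
  rw [h.head, h.ready.tail]
  omega

/-- Set up the main loop. -/
def startMain : Stmt :=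
  .seq (.const 26 0) <| .seq (.const 27 0) <| .seq (.const 28 0) <| .seq (.const 29 0) search

theorem ok_startMain {σ : Store} (hB : 8 * (n * n + 1) ≤ B) (hE : Env n σ)
    (hA : IsMatrix n σ.mem 1 D.Adj) (hN : IsMatrix n σ.mem 3 (Linked D))
    (h0 : ∀ p ≤ n * n, σ.mem (cell n 2 p) = 0) :
    Ok B startMain σ fun t τ => MainInvariant D [] τ ∧ t ≤ unitCost n * (n + 1) + 30 := by
  refine .seq (Ok.of_wp ⟨Nat.zero_le _, ?_⟩)
  refine Ok.seq (Ok.of_wp ⟨Nat.zero_le _, ?_⟩)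
  refine Ok.seq (Ok.of_wp ⟨Nat.zero_le _, ?_⟩)
  refine Ok.seq (Ok.of_wp ⟨Nat.zero_le _, ?_⟩)
  have hr : Ready D ((((σ.setReg 26 0).setReg 27 0).setReg 28 0).setReg 29 0) [] := by
    refine ⟨(((hE.setReg (by decide)).setReg (by decide)).setReg (by decide)).setReg (by decide),
      hA, hN, ⟨List.nodup_nil, fun x y => ?_, by simp⟩, by simp⟩
    rw [bit_of_not (by simp)]
    exact h0 _ (index_lt x y).le
  refine (ok_search hB hr ⟨by simp, by simp, by simp [Scanned], by simp⟩).imp ?_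
  rintro t τ - hf ⟨hm, hS, hor, ht⟩
  refine ⟨⟨hr.frame hm hf (by decide), (hf 26 (by decide)).trans (by simp), by simp [Processed],
    hS, hor⟩, ?_⟩
  have h₁ := hS.le₁
  have h₂ := hS.le₂
  simp at ht h₁
  have : unitCost n * (τ.reg 27 + τ.reg 28 + 1) ≤ unitCost n * (n + 1) :=
    Nat.mul_le_mul_left _ (by omega)
  omega

end MainLoop

end ComparabilityDigraph

namespace ComparabilityDigraph

open RAM

/-! ### Detecting conflicts and topological sorting. -/

section Output

variable {n B : ℕ} {T : Fin n → Fin n → Prop}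

/-- `reg 25` becomes 1 if the matrix in block 2 holds some pair together with its inverse, and 0
otherwise. -/
def conflictTest : Stmt :=
  .seq (.const 25 0) <| forLoop 20 2 <| forLoop 21 2 <|
    .seq (getCell 14 6 20 21) <| .seq (getCell 15 6 21 20) <| .seq (.mul 14 14 15) <|
    .ite (.eq 14 5) .skip (.const 25 1)

theorem ok_conflictTest {σ : Store} (hB : 8 * (n * n + 1) ≤ B) (hE : Env n σ)
    (hT : IsMatrix n σ.mem 2 T) :
    Ok B conflictTest σ fun t τ => t ≤ (33 * n + 6) * n + 5 ∧ τ.mem = σ.mem ∧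
      τ.reg 25 = bit (∃ x y, T x y ∧ T y x) := by
  let bad : (ℕ → ℕ → Prop) → Prop := fun P => ∃ x y : Fin n, P x y ∧ T x y ∧ T y x
  refine .seq (Ok.of_wp ⟨by omega, ?_⟩)
  refine Ok.forLoop n (33 * n + 3) (fun i τ => τ.mem = σ.mem ∧
    τ.reg 25 = bit (bad fun x _ => x < i)) (by decide) (by simp [hE.r3]) (by simp [hE.r2])
    ⟨rfl, by simp [bad, bit_of_not]⟩ ?_ ?_
  · rintro i hi τ hτ ⟨hm, hg⟩ h20 hf
    have hE' : Env n τ := (hE.setReg (by decide)).frame hf (by decide)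
    refine Ok.forLoop n 30 (fun j τ' => τ'.mem = σ.mem ∧
      τ'.reg 25 = bit (bad fun x y => x < i ∨ (x = i ∧ y < j))) (by decide) hE'.r3 hE'.r2
      ⟨hm, by simp [hg]⟩ ?_ ?_
    · rintro j hj ρ hρ ⟨hm', hg'⟩ h21 hf'
      have hE'' : Env n ρ := hE'.frame hf' (by decide)
      have h20' : ρ.reg 20 = i := (hf' 20 (by decide)).trans h20
      have a1 := hT ⟨i, hi⟩ ⟨j, hj⟩
      have a2 := hT ⟨j, hj⟩ ⟨i, hi⟩
      have split : (bad fun x y => x < i ∨ (x = i ∧ y < j + 1)) ↔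
          ((bad fun x y => x < i ∨ (x = i ∧ y < j)) ∨
            (T ⟨i, hi⟩ ⟨j, hj⟩ ∧ T ⟨j, hj⟩ ⟨i, hi⟩)) := by
        constructor
        · rintro ⟨x, y, hxy, h⟩
          by_cases e : (x : ℕ) = i ∧ (y : ℕ) = j
          · obtain rfl : x = ⟨i, hi⟩ := Fin.ext e.1
            obtain rfl : y = ⟨j, hj⟩ := Fin.ext e.2
            exact Or.inr h
          · exact Or.inl ⟨x, y, by omega, h⟩
        · rintro (⟨x, y, hxy, h⟩ | h)
          · exact ⟨x, y, by omega, h⟩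
          · exact ⟨_, _, Or.inr ⟨rfl, Nat.lt_succ_self j⟩, h⟩
      refine .seq (ok_getCell hB (X := ⟨i, hi⟩) (Y := ⟨j, hj⟩) hE''.r2 hE''.r6 h20' h21 ?_)
      refine .seq (ok_getCell hB (X := ⟨j, hj⟩) (Y := ⟨i, hi⟩) (k := 2) (by simp [hE''.r2])
        (by simp [hE''.r6]) (by simp [h21]) (by simp [h20']) ?_)
      apply Ok.of_wp
      simp only [wp, Store.setReg_reg, Store.setReg_mem, hm', a1, a2]
      have h₁ := bit_le (T ⟨i, hi⟩ ⟨j, hj⟩ ∧ T ⟨j, hj⟩ ⟨i, hi⟩)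
      simp only [propext split]
      simp [Test.eval, hE''.r5, hg', bit_mul_bit]
      refine ⟨by omega, fun h => ?_, fun h h' => ⟨by omega, (bit_of (Or.inr ⟨h, h'⟩)).symm⟩⟩
      congr 1
      simp only [eq_iff_iff, iff_self_or]
      tauto
    · rintro t ρ ⟨hm', hg'⟩ h21 hf' ht
      refine ⟨by omega, by simp [hm'], ?_⟩
      simp only [Store.setReg_reg]
      rw [if_neg (by decide), hg']
      congr 1
      simp only [bad, eq_iff_iff]
      exact ⟨fun ⟨x, y, hxy, h⟩ => ⟨x, y, by omega, h⟩, fun ⟨x, y, hxy, h⟩ => ⟨x, y, by omega, h⟩⟩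
  · rintro t τ ⟨hm, hg⟩ - hf ht
    refine ⟨by ring_nf at ht ⊢; omega, hm, ?_⟩
    rw [hg]
    congr 1
    simp [bad]

theorem val_le_sq (v : Fin n) : (v : ℕ) ≤ n * n :=
  v.2.le.trans (Nat.le_mul_self n)

/-- The vertices marked in block 6 are those in `U`. -/
def Marks (m : ℕ → ℕ) (U : Fin n → Prop) : Prop := ∀ v : Fin n, m (cell n 6 v) = bit (U v)

/-- `v` is a minimal element of the complement of `U`. -/
def IsFree (T : Fin n → Fin n → Prop) (U : Fin n → Prop) (v : Fin n) : Prop :=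
  ¬ U v ∧ ∀ u, ¬ U u → ¬ T u v

/-- `reg 26` becomes 1 if no unmarked vertex precedes the vertex in `reg 21`. -/
def minimalTest : Stmt :=
  .seq (.const 26 1) <| forLoop 22 2 <| .seq (getAt 14 10 22) <| .seq (getCell 15 6 22 21) <|
    .ite (.eq 14 5) (.ite (.eq 15 5) .skip (.const 26 0)) .skip

theorem ok_minimalTest {σ : Store} {U : Fin n → Prop} {v : Fin n} (hB : 8 * (n * n + 1) ≤ B)
    (hE : Env n σ) (hT : IsMatrix n σ.mem 2 T) (hU : Marks σ.mem U) (h21 : σ.reg 21 = v) :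
    Ok B minimalTest σ fun t τ => t ≤ 23 * n + 5 ∧ τ.mem = σ.mem ∧
      τ.reg 26 = bit (∀ u, ¬ U u → ¬ T u v) := by
  refine .seq (Ok.of_wp ⟨by omega, ?_⟩)
  refine Ok.forLoop n 20 (fun i τ => τ.mem = σ.mem ∧
    τ.reg 26 = bit (∀ u : Fin n, (u : ℕ) < i → ¬ U u → ¬ T u v)) (by decide) (by simp [hE.r3])
    (by simp [hE.r2]) ⟨rfl, by simp [bit_of]⟩ ?_ ?_
  · rintro i hi τ - ⟨hm, hg⟩ h22 hf
    have hE' : Env n τ := (hE.setReg (by decide)).frame hf (by decide)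
    have h21' : τ.reg 21 = v := (hf 21 (by decide)).trans (by simpa using h21)
    have a1 := hU ⟨i, hi⟩
    have a2 := hT ⟨i, hi⟩ v
    have split : (∀ u : Fin n, (u : ℕ) < i + 1 → ¬ U u → ¬ T u v) ↔
        (∀ u : Fin n, (u : ℕ) < i → ¬ U u → ¬ T u v) ∧ (¬ U ⟨i, hi⟩ → ¬ T ⟨i, hi⟩ v) := by
      constructor
      · exact fun h => ⟨fun u hu => h u (by omega), h _ (Nat.lt_succ_self i)⟩
      · rintro ⟨h, h'⟩ u hu
        rcases Nat.lt_succ_iff_lt_or_eq.1 hu with hu | hu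
        · exact h u hu
        · obtain rfl : u = ⟨i, hi⟩ := Fin.ext hu
          exact h'
    refine .seq (ok_getAt hB hE'.r10 h22 (val_le_sq ⟨i, hi⟩) ?_)
    refine .seq (ok_getCell hB (X := ⟨i, hi⟩) (Y := v) (k := 2) (by simp [hE'.r2])
      (by simp [hE'.r6]) (by simp [h22]) (by simp [h21']) ?_)
    apply Ok.of_wp
    simp only [wp, Store.setReg_reg, Store.setReg_mem, hm, a1, a2, propext split]
    simp [Test.eval, hE'.r5, hg]
    refine ⟨fun h₁ => ⟨fun h₂ => ?_, fun h₂ => ?_⟩, fun h₁ => ?_⟩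
    · congr 1
      simp only [eq_iff_iff, iff_self_and]
      tauto
    · refine (bit_of_not ?_).symm
      tauto
    · congr 1
      simp only [eq_iff_iff, iff_self_and]
      tauto
  · rintro t τ ⟨hm, hg⟩ - - ht
    exact ⟨by omega, hm, by rw [hg]; simp⟩

/-- Put a minimal unmarked vertex into `reg 25`. -/
def selectMinimal : Stmt :=
  forLoop 21 2 <| .seq (getAt 14 10 21) <| .ite (.eq 14 5)
    (.seq minimalTest (.ite (.eq 26 3) (.move 25 21) .skip)) .skip

theorem ok_selectMinimal {σ : Store} {U : Fin n → Prop} (hB : 8 * (n * n + 1) ≤ B)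
    (hE : Env n σ) (hT : IsMatrix n σ.mem 2 T) (hU : Marks σ.mem U) (hex : ∃ v, IsFree T U v) :
    Ok B selectMinimal σ fun t τ => t ≤ (23 * n + 20) * n + 3 ∧ τ.mem = σ.mem ∧
      ∃ v : Fin n, τ.reg 25 = v ∧ IsFree T U v := by
  refine Ok.forLoop n (23 * n + 17) (fun i τ => τ.mem = σ.mem ∧
    ((∃ v : Fin n, τ.reg 25 = v ∧ IsFree T U v) ∨ ∀ v : Fin n, (v : ℕ) < i → ¬ IsFree T U v)) (by decide)
    hE.r3 hE.r2 ⟨rfl, Or.inr (by simp)⟩ ?_ ?_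
  · rintro i hi τ - ⟨hm, hg⟩ h21 hf
    have hE' : Env n τ := hE.frame hf (by decide)
    have keep : ¬ IsFree T U ⟨i, hi⟩ → (∃ v : Fin n, τ.reg 25 = v ∧ IsFree T U v) ∨
        ∀ v : Fin n, (v : ℕ) < i + 1 → ¬ IsFree T U v := by
      intro hn
      refine hg.imp_right fun h v hv => ?_
      rcases Nat.lt_succ_iff_lt_or_eq.1 hv with hv | hv
      · exact h v hv
      · obtain rfl : v = ⟨i, hi⟩ := Fin.ext hv
        exact hn
    refine .seq (ok_getAt hB hE'.r10 h21 (val_le_sq ⟨i, hi⟩) ?_)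
    refine .ite (fun hb => ?_) (fun hb => ?_)
    · have hn : ¬ U ⟨i, hi⟩ := by
        simpa [Test.eval, hm, hU ⟨i, hi⟩, hE'.r5] using hb
      refine .seq ((ok_minimalTest (v := ⟨i, hi⟩) hB
        ((hE'.setReg (by decide)).setReg (by decide)) (by simpa [hm] using hT)
        (by simpa [hm] using hU) (by simpa using h21)).imp ?_)
      rintro t₁ τ₁ - hf₁ ⟨ht₁, hm₁, h26⟩
      have h3 : τ₁.reg 3 = 1 := (hf₁ 3 (by decide)).trans (by simp [hE'.r3])
      have h21₁ : τ₁.reg 21 = i := (hf₁ 21 (by decide)).trans (by simpa using h21)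
      have h25₁ : τ₁.reg 25 = τ.reg 25 := (hf₁ 25 (by decide)).trans (by simp)
      simp only [Store.setReg_mem, hm] at hm₁
      refine .ite (fun hb' => Ok.of_wp ?_) (fun hb' => .skip ?_)
      · simp only [Test.eval, h26, h3, decide_eq_true_eq, bit_eq_one] at hb'
        exact ⟨by omega, hm₁, Or.inl ⟨⟨i, hi⟩, by simp [h21₁], hn, hb'⟩⟩
      · simp only [Test.eval, h26, h3, decide_eq_false_iff_not, bit_eq_one] at hb'
        refine ⟨by omega, hm₁, ?_⟩
        simpa [h25₁] using keep fun h => hb' h.2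
    · have hn : U ⟨i, hi⟩ := by
        simpa [Test.eval, hm, hU ⟨i, hi⟩, hE'.r5] using hb
      refine .skip ⟨by omega, by simp [hm], ?_⟩
      simpa using keep fun h => h.1 hn
  · rintro t τ ⟨hm, hg⟩ - - ht
    refine ⟨by ring_nf at ht ⊢; omega, hm, hg.resolve_right fun h => ?_⟩
    obtain ⟨v, hv⟩ := hex
    exact h v v.2 hv

/-- `l` is an initial part of a vertex ordering that extends `T`. -/
structure IsInitialPart (T : Fin n → Fin n → Prop) (l : List (Fin n)) : Prop where
  nodup : l.Nodup
  sorted : l.Pairwise fun a b => ¬ T b a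
  lower : ∀ x, ∀ y ∈ l, T x y → x ∈ l

theorem IsInitialPart.append {l : List (Fin n)} (h : IsInitialPart T l) {v : Fin n}
    (hT : ¬ T v v) (hv : IsFree T (· ∈ l) v) : IsInitialPart T (l ++ [v]) := by
  refine ⟨?_, ?_, ?_⟩
  · rw [List.nodup_append]
    refine ⟨h.nodup, by simp, ?_⟩
    rintro a ha b hb rfl
    obtain rfl : a = v := by simpa using hb
    exact hv.1 ha
  · rw [List.pairwise_append]
    refine ⟨h.sorted, by simp, ?_⟩
    intro a ha b hb hba
    obtain rfl : b = v := by simpa using hb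
    exact hv.1 (h.lower b a ha hba)
  · intro x y hy hxy
    rw [List.mem_append] at hy ⊢
    rcases hy with hy | hy
    · exact Or.inl (h.lower x y hy hxy)
    · obtain rfl : y = v := by simpa using hy
      exact Or.inl (by_contra fun hx => hv.2 x hx hxy)

/-- On a finite set the transitive closure of an acyclic relation is well-founded, so the vertices
not yet listed have a minimal element. -/
theorem exists_isFree (hT : ∀ x, ¬ Relation.TransGen T x x) {l : List (Fin n)}
    (hl : l.length < n) : ∃ v, IsFree T (· ∈ l) v := by
  have : IsTrans (Fin n) (Relation.TransGen T) := ⟨fun _ _ _ => Relation.TransGen.trans⟩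
  have : Std.Irrefl (Relation.TransGen T) := ⟨hT⟩
  have hwf := Finite.wellFounded_of_trans_of_irrefl (Relation.TransGen T)
  have hne : {v | v ∉ l}.Nonempty := by
    by_contra hne
    have hall : ∀ v, v ∈ l := fun v => by_contra fun hv => hne ⟨v, hv⟩
    have h₁ : (Finset.univ : Finset (Fin n)) ⊆ l.toFinset := fun v _ => by simpa using hall v
    have h₂ := (Finset.card_le_card h₁).trans l.toFinset_card_le
    simp at h₂
    omega
  exact ⟨hwf.min _ hne, hwf.min_mem _ hne, fun u hu h => hwf.not_lt_min _ hu (.single h)⟩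

/-- A complete list gives a permutation. -/
theorem IsInitialPart.exists_perm {l : List (Fin n)} (h : IsInitialPart T l)
    (hT : ∀ x, ¬ T x x) (hl : l.length = n) :
    ∃ p : Equiv.Perm (Fin n), (∀ i : Fin n, p i = l[i]) ∧ ∀ x y, T x y → listingOrder p x y := by
  have hinj : Function.Injective fun i : Fin n => l[i] := fun i j hij =>
    Fin.ext ((h.nodup.getElem_inj_iff).1 hij)
  let p := Equiv.ofBijective _ (Finite.injective_iff_bijective.1 hinj)
  refine ⟨p, fun i => rfl, fun x y hxy => ?_⟩
  by_contra hle
  have hx : l[p.symm x] = x := p.apply_symm_apply x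
  have hy : l[p.symm y] = y := p.apply_symm_apply y
  rcases lt_or_eq_of_le (not_lt.1 hle) with hlt | heq
  · have := List.pairwise_iff_getElem.1 h.sorted (p.symm y) (p.symm x) (by omega) (by omega) hlt
    rw [show l[(p.symm x : ℕ)] = x from hx, show l[(p.symm y : ℕ)] = y from hy] at this
    exact this hxy
  · obtain rfl := p.symm.injective heq
    exact hT _ hxy

/-- Write a vertex ordering that extends the matrix in block 2 to block 7. -/
def topologicalSort : Stmt :=
  .seq (forLoop 20 2 (setAt 10 20 5)) <| forLoop 20 2 <|
    .seq selectMinimal <| .seq (setAt 1 20 25) (setAt 10 25 3)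

/-- There are `n` rounds, and each finds a minimal remaining vertex by brute force in quadratic
time, which the cubic bound permits. -/
theorem ok_topologicalSort {σ : Store} (hB : 8 * (n * n + 1) ≤ B) (hE : Env n σ)
    (hM : IsMatrix n σ.mem 2 T) (hT : ∀ x, ¬ Relation.TransGen T x x) :
    Ok B topologicalSort σ fun t τ => t ≤ ((23 * n + 20) * n + 23) * n + 7 ∧
      ∃ p : Equiv.Perm (Fin n), (∀ i : Fin n, τ.mem (cell n 7 i) = p i) ∧
        ∀ x y, T x y → listingOrder p x y := by
  refine .seq ?_
  refine Ok.forLoop n 3 (fun i τ => IsMatrix n τ.mem 2 T ∧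
    ∀ v : Fin n, (v : ℕ) < i → τ.mem (cell n 6 v) = 0) (by decide) hE.r3 hE.r2
    ⟨hM, by simp⟩ ?_ ?_
  · rintro i hi τ - ⟨hm, hz⟩ h20 hf
    have hE' : Env n τ := hE.frame hf (by decide)
    refine ok_setAt hB hE'.r10 h20 (val_le_sq ⟨i, hi⟩) ⟨le_rfl, ?_, ?_⟩
    · exact hm.update_of_ne (by decide) (val_le_sq ⟨i, hi⟩)
    · intro v hv
      simp only [Store.setReg_mem, Store.setMem_mem]
      rw [update_cell (val_le_sq ⟨i, hi⟩) (val_le_sq v), hE'.r5]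
      split_ifs with h
      · rfl
      · exact hz v (by simp at h; omega)
  rintro t₀ σ₀ ⟨hM₀, hz⟩ - hf₀ ht₀
  have hE₀ : Env n σ₀ := hE.frame hf₀ (by decide)
  refine Ok.forLoop n ((23 * n + 20) * n + 14) (fun i τ => IsMatrix n τ.mem 2 T ∧
    ∃ l, IsInitialPart T l ∧ l.length = i ∧ Marks τ.mem (· ∈ l) ∧
      ∀ (j : ℕ) (hj : j < l.length), τ.mem (cell n 7 j) = l[j]) (by decide) hE₀.r3 hE₀.r2
    ⟨hM₀, [], ⟨by simp, by simp, by simp⟩, rfl, ?_, by simp⟩ ?_ ?_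
  · intro v
    rw [bit_of_not (by simp)]
    exact hz v v.2
  · rintro i hi τ - ⟨hm, l, hl, hlen, hU, hout⟩ h20 hf
    have hE' : Env n τ := hE₀.frame hf (by decide)
    refine .seq ((ok_selectMinimal hB hE' hm hU (exists_isFree hT (by omega))).imp ?_)
    rintro t₁ τ₁ - hf₁ ⟨ht₁, hm₁, v, h25, hv⟩
    have hE₁ : Env n τ₁ := hE'.frame hf₁ (by decide)
    have h20₁ : τ₁.reg 20 = i := (hf₁ 20 (by decide)).trans h20
    refine .seq (ok_setAt hB hE₁.r1 h20₁ (val_le_sq ⟨i, hi⟩) ?_)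
    refine ok_setAt (k := 6) hB (by simp [hE₁.r10]) (by simpa using h25) (val_le_sq v) ?_
    have hmem : ∀ {w a b c d : ℕ}, (((((τ₁.setReg 11 a).setMem b (τ₁.reg 25)).setReg 11 c).setMem
        d (((τ₁.setReg 11 a).setMem b (τ₁.reg 25)).reg 3)).setReg 20 w).mem =
        Function.update (Function.update τ.mem b v) d 1 := by
      simp [Store.setMem_mem, hm₁, hE₁.r3, h25]
    refine ⟨by omega, ?_, l ++ [v], hl.append (fun h => hT v (.single h)) hv, by simp [hlen],
      ?_, ?_⟩
    · rw [hmem]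
      exact (hm.update_of_ne (by decide) (val_le_sq ⟨i, hi⟩)).update_of_ne (by decide)
        (val_le_sq v)
    · intro u
      rw [hmem, update_cell (val_le_sq v) (val_le_sq u)]
      split_ifs with h
      · obtain rfl : u = v := Fin.ext h.2
        rw [bit_of (by simp)]
      · rw [update_cell_of_ne (val_le_sq ⟨i, hi⟩) (val_le_sq u) (by decide), hU u]
        have : u ≠ v := fun e => h ⟨rfl, by rw [e]⟩
        simp [this]
    · intro j hj
      have hj' : j ≤ i := by
        simp at hj
        omega
      have hjn : j ≤ n * n := val_le_sq ⟨j, by omega⟩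
      rw [hmem, update_cell_of_ne (val_le_sq v) hjn (by decide),
        update_cell (val_le_sq ⟨i, hi⟩) hjn]
      split_ifs with h
      · obtain rfl : j = i := h.2
        simp [← hlen]
      · have hjl : j < l.length := by
          simp at h
          omega
        rw [hout j hjl, List.getElem_append_left hjl]
  · rintro t τ ⟨-, l, hl, hlen, -, hout⟩ - - ht
    obtain ⟨p, hp, hpT⟩ := hl.exists_perm (fun x h => hT x (.single h)) hlen
    refine ⟨by ring_nf at ht ht₀ ⊢; omega, p, fun i => ?_, hpT⟩
    rw [hout i (by omega), hp i]
    rfl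

end Output

end ComparabilityDigraph

namespace ComparabilityDigraph

open RAM

/-! ### The whole program and its outcome. -/

section Program

variable {n B : ℕ} {D : Digraph (Fin n)} {L : Fin n → List (Fin n)}

/-- Read the input and test whether the digraph is semicomplete. -/
def prologue : Stmt := .seq initRegs (.seq readInput semicompleteTest)

theorem ok_prologue {σ : Store} (hB : 8 * (n * n + 1) ≤ B) (hL : IsAdjacencyLists D L)
    (hD : IsLoopless D) (hr : ∀ i, σ.reg i = 0) (hm : ∀ i, σ.mem i = (inputWord L).getD i 0) :
    Ok B prologue σ fun t τ => t ≤ (56 * n + 26) * n + 50 ∧ Env n τ ∧ IsMatrix n τ.mem 1 D.Adj ∧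
      (∀ k p, 2 ≤ k → p ≤ n * n → τ.mem (cell n k p) = 0) ∧
      τ.reg 25 = bit (IsSemicomplete D) := by
  refine .seq ((ok_initRegs hB hr (by simp [hm, inputWord])).imp ?_)
  rintro t₁ τ₁ - - ⟨ht₁, hm₁, hE₁⟩
  refine .seq ((ok_readInput hB hE₁ hL hD (by simpa [hm₁] using hm)).imp ?_)
  rintro t₂ τ₂ - hf₂ ⟨ht₂, hA, h0⟩
  have hE₂ : Env n τ₂ := hE₁.frame hf₂ (by decide)
  refine (ok_semicompleteTest hB hE₂ hA).imp ?_
  rintro t₃ τ₃ - hf₃ ⟨ht₃, hm₃, h25⟩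
  refine ⟨?_, hE₂.frame hf₃ (by decide), hm₃ ▸ hA, hm₃ ▸ h0, h25⟩
  ring_nf at ht₂ ht₃ ⊢
  omega

/-- Prepare the main loop. -/
def prepareMain : Stmt := .seq markLinked startMain

theorem ok_prepareMain {σ : Store} (hB : 8 * (n * n + 1) ≤ B) (hE : Env n σ)
    (hA : IsMatrix n σ.mem 1 D.Adj) (h0 : ∀ k p, 2 ≤ k → p ≤ n * n → σ.mem (cell n k p) = 0) :
    Ok B prepareMain σ fun t τ => MainInvariant D [] τ ∧
      t ≤ ((103 * n + 6) * n + 6) * n + unitCost n * (n + 1) + 34 := by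
  refine .seq ((ok_markLinked hB hE hA h0).imp ?_)
  rintro t₁ τ₁ - hf₁ ⟨ht₁, hN, hk⟩
  have hE₁ : Env n τ₁ := hE.frame hf₁ (by decide)
  have hA₁ : IsMatrix n τ₁.mem 1 D.Adj := fun x y => by
    rw [hk 1 _ (by decide) (index_lt x y).le, hA x y]
  refine (ok_startMain hB hE₁ hA₁ hN fun p hp => ?_).imp ?_
  · rw [hk 2 p (by decide) hp, h0 2 p le_rfl hp]
  · rintro t τ - - ⟨hI, ht⟩
    exact ⟨hI, by omega⟩

/-- Answer no if the set in block 2 contains a pair together with its inverse; otherwise write an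
ordering that extends this set and answer yes. -/
def epilogue : Stmt :=
  .seq conflictTest <| .ite (.eq 25 3) .skip <| .seq topologicalSort (.const 0 1)

theorem ok_epilogue {T : Fin n → Fin n → Prop} {σ : Store} (hB : 8 * (n * n + 1) ≤ B)
    (hE : Env n σ) (hM : IsMatrix n σ.mem 2 T)
    (hT : (¬ ∃ x y, T x y ∧ T y x) → ∀ x, ¬ Relation.TransGen T x x) :
    Ok B epilogue σ fun t τ => t ≤ ((23 * n + 53) * n + 29) * n + 20 ∧
      (((∃ x y, T x y ∧ T y x) ∧ AnswersNo τ) ∨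
        ((¬ ∃ x y, T x y ∧ T y x) ∧ AnswersYes τ ∧ ∃ p : Equiv.Perm (Fin n),
          ReturnsOrdering τ p ∧ ∀ x y, T x y → listingOrder p x y)) := by
  refine .seq ((ok_conflictTest hB hE hM).imp ?_)
  rintro t₁ τ₁ - hf₁ ⟨ht₁, hm₁, h25⟩
  have hE₁ : Env n τ₁ := hE.frame hf₁ (by decide)
  refine .ite (fun hb => ?_) (fun hb => ?_)
  · simp only [Test.eval, h25, hE₁.r3, decide_eq_true_eq, bit_eq_one] at hb
    refine .skip ⟨by ring_nf at ht₁ ⊢; omega, Or.inl ⟨hb, hE₁.r0⟩⟩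
  · simp only [Test.eval, h25, hE₁.r3, decide_eq_false_iff_not, bit_eq_one] at hb
    refine .seq ((ok_topologicalSort hB hE₁ (hm₁ ▸ hM) (hT hb)).imp ?_)
    rintro t₂ τ₂ - hf₂ ⟨ht₂, p, hp, hpT⟩
    have hE₂ : Env n τ₂ := hE₁.frame hf₂ (by decide)
    refine Ok.of_wp ⟨by omega, by ring_nf at ht₁ ht₂ ⊢; omega, Or.inr ⟨hb, by simp [AnswersYes],
      p, fun i => ?_, hpT⟩⟩
    simp only [Store.setReg_mem, Store.setReg_reg, if_neg (show ¬ (1 : ℕ) = 0 by decide), hE₂.r1]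
    exact hp i

/-- The loop that collects the implication classes. -/
def mainLoop : Stmt := .loop (.eq 30 3) collectClass

/-- The recognition program. -/
def program : Stmt :=
  .seq prologue <| .ite (.eq 25 3) (.seq prepareMain (.seq mainLoop epilogue)) .skip

/-- From the store `σ`, the program halts after `N` steps in the store `τ`. -/
structure Outcome (n B N : ℕ) (σ τ : Store) : Prop where
  final : step^[N] ⟨[program], σ⟩ = ⟨[], τ⟩
  bounded : ∀ t ≤ N, (step^[t] ⟨[program], σ⟩).store.Bounded B
  time : N ≤ 20000 * (n ^ 3 + 1)

theorem sq_le_cube (n : ℕ) : n ^ 2 ≤ n ^ 3 := by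
  rcases n.eq_zero_or_pos with rfl | h
  · simp
  · exact Nat.pow_le_pow_right h (by decide)

theorem exists_outcome_of_not_semicomplete {σ : Store} (hB : 8 * (n * n + 1) ≤ B)
    (hσ : σ.Bounded B) (hL : IsAdjacencyLists D L) (hD : IsLoopless D) (hr : ∀ i, σ.reg i = 0)
    (hm : ∀ i, σ.mem i = (inputWord L).getD i 0) (hS : ¬ IsSemicomplete D) :
    ∃ N τ, Outcome n B N σ τ ∧ AnswersNo τ := by
  have hok : Ok B program σ fun t τ => t ≤ (56 * n + 26) * n + 60 ∧ AnswersNo τ := by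
    refine .seq ((ok_prologue hB hL hD hr hm).imp ?_)
    rintro t₁ τ₁ - hf₁ ⟨ht₁, hE, hA, h0, h25⟩
    refine .ite (fun hb => ?_) (fun hb => .skip ⟨by omega, hE.r0⟩)
    simp only [Test.eval, h25, hE.r3, decide_eq_true_eq, bit_eq_one] at hb
    exact absurd hb hS
  obtain ⟨N, τ, ⟨hN, hτ⟩, hex⟩ := hok hσ
  refine ⟨N, τ, ⟨(hex []).1, (hex []).2, ?_⟩, hτ⟩
  have h₁ : n ^ 2 ≤ n ^ 3 := sq_le_cube n
  have h₂ : n ≤ n ^ 3 := Nat.le_self_pow (by decide) n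
  ring_nf at hN ⊢
  omega

theorem MainInvariant.linked_mem {σ : Store} {q : List (Fin n × Fin n)}
    (h : MainInvariant D q σ) (hb : Test.eval σ (.eq 30 3) = false) {x y : Fin n}
    (hl : Linked D x y) : heldPairs n σ x y ∨ heldPairs n σ y x := by
  simp only [Test.eval, h.ready.env.r3, decide_eq_false_iff_not] at hb
  have hno := (h.seed.resolve_right fun h' => hb h'.1).2 x y
  rw [h.ready.heldPairs_iff, h.ready.heldPairs_iff]
  by_contra hcon
  rw [not_or] at hcon
  exact hno ⟨hl, hcon.1, hcon.2⟩

/-- On semicomplete digraphs, the main loop collects the sets `S 0, …, S m` of an execution. -/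
theorem exists_outcome_of_semicomplete {σ : Store} (hB : 8 * (n * n + 1) ≤ B)
    (hσ : σ.Bounded B) (hL : IsAdjacencyLists D L) (hD : IsLoopless D) (hr : ∀ i, σ.reg i = 0)
    (hm : ∀ i, σ.mem i = (inputWord L).getD i 0) (hS : IsSemicomplete D) :
    ∃ N τ, Outcome n B N σ τ ∧ ∃ (m : ℕ) (S : ℕ → Fin n → Fin n → Prop) (time : ℕ → ℕ),
      IsLoopExecution D m (fun i => stateOf D (S i)) ∧ LoopInvariant D (S m) ∧
      (∀ x y, Linked D x y → S m x y ∨ S m y x) ∧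
      (∀ i < m, time i < time (i + 1)) ∧ time m ≤ N ∧
      (∀ i ≤ m, heldPairs n (step^[time i] ⟨[program], σ⟩).store = S i) ∧
      ((FirstTest D ∧ AnswersNo τ) ∨ (¬ FirstTest D ∧ AnswersYes τ ∧
        ∃ p : Equiv.Perm (Fin n), ReturnsOrdering τ p ∧ ∀ x y, S m x y → listingOrder p x y)) := by
  obtain ⟨t₁, σ₁, ⟨ht₁, hE₁, hA₁, h0₁, h25⟩, e₁⟩ := ok_prologue hB hL hD hr hm hσ
  obtain ⟨t₂, σ₂, ⟨hI₂, ht₂⟩, e₂⟩ := ok_prepareMain hB hE₁ hA₁ h0₁ e₁.bounded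
  -- The extra steps unfold the outer sequence, the conditional and the two inner sequences.
  have start : step^[1 + t₁ + (2 + t₂ + 1)] ⟨[program], σ⟩ = ⟨[mainLoop, epilogue], σ₂⟩ ∧
      ∀ t ≤ 1 + t₁ + (2 + t₂ + 1), (step^[t] ⟨[program], σ⟩).store.Bounded B := by
    have a : step^[1 + t₁] ⟨[program], σ⟩ =
        ⟨[.ite (.eq 25 3) (.seq prepareMain (.seq mainLoop epilogue)) .skip], σ₁⟩ := by
      rw [add_comm, Function.iterate_add_apply]
      exact (e₁ _).1
    have b : step^[2] ⟨[.ite (.eq 25 3) (.seq prepareMain (.seq mainLoop epilogue)) .skip], σ₁⟩ =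
        ⟨[prepareMain, .seq mainLoop epilogue], σ₁⟩ := by
      simp [step, Test.eval, h25, hE₁.r3, bit_of hS]
    have c : step^[2 + t₂]
        ⟨[.ite (.eq 25 3) (.seq prepareMain (.seq mainLoop epilogue)) .skip], σ₁⟩ =
        ⟨[.seq mainLoop epilogue], σ₂⟩ := by
      rw [add_comm, Function.iterate_add_apply, b, (e₂ _).1]
    refine ⟨?_, ?_⟩
    · rw [add_comm, Function.iterate_add_apply, a, add_comm, Function.iterate_add_apply, c]
      rfl
    · refine bounded_trans a (bounded_trans (c₁ := ⟨[prologue, _], σ⟩) rfl ?_ (e₁ _).2)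
        (bounded_trans c (bounded_trans b ?_ (e₂ _).2) ?_)
      · intro t ht
        rcases (show t = 0 ∨ t = 1 by omega) with rfl | rfl <;> exact hσ
      · intro t ht
        rcases (show t = 0 ∨ t = 1 ∨ t = 2 by omega) with rfl | rfl | rfl
        · exact e₁.bounded
        · exact e₁.bounded
        · rw [b]
          exact e₁.bounded
      · intro t ht
        rcases (show t = 0 ∨ t = 1 by omega) with rfl | rfl <;> exact e₂.bounded
  -- A plain loop rule would keep only the final store; here the stores at the loop head are needed,
  -- since they hold the successive sets of the execution.
  obtain ⟨m, ss, time, g0, g1, g2, ⟨q, g3⟩, g4, g5, g6⟩ := exists_trace (B := B) (b := .eq 30 3)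
    (s := collectClass) (fun τ => ∃ q, MainInvariant D q τ) (work n)
    (fun τ τ' => CollectStep D (heldPairs n τ) (heldPairs n τ'))
    (unitCost n * (4 * (n * n) + n)) (fun τ ⟨q, h⟩ => work_le h)
    (fun τ ⟨q, h⟩ hb => ok_collectClass hB h (by
      simpa [Test.eval, h.ready.env.r3] using hb)) e₂.bounded ⟨[], hI₂⟩
  have hmax : ∀ x y, Linked D x y → heldPairs n (ss m) x y ∨ heldPairs n (ss m) y x :=
    fun x y hl => g3.linked_mem g4 hl
  obtain ⟨hex, hinv⟩ := isLoopExecution_of_collectStep (S := fun i => heldPairs n (ss i)) hS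
    (fun x y => by rw [g0, hI₂.ready.heldPairs_iff]; simp) (fun i hi => (g2 i hi).1) hmax
  have hconf := hinv.conflict_iff hD hmax
  have hbd : (ss m).Bounded B := by
    have := (g6 []).2 (time m) le_rfl
    rwa [(g6 []).1 m le_rfl] at this
  have hM : IsMatrix n (ss m).mem 2 (heldPairs n (ss m)) := by
    rw [g3.ready.heldPairs_eq]
    exact g3.ready.queue.matrix
  -- Absence of conflicts in the final set means that no class is self-inverse, and only then is the
  -- set known to be acyclic and fit for sorting.
  obtain ⟨t₃, τ, ⟨ht₃, hout⟩, e₃⟩ := ok_epilogue hB g3.ready.env hM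
    (fun h => hinv.acyclic (by
      rw [hconf, firstTest_iff, not_not] at h
      exact h)) hbd
  rw [hconf] at hout
  have hloop : ∀ i ≤ m, step^[1 + t₁ + (2 + t₂ + 1) + time i] ⟨[program], σ⟩ =
      ⟨[mainLoop, epilogue], ss i⟩ := by
    intro i hi
    rw [add_comm, Function.iterate_add_apply, start.1]
    exact (g6 _).1 i hi
  have hexit : step^[1] ⟨[mainLoop, epilogue], ss m⟩ = ⟨[epilogue], ss m⟩ := by
    simp [mainLoop, step, g4]
  refine ⟨1 + t₁ + (2 + t₂ + 1) + time m + (1 + t₃), τ, ⟨?_, ?_, ?_⟩, m,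
    fun i => heldPairs n (ss i), fun i => 1 + t₁ + (2 + t₂ + 1) + time i, hex, hinv, hmax,
    fun i hi => ?_, Nat.le_add_right _ _, fun i hi => by rw [hloop i hi], hout⟩
  · rw [add_comm, Function.iterate_add_apply, hloop m le_rfl, add_comm,
      Function.iterate_add_apply, hexit, (e₃ _).1]
  · refine bounded_trans (hloop m le_rfl) (bounded_trans start.1 start.2 (g6 _).2)
      (bounded_trans hexit ?_ (e₃ _).2)
    intro t ht
    rcases (show t = 0 ∨ t = 1 by omega) with rfl | rfl
    · exact hbd
    · rw [hexit]
      exact hbd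
  · have h₁ : n ^ 2 ≤ n ^ 3 := sq_le_cube n
    have h₂ : n ≤ n ^ 3 := Nat.le_self_pow (by decide) n
    have h₃ := g5.trans (work_le g3)
    unfold unitCost at ht₂ h₃
    ring_nf at ht₁ ht₂ ht₃ h₃ ⊢
    omega
  · exact Nat.add_lt_add_left (g2 i hi).2 _

theorem isStrictTotalOrder_listingOrder (p : Equiv.Perm (Fin n)) :
    IsStrictTotalOrder (Fin n) (listingOrder p) :=
  RelEmbedding.isStrictTotalOrder (s := (· < ·)) ⟨p.symm.toEmbedding, Iff.rfl⟩

theorem iterate_step_nil (t : ℕ) (σ : Store) : step^[t] ⟨[], σ⟩ = ⟨[], σ⟩ :=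
  Function.iterate_fixed rfl t

theorem Outcome.bounded_all {N : ℕ} {σ τ : Store} (h : Outcome n B N σ τ) (t : ℕ) :
    (step^[t] ⟨[program], σ⟩).store.Bounded B := by
  rcases le_total t N with ht | ht
  · exact h.bounded t ht
  · obtain ⟨u, rfl⟩ := Nat.exists_eq_add_of_le ht
    have := h.bounded N le_rfl
    rw [add_comm, Function.iterate_add_apply]
    rw [h.final] at this ⊢
    rwa [iterate_step_nil]

end Program

end ComparabilityDigraph

/-- There is one program that, on every loopless digraph with `n` vertices given by adjacency
lists, halts within `O(n³)` steps, with all numbers of `O(log n)` bits; on semicomplete digraphs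
it carries out the algorithm, and an ordering that it returns is a comparability ordering; and it
decides whether the input is a semicomplete comparability digraph. -/
theorem mainTheorem8 :
    ∃ (P : RAM.Stmt) (base : ℕ → ℕ) (a c : ℕ),
      ∀ (n : ℕ) (D : Digraph (Fin n)) (L : Fin n → List (Fin n)),
        IsLoopless D → IsAdjacencyLists D L →
        ∃ N : ℕ, N ≤ a * (n ^ 3 + 1) ∧
          (RAM.run P (inputWord L) N).Halted ∧
          (∀ t i : ℕ, (RAM.run P (inputWord L) t).store.reg i ≤ (n + 2) ^ c ∧
            (RAM.run P (inputWord L) t).store.mem i ≤ (n + 2) ^ c) ∧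
          (IsSemicomplete D →
            CarriesOut P (inputWord L) N (base n) D ∧
            (AnswersYes (RAM.run P (inputWord L) N).store →
              ∃ p : Equiv.Perm (Fin n), ReturnsOrdering (RAM.run P (inputWord L) N).store p ∧
                IsComparabilityOrdering D (listingOrder p))) ∧
          ((IsSemicomplete D ∧ IsComparability D) →
            AnswersYes (RAM.run P (inputWord L) N).store) ∧
          (¬ (IsSemicomplete D ∧ IsComparability D) →
            AnswersNo (RAM.run P (inputWord L) N).store) := by
  -- The base address is that of block 2. The exponent 5 comes from splitting the address bound: `8
  -- ≤ (n + 2) ^ 3` and `n * n + 1 ≤ (n + 2) ^ 2`.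
  refine ⟨program, fun n => 2 * (n * n + 1), 20000, 5, fun n D L hD hL => ?_⟩
  have hB : 8 * (n * n + 1) ≤ (n + 2) ^ 5 := by
    have h₁ : 2 ^ 3 ≤ (n + 2) ^ 3 := Nat.pow_le_pow_left (by omega) 3
    have h₂ : n * n + 1 ≤ (n + 2) ^ 2 := by
      ring_nf
      omega
    calc 8 * (n * n + 1) ≤ (n + 2) ^ 3 * (n + 2) ^ 2 := Nat.mul_le_mul h₁ h₂
      _ = (n + 2) ^ 5 := by ring
  let σ : RAM.Store := ⟨fun _ => 0, fun i => (inputWord L).getD i 0⟩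
  have hσ : σ.Bounded ((n + 2) ^ 5) := by
    refine ⟨fun _ => Nat.zero_le _, fun i => (inputWord_getD_le hL hD i).trans ?_⟩
    have := Nat.le_mul_self n
    omega
  have hrun : ∀ t, RAM.run program (inputWord L) t = RAM.step^[t] ⟨[program], σ⟩ := fun _ => rfl
  simp only [hrun]
  by_cases hS : IsSemicomplete D
  · obtain ⟨N, τ, hO, m, S, time, hex, hinv, hmax, hlt, hle, hheld, hout⟩ :=
      exists_outcome_of_semicomplete hB hσ hL hD (fun _ => rfl) (fun _ => rfl) hS
    refine ⟨N, hO.time, by rw [hO.final]; rfl,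
      fun t i => ⟨(hO.bounded_all t).1 i, (hO.bounded_all t).2 i⟩, fun _ => ⟨?_, ?_⟩, ?_, ?_⟩
    · simp only [CarriesOut, hrun, hO.final]
      refine hout.imp_right ?_
      rintro ⟨hF, hY, p, hp, hpS⟩
      refine ⟨hF, hY, m, _, time, hex, hlt, hle, fun i hi x y => ?_, p, hp, hpS⟩
      exact iff_of_eq (congrFun (congrFun (hheld i hi) x) y)
    all_goals
      rw [hO.final]
      rcases hout with ⟨hF, hA⟩ | ⟨hF, hA, p, hp, hpS⟩
    · intro hY
      simp only [AnswersYes, AnswersNo] at hA hY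
      omega
    · intro _
      rw [firstTest_iff, not_not] at hF
      exact ⟨p, hp, isComparabilityOrdering_of_extends (hinv.sound hF)
        (isStrictTotalOrder_listingOrder p) hpS hmax⟩
    · rintro ⟨-, hC⟩
      exact absurd (hC.noSelfInverse hD) (firstTest_iff.1 hF)
    · exact fun _ => hA
    · exact fun _ => hA
    · intro hn
      rw [firstTest_iff, not_not] at hF
      exact absurd ⟨hS, _, isComparabilityOrdering_of_extends (hinv.sound hF)
        (isStrictTotalOrder_listingOrder p) hpS hmax⟩ hn
  · obtain ⟨N, τ, hO, hA⟩ :=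
      exists_outcome_of_not_semicomplete hB hσ hL hD (fun _ => rfl) (fun _ => rfl) hS
    refine ⟨N, hO.time, by rw [hO.final]; rfl,
      fun t i => ⟨(hO.bounded_all t).1 i, (hO.bounded_all t).2 i⟩, fun h => absurd h hS,
      fun h => absurd h.1 hS, fun _ => ?_⟩
    rw [hO.final]
    exact hA
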